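/- Let $k\ge 1$ be a fixed integer, and for each $n$ let $K_n\le P_n$ be positive integers and $p_n\in[0,1]$. Let $\mathbb{G}(n,K_n,P_n,p_n)$ be the following random graph on the nodes $v_1,\dots,v_n$: each node $v_i$ is independently assigned a uniformly random $K_n$-element subset $S_i$ of a pool of $P_n$ keys; independently of the key sets, each of the $\binom n2$ channels between two distinct nodes is on with probability $p_n$ and off otherwise, independently of the other channels; and two distinct nodes $v_i,v_j$ are joined by an edge if and only if $S_i\cap S_j\neq\emptyset$ and the channel between $v_i$ and $v_j$ is on. A graph is called $k$-connected if it has more than $k$ nodes and remains connected despite the deletion of any at most $k-1$ nodes and edges in total. Suppose that, as $n\to\infty$, $P_n=\Omega(n)$ and $\frac{K_n^2}{P_n}=o\!\left(\frac1{\ln n}\right)$, and define the sequence $\beta_n$ (for $n\ge 2$) by $$p_n\cdot\frac{K_n^2}{P_n}=\frac{\ln n+(k-1)\ln\ln n+\beta_n}{n}.$$ If $\lim_{n\to\infty}\beta_n=\beta^*\in(-\infty,\infty)$, then $$\lim_{n\to\infty}\mathbb{P}\big[\mathbb{G}(n,K_n,P_n,p_n)\text{ is }k\text{-connected}\big]=\exp\!\left(-\frac{e^{-\beta^*}}{(k-1)!}\right).$$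 -/

import Mathlib

open Filter Topology Asymptotics MeasureTheory ProbabilityTheory
open scoped Nat

namespace SecureNetwork

/-- A finite graph is `k`-connected if it has more than `k` nodes and it remains connected despite
the deletion of any set `S` of nodes and any set `F` of links with fewer than `k` deleted objects
in total. -/
def IsKConnected {V : Type*} [Fintype V] (G : SimpleGraph V) (k : ℕ) : Prop :=
  k < Fintype.card V ∧
    ∀ (S : Finset V) (F : Finset (Sym2 V)), S.card + F.card < k →
      ((G.deleteEdges (F : Set (Sym2 V))).induce ((S : Set V)ᶜ)).Connected

/-- The graph on `n` nodes in which two distinct nodes are adjacent if and only if their key rings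
(subsets of a pool of `P` keys) share at least one key. -/
def keyGraph {n P : ℕ} (S : Fin n → Finset (Fin P)) : SimpleGraph (Fin n) where
  Adj i j := i ≠ j ∧ (S i ∩ S j).Nonempty
  symm := ⟨fun _ _ h => ⟨h.1.symm, by rw [Finset.inter_comm]; exact h.2⟩⟩
  loopless := ⟨fun _ h => h.1 rfl⟩

/-- The joint law of the key rings `S_1, …, S_n` and of the graph of the channels that are on:
the key rings are independent and uniform over the `K`-element subsets of a pool of `P` keys,
and, independently of them, every channel is on with probability `p`, independently of the other
channels (an Erdős–Rényi graph). This is a probability measure if `K ≤ P`. -/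
noncomputable def networkMeasure (n K P : ℕ) (p : unitInterval) :
    Measure ((Fin n → Finset (Fin P)) × SimpleGraph (Fin n)) :=
  (Measure.pi fun _ : Fin n => uniformOn {s : Finset (Fin P) | s.card = K}).prod
    (SimpleGraph.binomialRandom (Fin n) p)

/-- The probability that the random graph `𝔾(n, K, P, p)` is `k`-connected, where
`𝔾(n, K, P, p)` is the intersection of the random key graph and the graph of the channels that
are on. -/
noncomputable def probKConnected (n K P : ℕ) (p : unitInterval) (k : ℕ) : ℝ :=
  (networkMeasure n K P p).real {ω | IsKConnected (keyGraph ω.1 ⊓ ω.2) k}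

end SecureNetwork

/-!
Put `d = k - 1`, and call `load = n * p * K ^ 2 / P` the approximate mean degree. The scaling says
precisely that `n * exp (-load) * load ^ d` tends to `exp (-βstar)` (`regime_of_scaling`), so that
the expected number of nodes of degree `d` tends to `exp (-βstar) / d!`. The theorem holds because
this number is asymptotically Poisson, and because the absence of nodes of degree `d` is
asymptotically the only condition for `(d + 1)`-connectivity.

*Exploration of a set of nodes.* Fix a set `A` of nodes and reveal its key rings. Each outside node
then decides independently of the others to which nodes of `A` it is linked
(`netMean_prod_nbrsIn`), and has no link to `A` with probability `missProb`. Hence the probability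
that `A` has at most `J` outside neighbours is about `missProb ^ (n - |A|)`, up to a factor that is
polynomial in the load (`netMean_boundary_card_le`). The number of keys lost to overlaps between
the rings of `A` is called `excess`. If it vanishes, then `missProb` is about
`exp (-p * |A| * K ^ 2 / P)`, and in general every lost key costs a factor of at most
`exp (load / K)` in the power above (`missProb_pow_le`). Since the excess has exponential moments
of Poisson type (`keyMean_pow_excess_le`), overlaps are negligible as long as `A` is not large.

*The Poisson law.* For sets `A` of a fixed size `r` this gives the `r`-th factorial moment of the
number of nodes of degree `d` (`tendsto_degreeMoment`), and the Bonferroni inequalities turn the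
moments into the probability that there is no such node (`tendsto_no_degree`).

*Connectivity.* If the graph is not `(d + 1)`-connected, then some nonempty set `A` of at most half
of the nodes has at most `d` outside neighbours (`exists_boundary_card_lt`). If moreover all
degrees exceed `d`, then `A` contains a link, hence a common key. Such sets are excluded by a union
bound over `A`, in three ranges of the size `r` of `A`:
* for bounded `r`, since an overlap within a bounded set is unlikely (`tendsto_overlapping`);
* for `r ≤ n ^ (1/8)`, since the expected number of such sets is at most `C ^ r / r!` up to a
  constant, which is the tail of a convergent series (`eventually_sum_moderate_le`);
* for larger `r`, the exponential moment is of no use, and one first discards the event that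
  some small set of nodes loses a fixed fraction of its keys to overlaps
  (`tendsto_not_smallOverlap`). Outside this event the power of `missProb` beats the number of sets
  (`tendsto_sum_large`).

All expectations are finite weighted sums (`netMean`), to which the probability measure of the
model is reduced in `networkMeasure_real`.
-/

namespace SecureNetwork

/-! ### Finite expectations for the key rings and the channels -/

/-- The probability that a uniformly random `K`-subset of a pool of `P` keys is `W`. -/
noncomputable def ringWeight {P : ℕ} (K : ℕ) (W : Finset (Fin P)) : ℝ :=
  if W.card = K then ((P.choose K : ℕ) : ℝ)⁻¹ else 0

/-- The expectation of `g W` for a uniformly random `K`-subset `W` of a pool of `P` keys. -/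
noncomputable def ringMean {P : ℕ} (K : ℕ) (g : Finset (Fin P) → ℝ) : ℝ :=
  ∑ W, ringWeight K W * g W

/-- The probability that the family of key rings is `S`. -/
noncomputable def keyWeight {n P : ℕ} (K : ℕ) (S : Fin n → Finset (Fin P)) : ℝ :=
  ∏ i, ringWeight K (S i)

/-- The expectation of a function of the family of key rings. -/
noncomputable def keyMean {n P : ℕ} (K : ℕ) (F : (Fin n → Finset (Fin P)) → ℝ) : ℝ :=
  ∑ S, keyWeight K S * F S

/-- The pairs of distinct nodes. -/
def channels (n : ℕ) : Finset (Sym2 (Fin n)) := Finset.univ.filter fun e => ¬ e.IsDiag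

open Classical in
/-- The probability that the graph of the channels that are on is `G`. -/
noncomputable def chanWeight {n : ℕ} (p : ℝ) (G : SimpleGraph (Fin n)) : ℝ :=
  ∏ e ∈ channels n, if e ∈ G.edgeSet then p else 1 - p

/-- The expectation of a function of the graph of the channels that are on. -/
noncomputable def chanMean {n : ℕ} (p : ℝ) (F : SimpleGraph (Fin n) → ℝ) : ℝ :=
  ∑ G, chanWeight p G * F G

/-- The expectation of a function of the key rings `S` and of the graph `G` of the channels that are
on, which are independent. -/
noncomputable def netMean {n P : ℕ} (K : ℕ) (p : ℝ)
    (F : (Fin n → Finset (Fin P)) → SimpleGraph (Fin n) → ℝ) : ℝ :=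
  keyMean K fun S => chanMean p fun G => F S G

section Means
variable {n P K : ℕ} {p : ℝ}

lemma ringWeight_nonneg (W : Finset (Fin P)) : 0 ≤ ringWeight K W := by
  unfold ringWeight; split_ifs <;> positivity

lemma sum_ringWeight (h : K ≤ P) : ∑ W : Finset (Fin P), ringWeight K W = 1 := by
  have hpos : (0 : ℝ) < (P.choose K : ℕ) := by exact_mod_cast Nat.choose_pos h
  have hc : (Finset.univ.filter fun W : Finset (Fin P) => W.card = K).card = P.choose K := by
    rw [Finset.univ_filter_card_eq]; simp
  simp only [ringWeight, ← Finset.sum_filter, Finset.sum_const, hc, nsmul_eq_mul]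
  exact mul_inv_cancel₀ hpos.ne'

lemma keyWeight_nonneg (S : Fin n → Finset (Fin P)) : 0 ≤ keyWeight K S :=
  Finset.prod_nonneg fun i _ => ringWeight_nonneg (S i)

lemma card_of_keyWeight_ne_zero {S : Fin n → Finset (Fin P)} (h : keyWeight K S ≠ 0) (i : Fin n) :
    (S i).card = K := by
  by_contra hi
  exact h (Finset.prod_eq_zero (Finset.mem_univ i) (by simp [ringWeight, hi]))

lemma sum_keyWeight (h : K ≤ P) : ∑ S : Fin n → Finset (Fin P), keyWeight K S = 1 := by
  have := Finset.prod_univ_sum (fun _ : Fin n => (Finset.univ : Finset (Finset (Fin P))))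
    (fun _ W => ringWeight K W)
  simp only [sum_ringWeight h, Finset.prod_const_one, Fintype.piFinset_univ] at this
  exact this.symm

lemma chanWeight_nonneg (h0 : 0 ≤ p) (h1 : p ≤ 1) (G : SimpleGraph (Fin n)) :
    0 ≤ chanWeight p G := by
  classical
  exact Finset.prod_nonneg fun e _ => by split_ifs <;> linarith

/-- Distinct channels are independent. -/
lemma chanMean_prod (p : ℝ) (E : Finset (Sym2 (Fin n))) (hE : E ⊆ channels n)
    (a b : Sym2 (Fin n) → ℝ) [∀ G : SimpleGraph (Fin n), DecidablePred (· ∈ G.edgeSet)] :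
    chanMean p (fun G => ∏ e ∈ E, if e ∈ G.edgeSet then a e else b e) =
      ∏ e ∈ E, (p * a e + (1 - p) * b e) := by
  classical
  have h1 : ∏ e ∈ E, (p * a e + (1 - p) * b e) =
      ∏ e ∈ channels n, (p * (if e ∈ E then a e else 1) + (1 - p) * (if e ∈ E then b e else 1)) := by
    rw [← Finset.prod_subset hE]
    · exact Finset.prod_congr rfl fun e he => by simp [he]
    · intro e _ he; simp [he]
  rw [h1, Finset.prod_add]
  unfold chanMean
  symm
  refine Finset.sum_bij' (fun X _ => SimpleGraph.fromEdgeSet (X : Set (Sym2 (Fin n))))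
    (fun G _ => (channels n).filter (· ∈ G.edgeSet)) ?_ ?_ ?_ ?_ ?_
  · intro X _; exact Finset.mem_univ _
  · intro G _; simp
  · intro X hX
    have hX := Finset.mem_powerset.1 hX
    ext e
    simp only [Finset.mem_filter, SimpleGraph.edgeSet_fromEdgeSet, Set.mem_sdiff, Finset.mem_coe]
    constructor
    · exact fun h => h.2.1
    · intro h
      have := hX h
      refine ⟨this, h, ?_⟩
      simpa [channels] using this
  · intro G _
    ext i j
    simp only [SimpleGraph.fromEdgeSet_adj, Finset.coe_filter, channels, Set.mem_ofPred_eq,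
      SimpleGraph.mem_edgeSet, Finset.mem_filter, Finset.mem_univ, true_and, Sym2.mk_isDiag_iff]
    exact ⟨fun h => h.1.2, fun h => ⟨⟨h.ne, h⟩, h.ne⟩⟩
  · intro X hX
    have hX := Finset.mem_powerset.1 hX
    have hmem : ∀ e ∈ channels n, (e ∈ (SimpleGraph.fromEdgeSet (X : Set (Sym2 (Fin n)))).edgeSet ↔
        e ∈ X) := by
      intro e he
      simp only [SimpleGraph.edgeSet_fromEdgeSet, Set.mem_sdiff, Finset.mem_coe]
      exact ⟨fun h => h.1, fun h => ⟨h, by simpa [channels] using he⟩⟩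
    have h2 : (∏ e ∈ E, if e ∈ (SimpleGraph.fromEdgeSet (X : Set (Sym2 (Fin n)))).edgeSet
        then a e else b e) = ∏ e ∈ channels n, if e ∈ X then (if e ∈ E then a e else 1)
          else (if e ∈ E then b e else 1) := by
      rw [← Finset.prod_subset hE]
      · refine Finset.prod_congr rfl fun e he => ?_
        simp only [he, if_true, hmem e (hE he)]
      · intro e _ he; simp [he]
    have h3 : chanWeight p (SimpleGraph.fromEdgeSet (X : Set (Sym2 (Fin n)))) =
        ∏ e ∈ channels n, if e ∈ X then p else 1 - p := by
      unfold chanWeight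
      exact Finset.prod_congr rfl fun e he => by simp only [hmem e he]
    beta_reduce
    rw [h2, h3, ← Finset.prod_mul_distrib, ← Finset.prod_sdiff hX, mul_comm]
    congr 1
    · refine Finset.prod_congr rfl fun e he => ?_
      rw [if_neg (Finset.mem_sdiff.1 he).2, if_neg (Finset.mem_sdiff.1 he).2]
    · refine Finset.prod_congr rfl fun e he => ?_
      rw [if_pos he, if_pos he]

lemma sum_chanWeight : ∑ G : SimpleGraph (Fin n), chanWeight p G = 1 := by
  classical
  have := chanMean_prod p (∅ : Finset (Sym2 (Fin n))) (by simp) (fun _ => 1) (fun _ => 1)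
  simpa [chanMean] using this

/-! #### Linearity and monotonicity -/

lemma ringMean_mono {g g' : Finset (Fin P) → ℝ} (h : ∀ W, W.card = K → g W ≤ g' W) :
    ringMean K g ≤ ringMean K g' := by
  refine Finset.sum_le_sum fun W _ => ?_
  by_cases hW : W.card = K
  · exact mul_le_mul_of_nonneg_left (h W hW) (ringWeight_nonneg W)
  · simp [ringWeight, hW]

lemma ringMean_const (h : K ≤ P) (c : ℝ) : ringMean K (fun _ : Finset (Fin P) => c) = c := by
  simp [ringMean, ← Finset.sum_mul, sum_ringWeight h]

lemma ringMean_sum {ι : Type*} (s : Finset ι) (g : ι → Finset (Fin P) → ℝ) :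
    ringMean K (fun W => ∑ i ∈ s, g i W) = ∑ i ∈ s, ringMean K (g i) := by
  simp only [ringMean, Finset.mul_sum]
  exact Finset.sum_comm

lemma ringMean_const_mul (c : ℝ) (g : Finset (Fin P) → ℝ) :
    ringMean K (fun W => c * g W) = c * ringMean K g := by
  simp only [ringMean, Finset.mul_sum]
  exact Finset.sum_congr rfl fun _ _ => by ring

lemma ringMean_sub (g g' : Finset (Fin P) → ℝ) :
    ringMean K (fun W => g W - g' W) = ringMean K g - ringMean K g' := by
  simp only [ringMean, mul_sub, Finset.sum_sub_distrib]

lemma ringMean_nonneg {g : Finset (Fin P) → ℝ} (h : ∀ W, W.card = K → 0 ≤ g W) :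
    0 ≤ ringMean K g := by
  have := ringMean_mono (K := K) (g := fun _ => 0) h
  simpa [ringMean] using this

/-- Only families of rings of `K` keys have positive weight. -/
lemma keyMean_congr {F F' : (Fin n → Finset (Fin P)) → ℝ}
    (h : ∀ S, (∀ i, (S i).card = K) → F S = F' S) : keyMean K F = keyMean K F' := by
  refine Finset.sum_congr rfl fun S _ => ?_
  by_cases hS : keyWeight K S = 0
  · simp [hS]
  · rw [h S (card_of_keyWeight_ne_zero hS)]

lemma keyMean_mono {F F' : (Fin n → Finset (Fin P)) → ℝ}
    (h : ∀ S, (∀ i, (S i).card = K) → F S ≤ F' S) : keyMean K F ≤ keyMean K F' := by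
  refine Finset.sum_le_sum fun S _ => ?_
  by_cases hS : keyWeight K S = 0
  · simp [hS]
  · exact mul_le_mul_of_nonneg_left (h S (card_of_keyWeight_ne_zero hS)) (keyWeight_nonneg S)

lemma keyMean_const (h : K ≤ P) (c : ℝ) :
    keyMean K (fun _ : Fin n → Finset (Fin P) => c) = c := by
  simp [keyMean, ← Finset.sum_mul, sum_keyWeight h]

lemma keyMean_sum {ι : Type*} (s : Finset ι) (F : ι → (Fin n → Finset (Fin P)) → ℝ) :
    keyMean K (fun S => ∑ i ∈ s, F i S) = ∑ i ∈ s, keyMean K (F i) := by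
  simp only [keyMean, Finset.mul_sum]
  exact Finset.sum_comm

lemma keyMean_const_mul (c : ℝ) (F : (Fin n → Finset (Fin P)) → ℝ) :
    keyMean K (fun S => c * F S) = c * keyMean K F := by
  simp only [keyMean, Finset.mul_sum]
  exact Finset.sum_congr rfl fun _ _ => by ring

lemma keyMean_add (F F' : (Fin n → Finset (Fin P)) → ℝ) :
    keyMean K (fun S => F S + F' S) = keyMean K F + keyMean K F' := by
  simp only [keyMean, mul_add, Finset.sum_add_distrib]

lemma keyMean_sub (F F' : (Fin n → Finset (Fin P)) → ℝ) :
    keyMean K (fun S => F S - F' S) = keyMean K F - keyMean K F' := by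
  simp only [keyMean, mul_sub, Finset.sum_sub_distrib]

lemma keyMean_nonneg {F : (Fin n → Finset (Fin P)) → ℝ}
    (h : ∀ S, (∀ i, (S i).card = K) → 0 ≤ F S) : 0 ≤ keyMean K F := by
  have := keyMean_mono (K := K) (F := fun _ => 0) h
  simpa [keyMean] using this

lemma chanMean_mono (h0 : 0 ≤ p) (h1 : p ≤ 1) {F F' : SimpleGraph (Fin n) → ℝ}
    (h : ∀ G, F G ≤ F' G) : chanMean p F ≤ chanMean p F' :=
  Finset.sum_le_sum fun G _ => mul_le_mul_of_nonneg_left (h G) (chanWeight_nonneg h0 h1 G)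

lemma chanMean_const (c : ℝ) : chanMean p (fun _ : SimpleGraph (Fin n) => c) = c := by
  simp [chanMean, ← Finset.sum_mul, sum_chanWeight]

lemma chanMean_sum {ι : Type*} (s : Finset ι) (F : ι → SimpleGraph (Fin n) → ℝ) :
    chanMean p (fun G => ∑ i ∈ s, F i G) = ∑ i ∈ s, chanMean p (F i) := by
  simp only [chanMean, Finset.mul_sum]
  exact Finset.sum_comm

lemma chanMean_const_mul (c : ℝ) (F : SimpleGraph (Fin n) → ℝ) :
    chanMean p (fun G => c * F G) = c * chanMean p F := by
  simp only [chanMean, Finset.mul_sum]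
  exact Finset.sum_congr rfl fun _ _ => by ring

lemma chanMean_add (F F' : SimpleGraph (Fin n) → ℝ) :
    chanMean p (fun G => F G + F' G) = chanMean p F + chanMean p F' := by
  simp only [chanMean, mul_add, Finset.sum_add_distrib]

lemma netMean_mono (h0 : 0 ≤ p) (h1 : p ≤ 1)
    {F F' : (Fin n → Finset (Fin P)) → SimpleGraph (Fin n) → ℝ}
    (h : ∀ S G, (∀ i, (S i).card = K) → F S G ≤ F' S G) : netMean K p F ≤ netMean K p F' :=
  keyMean_mono fun S hS => chanMean_mono h0 h1 fun G => h S G hS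

lemma netMean_sum {ι : Type*} (s : Finset ι)
    (F : ι → (Fin n → Finset (Fin P)) → SimpleGraph (Fin n) → ℝ) :
    netMean K p (fun S G => ∑ i ∈ s, F i S G) = ∑ i ∈ s, netMean K p (F i) := by
  simp only [netMean, chanMean_sum, keyMean_sum]

lemma netMean_add (F F' : (Fin n → Finset (Fin P)) → SimpleGraph (Fin n) → ℝ) :
    netMean K p (fun S G => F S G + F' S G) = netMean K p F + netMean K p F' := by
  simp only [netMean, chanMean_add, keyMean_add]

lemma netMean_const_mul (c : ℝ) (F : (Fin n → Finset (Fin P)) → SimpleGraph (Fin n) → ℝ) :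
    netMean K p (fun S G => c * F S G) = c * netMean K p F := by
  simp only [netMean, chanMean_const_mul, keyMean_const_mul]

lemma netMean_nonneg (h0 : 0 ≤ p) (h1 : p ≤ 1)
    {F : (Fin n → Finset (Fin P)) → SimpleGraph (Fin n) → ℝ}
    (h : ∀ S G, (∀ i, (S i).card = K) → 0 ≤ F S G) : 0 ≤ netMean K p F := by
  have := netMean_mono (K := K) (F := fun _ _ => 0) h0 h1 h
  simpa [netMean, chanMean, keyMean] using this

/-! #### Resampling -/

/-- Resampling one key ring does not change an expectation. -/
lemma keyMean_resample (h : K ≤ P) (a : Fin n) (F : (Fin n → Finset (Fin P)) → ℝ) :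
    keyMean K F = keyMean K fun S => ringMean K fun W => F (Function.update S a W) := by
  classical
  have hw : ∀ (S : Fin n → Finset (Fin P)) (W : Finset (Fin P)),
      keyWeight K S * ringWeight K W =
        keyWeight K (Function.update S a W) * ringWeight K (S a) := by
    intro S W
    unfold keyWeight
    rw [← Finset.mul_prod_erase _ _ (Finset.mem_univ a),
      ← Finset.mul_prod_erase _ (fun i => ringWeight K (Function.update S a W i))
        (Finset.mem_univ a)]
    rw [Finset.prod_congr rfl fun i hi => by
      rw [show S i = Function.update S a W i from
        (Function.update_of_ne (Finset.ne_of_mem_erase hi) W S).symm]]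
    simp only [Function.update_self]
    ring
  have hw' : ∀ (S : Fin n → Finset (Fin P)) (W : Finset (Fin P)),
      keyWeight K S * (ringWeight K W * F (Function.update S a W)) =
        keyWeight K (Function.update S a W) * ringWeight K (S a) * F (Function.update S a W) := by
    intro S W
    rw [← mul_assoc, hw]
  simp only [keyMean, ringMean, Finset.mul_sum]
  rw [Finset.sum_congr rfl fun S _ => Finset.sum_congr rfl fun W _ => hw' S W]
  rw [← Fintype.sum_prod_type']
  let e : ((Fin n → Finset (Fin P)) × Finset (Fin P)) ≃ ((Fin n → Finset (Fin P)) × Finset (Fin P)) :=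
    { toFun := fun x => (Function.update x.1 a x.2, x.1 a)
      invFun := fun x => (Function.update x.1 a x.2, x.1 a)
      left_inv := fun x => by simp
      right_inv := fun x => by simp }
  refine Eq.trans ?_ (Fintype.sum_equiv e (fun x => keyWeight K (Function.update x.1 a x.2) *
      ringWeight K (x.1 a) * F (Function.update x.1 a x.2))
    (fun x => keyWeight K x.1 * ringWeight K x.2 * F x.1) (fun x => rfl)).symm
  rw [Fintype.sum_prod_type]
  refine Finset.sum_congr rfl fun S _ => ?_
  simp only [mul_right_comm _ _ (F S)]
  rw [← Finset.mul_sum, sum_ringWeight h, mul_one]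

/-- Integrating out the independent key rings of the nodes in `D`, in the product of
functions of one of them each. -/
lemma keyMean_prod (h : K ≤ P) (D : Finset (Fin n)) (χ : (Fin n → Finset (Fin P)) → ℝ)
    (g : Fin n → (Fin n → Finset (Fin P)) → Finset (Fin P) → ℝ)
    (hχ : ∀ S S', (∀ i ∉ D, S i = S' i) → χ S = χ S')
    (hg : ∀ v ∈ D, ∀ S S', (∀ i ∉ D, S i = S' i) → g v S = g v S') :
    keyMean K (fun S => χ S * ∏ v ∈ D, g v S (S v)) =
      keyMean K (fun S => χ S * ∏ v ∈ D, ringMean K (g v S)) := by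
  classical
  suffices H : ∀ D' ⊆ D, ∀ χ : (Fin n → Finset (Fin P)) → ℝ,
      (∀ S S', (∀ i ∉ D', S i = S' i) → χ S = χ S') →
      keyMean K (fun S => χ S * ∏ v ∈ D', g v S (S v)) =
      keyMean K (fun S => χ S * ∏ v ∈ D', ringMean K (g v S)) from H D le_rfl χ hχ
  intro D'
  induction D' using Finset.induction_on with
  | empty => simp
  | insert v D' hv ih =>
    intro hD χ hχ
    have hvD : v ∈ D := hD (Finset.mem_insert_self _ _)
    have hsub : D' ⊆ D := (Finset.subset_insert _ _).trans hD
    simp only [Finset.prod_insert hv, ← mul_assoc]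
    rw [ih hsub (fun S => χ S * g v S (S v))]
    · rw [keyMean_resample h v]
      refine keyMean_congr fun S _ => ?_
      have h1 : ∀ u ∈ D, ∀ W, g u (Function.update S v W) = g u S := fun u hu W =>
        hg u hu _ _ fun i hi => Function.update_of_ne (by rintro rfl; exact hi hvD) _ _
      have h2 : ∀ W, χ (Function.update S v W) = χ S := fun W =>
        hχ _ _ fun i hi => Function.update_of_ne (by rintro rfl; simp at hi) _ _
      have h3 : ∀ W, ∏ u ∈ D', ringMean K (g u (Function.update S v W)) =
          ∏ u ∈ D', ringMean K (g u S) := fun W =>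
        Finset.prod_congr rfl fun u hu => by rw [h1 u (hsub hu)]
      simp only [h1 v hvD, h2, h3, Function.update_self]
      rw [show (fun W => χ S * g v S W * ∏ u ∈ D', ringMean K (g u S)) =
        fun W => (χ S * ∏ u ∈ D', ringMean K (g u S)) * g v S W by funext W; ring,
        ringMean_const_mul]
      ring
    · intro S S' hS
      have hsv : S v = S' v := hS v hv
      rw [hχ S S' fun i hi => hS i (by simp at hi; tauto),
        hg v hvD S S' fun i hi => hS i fun h => hi (hsub h), hsv]

end Means

/-! ### A uniformly random key ring -/

section Ring
variable {n P K : ℕ}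

/-- The number of rings that avoid `u` given keys. -/
lemma choose_sub_left_le (h : K ≤ P) (u : ℕ) (hu : u ≤ P) :
    ((P - u).choose K : ℝ) ≤ (1 - (K : ℝ) / P) ^ u * (P.choose K : ℝ) := by
  induction u with
  | zero => simp
  | succ u ih =>
    have ih := ih (by omega)
    obtain ⟨m, hm⟩ : ∃ m, P - u = m + 1 := ⟨P - (u + 1), by omega⟩
    have hm' : P - (u + 1) = m := by omega
    have hP : (0 : ℝ) < P := by exact_mod_cast (by omega : 0 < P)
    have hKP : (K : ℝ) / P ≤ 1 := by rw [div_le_one hP]; exact_mod_cast h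
    have step : (m.choose K : ℝ) ≤ (1 - (K : ℝ) / P) * ((m + 1).choose K : ℝ) := by
      rcases le_or_gt K (m + 1) with hK | hK
      · have e := Nat.choose_mul_succ_eq m K
        have e' : (m.choose K : ℝ) * (m + 1) = ((m + 1).choose K : ℝ) * ((m : ℝ) + 1 - K) := by
          have : ((m.choose K * (m + 1) : ℕ) : ℝ) = (((m + 1).choose K * (m + 1 - K) : ℕ) : ℝ) := by
            rw [e]
          rw [Nat.cast_mul, Nat.cast_mul, Nat.cast_sub hK] at this
          push_cast at this
          exact this
        have hmpos : (0 : ℝ) < (m : ℝ) + 1 := by positivity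
        have e2 : (m.choose K : ℝ) = (1 - (K : ℝ) / (m + 1)) * ((m + 1).choose K : ℝ) := by
          field_simp
          linarith
        rw [e2]
        have hmP : (m : ℝ) + 1 ≤ P := by exact_mod_cast (by omega : m + 1 ≤ P)
        have : (K : ℝ) / P ≤ (K : ℝ) / (m + 1) := by gcongr
        gcongr
      · rw [Nat.choose_eq_zero_of_lt (by omega : m < K)]
        have : 0 ≤ 1 - (K : ℝ) / P := by linarith
        push_cast
        positivity
    rw [hm] at ih
    rw [hm', pow_succ']
    have h0 : 0 ≤ 1 - (K : ℝ) / P := by linarith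
    calc (m.choose K : ℝ) ≤ (1 - (K : ℝ) / P) * ((m + 1).choose K : ℝ) := step
      _ ≤ (1 - (K : ℝ) / P) * ((1 - (K : ℝ) / P) ^ u * (P.choose K : ℝ)) := by gcongr
      _ = _ := by ring

/-- The number of rings that contain `t` given keys. -/
lemma choose_sub_sub_le (h : K ≤ P) (t : ℕ) (ht : t ≤ K) :
    ((P - t).choose (K - t) : ℝ) ≤ ((K : ℝ) / P) ^ t * (P.choose K : ℝ) := by
  induction t with
  | zero => simp
  | succ t ih =>
    have ih := ih (by omega)
    obtain ⟨m, hm⟩ : ∃ m, P - t = m + 1 := ⟨P - (t + 1), by omega⟩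
    obtain ⟨j, hj⟩ : ∃ j, K - t = j + 1 := ⟨K - (t + 1), by omega⟩
    have hm' : P - (t + 1) = m := by omega
    have hj' : K - (t + 1) = j := by omega
    rw [hm, hj] at ih
    rw [hm', hj', pow_succ']
    have hP : (0 : ℝ) < P := by exact_mod_cast (by omega : 0 < P)
    have e := Nat.add_one_mul_choose_eq m j
    have e' : ((m : ℝ) + 1) * (m.choose j : ℝ) = ((m + 1).choose (j + 1) : ℝ) * (j + 1) := by
      exact_mod_cast e
    have hmr : (m : ℝ) + 1 = P - t := by
      have : m + 1 + t = P := by omega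
      have : (m : ℝ) + 1 + t = P := by exact_mod_cast this
      linarith
    have hjr : (j : ℝ) + 1 = K - t := by
      have : j + 1 + t = K := by omega
      have : (j : ℝ) + 1 + t = K := by exact_mod_cast this
      linarith
    have hmpos : (0 : ℝ) < (m : ℝ) + 1 := by positivity
    have hKP : (K : ℝ) ≤ P := by exact_mod_cast h
    have hr : ((j : ℝ) + 1) / (m + 1) ≤ (K : ℝ) / P := by
      rw [div_le_div_iff₀ hmpos hP, hmr, hjr]
      have : (0 : ℝ) ≤ t := by positivity
      nlinarith
    have e2 : (m.choose j : ℝ) = ((j : ℝ) + 1) / (m + 1) * ((m + 1).choose (j + 1) : ℝ) := by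
      field_simp
      linarith
    rw [e2]
    calc ((j : ℝ) + 1) / (m + 1) * ((m + 1).choose (j + 1) : ℝ)
        ≤ (K : ℝ) / P * (((K : ℝ) / P) ^ t * (P.choose K : ℝ)) := by gcongr
      _ = _ := by ring

lemma ringMean_ite (q : Finset (Fin P) → Prop) [DecidablePred q] :
    ringMean K (fun W => if q W then (1 : ℝ) else 0) =
      (((Finset.univ.powersetCard K).filter q).card : ℝ) / (P.choose K : ℝ) := by
  unfold ringMean ringWeight
  simp only [mul_ite, mul_one, mul_zero, ← ite_and]
  rw [← Finset.sum_filter, Finset.sum_const, nsmul_eq_mul, div_eq_mul_inv]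
  congr 3
  ext W
  simp [Finset.mem_powersetCard, and_comm]

lemma ringMean_disjoint_le (h : K ≤ P) (U : Finset (Fin P)) :
    ringMean K (fun W => if Disjoint W U then (1 : ℝ) else 0) ≤
      Real.exp (-(U.card * (K / P : ℝ))) := by
  have hc : (0 : ℝ) < (P.choose K : ℝ) := by exact_mod_cast Nat.choose_pos h
  have hU : U.card ≤ P := by simpa using U.card_le_univ
  rw [ringMean_ite, div_le_iff₀ hc]
  have e : ((Finset.univ.powersetCard K).filter fun W => Disjoint W U) = Uᶜ.powersetCard K := by
    ext W
    simp only [Finset.mem_filter, Finset.mem_powersetCard, Finset.subset_univ, true_and,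
      Finset.subset_compl_iff_disjoint_right]
    tauto
  rw [e, Finset.card_powersetCard, Finset.card_compl, Fintype.card_fin]
  refine (choose_sub_left_le h _ hU).trans ?_
  gcongr
  rcases Nat.eq_zero_or_pos P with rfl | hP
  · have : U.card = 0 := by omega
    simp [this]
  have hP' : (0 : ℝ) < P := by exact_mod_cast hP
  have hKP : (K : ℝ) / P ≤ 1 := by rw [div_le_one hP']; exact_mod_cast h
  rw [← mul_neg, Real.exp_nat_mul]
  have := Real.add_one_le_exp (-((K : ℝ) / P))
  exact pow_le_pow_left₀ (by linarith) (by linarith) _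

lemma ringMean_subset_le (h : K ≤ P) (T : Finset (Fin P)) :
    ringMean K (fun W => if T ⊆ W then (1 : ℝ) else 0) ≤ ((K : ℝ) / P) ^ T.card := by
  have hc : (0 : ℝ) < (P.choose K : ℝ) := by exact_mod_cast Nat.choose_pos h
  rw [ringMean_ite, div_le_iff₀ hc]
  rcases le_or_gt T.card K with hT | hT
  · rw [Finset.card_filter_powersetCard_subset _ _ _ (Finset.subset_univ _) hT, Finset.card_univ,
      Fintype.card_fin]
    exact choose_sub_sub_le h _ hT
  · rw [Finset.filter_false_of_mem]
    · simp; positivity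
    · intro W hW hTW
      have := Finset.card_le_card hTW
      rw [(Finset.mem_powersetCard.1 hW).2] at this
      omega

/-- The number of keys that a random ring shares with a fixed set has an exponential moment not
larger than that of the Poisson law with the same mean. -/
lemma ringMean_pow_card_inter_le (h : K ≤ P) (U : Finset (Fin P)) {z : ℝ} (hz : 1 ≤ z) :
    ringMean K (fun W => z ^ (W ∩ U).card) ≤ Real.exp ((z - 1) * (U.card * (K / P : ℝ))) := by
  have e : ∀ W : Finset (Fin P), z ^ (W ∩ U).card =
      ∑ T ∈ U.powerset, (z - 1) ^ T.card * if T ⊆ W then (1 : ℝ) else 0 := by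
    intro W
    have := Finset.sum_pow_mul_eq_add_pow (z - 1) 1 (W ∩ U)
    simp only [one_pow, mul_one, sub_add_cancel] at this
    rw [← this]
    simp only [mul_ite, mul_one, mul_zero, ← Finset.sum_filter]
    refine Finset.sum_congr ?_ fun _ _ => rfl
    ext T
    simp only [Finset.mem_powerset, Finset.subset_inter_iff, Finset.mem_filter]
    tauto
  have hz' : 0 ≤ z - 1 := by linarith
  have hq : (0 : ℝ) ≤ (K : ℝ) / P := by positivity
  simp only [e]
  rw [ringMean_sum]
  calc ∑ T ∈ U.powerset, ringMean K (fun W => (z - 1) ^ T.card * if T ⊆ W then (1 : ℝ) else 0)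
      ≤ ∑ T ∈ U.powerset, ((z - 1) * (K / P : ℝ)) ^ T.card * 1 ^ (U.card - T.card) := by
        refine Finset.sum_le_sum fun T _ => ?_
        rw [ringMean_const_mul, mul_pow, one_pow, mul_one]
        exact mul_le_mul_of_nonneg_left (ringMean_subset_le h T) (by positivity)
    _ = ((z - 1) * (K / P : ℝ) + 1) ^ U.card := Finset.sum_pow_mul_eq_add_pow _ _ _
    _ ≤ Real.exp ((z - 1) * (K / P : ℝ)) ^ U.card :=
        pow_le_pow_left₀ (by positivity) (Real.add_one_le_exp _) _
    _ = _ := by rw [← Real.exp_nat_mul]; congr 1; ring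

lemma ringMean_not_disjoint_le (h : K ≤ P) (U : Finset (Fin P)) :
    ringMean K (fun W => if Disjoint W U then (0 : ℝ) else 1) ≤ U.card * (K / P : ℝ) := by
  calc ringMean K (fun W => if Disjoint W U then (0 : ℝ) else 1)
      ≤ ringMean K (fun W => ∑ x ∈ U, if {x} ⊆ W then (1 : ℝ) else 0) := by
        refine ringMean_mono fun W _ => ?_
        split_ifs with hd
        · exact Finset.sum_nonneg fun _ _ => by split_ifs <;> norm_num
        · obtain ⟨x, hx, hxU⟩ := Finset.not_disjoint_iff.1 hd
          refine le_trans ?_ (Finset.single_le_sum (fun y _ => ?_) hxU)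
          · simp [hx]
          · split_ifs <;> norm_num
    _ = ∑ x ∈ U, ringMean K (fun W => if {x} ⊆ W then (1 : ℝ) else 0) := ringMean_sum _ _
    _ ≤ ∑ x ∈ U, (K / P : ℝ) := Finset.sum_le_sum fun x _ => by
        simpa using ringMean_subset_le h {x}
    _ = _ := by simp

lemma le_ringMean_not_disjoint (h : K ≤ P) (U : Finset (Fin P)) :
    1 - Real.exp (-(U.card * (K / P : ℝ))) ≤
      ringMean K (fun W => if Disjoint W U then (0 : ℝ) else 1) := by
  have e : (fun W : Finset (Fin P) => if Disjoint W U then (0 : ℝ) else 1) =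
      fun W => 1 - if Disjoint W U then (1 : ℝ) else 0 := by
    funext W; split_ifs <;> norm_num
  rw [e, ringMean_sub, ringMean_const h]
  linarith [ringMean_disjoint_le h U]

lemma ringMean_not_disjoint_both_le (h : K ≤ P) (U U' : Finset (Fin P)) (hU : Disjoint U U') :
    ringMean K (fun W => if Disjoint W U ∨ Disjoint W U' then (0 : ℝ) else 1) ≤
      U.card * U'.card * (K / P : ℝ) ^ 2 := by
  calc ringMean K (fun W => if Disjoint W U ∨ Disjoint W U' then (0 : ℝ) else 1)
      ≤ ringMean K (fun W => ∑ x ∈ U ×ˢ U', if {x.1, x.2} ⊆ W then (1 : ℝ) else 0) := by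
        refine ringMean_mono fun W _ => ?_
        split_ifs with hd
        · exact Finset.sum_nonneg fun _ _ => by split_ifs <;> norm_num
        · rw [not_or] at hd
          obtain ⟨x, hx, hxU⟩ := Finset.not_disjoint_iff.1 hd.1
          obtain ⟨y, hy, hyU⟩ := Finset.not_disjoint_iff.1 hd.2
          refine le_trans ?_ (Finset.single_le_sum (fun y _ => ?_)
            (Finset.mk_mem_product hxU hyU))
          · simp [hx, hy, Finset.insert_subset_iff]
          · split_ifs <;> norm_num
    _ = ∑ x ∈ U ×ˢ U', ringMean K (fun W => if {x.1, x.2} ⊆ W then (1 : ℝ) else 0) :=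
        ringMean_sum _ _
    _ ≤ ∑ x ∈ U ×ˢ U', (K / P : ℝ) ^ 2 := Finset.sum_le_sum fun x hx => by
        have hne : x.1 ≠ x.2 := fun he => by
          have := Finset.mem_product.1 hx
          exact Finset.disjoint_left.1 hU this.1 (he ▸ this.2)
        simpa [Finset.card_pair hne] using ringMean_subset_le h {x.1, x.2}
    _ = _ := by simp

/-! ### The overlap of several key rings -/

/-- The number of keys lost to overlaps in the union of the `K`-element rings of the nodes
in `A`. The subtraction of natural numbers is exact if all rings have `K` elements (`excess_add`). -/
def excess (K : ℕ) (A : Finset (Fin n)) (S : Fin n → Finset (Fin P)) : ℕ :=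
  A.card * K - (A.biUnion S).card

lemma card_biUnion_le {S : Fin n → Finset (Fin P)} (hS : ∀ i, (S i).card = K)
    (A : Finset (Fin n)) : (A.biUnion S).card ≤ A.card * K :=
  Finset.card_biUnion_le_card_mul _ _ _ fun i _ => (hS i).le

lemma excess_add {S : Fin n → Finset (Fin P)} (hS : ∀ i, (S i).card = K) (A : Finset (Fin n)) :
    excess K A S + (A.biUnion S).card = A.card * K :=
  Nat.sub_add_cancel (card_biUnion_le hS A)

lemma excess_congr {S S' : Fin n → Finset (Fin P)} {A : Finset (Fin n)}
    (h : ∀ i ∈ A, S i = S' i) : excess K A S = excess K A S' := by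
  unfold excess
  rw [Finset.biUnion_congr rfl h]

lemma excess_insert {S : Fin n → Finset (Fin P)} (hS : ∀ i, (S i).card = K)
    {A : Finset (Fin n)} {a : Fin n} (ha : a ∉ A) :
    excess K (insert a A) S = excess K A S + (S a ∩ A.biUnion S).card := by
  have h1 := excess_add hS (insert a A)
  have h2 := excess_add hS A
  have h3 := Finset.card_union_add_card_inter (S a) (A.biUnion S)
  rw [Finset.card_insert_of_notMem ha, Finset.biUnion_insert, add_mul, one_mul] at h1
  rw [hS a] at h3
  omega

lemma disjoint_of_excess_eq_zero {S : Fin n → Finset (Fin P)} (hS : ∀ i, (S i).card = K)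
    {A : Finset (Fin n)} (h : excess K A S = 0) {i j : Fin n} (hi : i ∈ A) (hj : j ∈ A)
    (hij : i ≠ j) : Disjoint (S i) (S j) := by
  classical
  have e := Finset.insert_erase hi
  rw [← e, excess_insert hS (Finset.notMem_erase i A)] at h
  have h2 : (S i ∩ (A.erase i).biUnion S).card = 0 := by omega
  rw [Finset.card_eq_zero, ← Finset.disjoint_iff_inter_eq_empty, Finset.disjoint_biUnion_right] at h2
  exact h2 j (Finset.mem_erase.2 ⟨hij.symm, hj⟩)

/-- The excess of `r` nodes has an exponential moment not larger than that of the Poisson law with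
mean `r ^ 2 * K ^ 2 / P`: if the rings are revealed one at a time, then each ring meets the union of
the previous ones, which has at most `r * K` elements, in at most a Poisson number of keys. -/
lemma keyMean_pow_excess_le (h : K ≤ P) (A : Finset (Fin n)) {z : ℝ} (hz : 1 ≤ z) :
    keyMean K (fun S : Fin n → Finset (Fin P) => z ^ excess K A S) ≤
      Real.exp ((z - 1) * (A.card ^ 2 * ((K : ℝ) ^ 2 / P))) := by
  classical
  induction A using Finset.induction_on with
  | empty => simp [excess, keyMean_const h]
  | insert a A ha ih =>
    have hz' : 0 ≤ z - 1 := by linarith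
    calc keyMean K (fun S : Fin n → Finset (Fin P) => z ^ excess K (insert a A) S)
        = keyMean K (fun S : Fin n → Finset (Fin P) =>
            z ^ excess K A S * z ^ (S a ∩ A.biUnion S).card) :=
          keyMean_congr fun S hS => by rw [excess_insert hS ha, pow_add]
      _ = keyMean K (fun S : Fin n → Finset (Fin P) =>
            z ^ excess K A S * ringMean K fun W => z ^ (W ∩ A.biUnion S).card) := by
          rw [keyMean_resample h a]
          refine keyMean_congr fun S _ => ?_
          rw [← ringMean_const_mul]
          congr 1
          funext W
          have hu : ∀ i ∈ A, Function.update S a W i = S i := fun i hi =>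
            Function.update_of_ne (by rintro rfl; exact ha hi) _ _
          rw [excess_congr hu, Function.update_self, Finset.biUnion_congr rfl hu]
      _ ≤ keyMean K (fun S : Fin n → Finset (Fin P) =>
            Real.exp ((z - 1) * (A.card * ((K : ℝ) ^ 2 / P))) * z ^ excess K A S) := by
          refine keyMean_mono fun S hS => ?_
          rw [mul_comm]
          refine mul_le_mul_of_nonneg_right ?_ (by positivity)
          refine (ringMean_pow_card_inter_le h _ hz).trans (Real.exp_le_exp.2 ?_)
          refine mul_le_mul_of_nonneg_left ?_ hz'
          have : ((A.biUnion S).card : ℝ) ≤ A.card * K := by exact_mod_cast card_biUnion_le hS A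
          calc ((A.biUnion S).card : ℝ) * (K / P) ≤ A.card * K * (K / P) := by gcongr
            _ = _ := by ring
      _ ≤ Real.exp ((z - 1) * (A.card * ((K : ℝ) ^ 2 / P))) *
            Real.exp ((z - 1) * (A.card ^ 2 * ((K : ℝ) ^ 2 / P))) := by
          rw [keyMean_const_mul]
          gcongr
      _ ≤ _ := by
          rw [← Real.exp_add, Finset.card_insert_of_notMem ha, ← mul_add, ← add_mul]
          refine Real.exp_le_exp.2 (mul_le_mul_of_nonneg_left ?_ hz')
          refine mul_le_mul_of_nonneg_right ?_ (by positivity)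
          push_cast
          nlinarith [(Nat.cast_nonneg A.card : (0 : ℝ) ≤ A.card)]

end Ring

/-! ### The links between a set of nodes and the other nodes -/

/-- The probability that the channels from an outside node to `A` that are on are those to `C`. -/
noncomputable def subsetWeight {n : ℕ} (p : ℝ) (A C : Finset (Fin n)) : ℝ :=
  p ^ C.card * (1 - p) ^ (A \ C).card

open Classical in
/-- The neighbours in `A` of the node `v`. -/
noncomputable def nbrsIn {n P : ℕ} (A : Finset (Fin n)) (S : Fin n → Finset (Fin P))
    (G : SimpleGraph (Fin n)) (v : Fin n) : Finset (Fin n) :=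
  A.filter fun i => (keyGraph S ⊓ G).Adj i v

/-- The nodes outside `A` with a neighbour in `A`. -/
noncomputable def boundary {n P : ℕ} (A : Finset (Fin n)) (S : Fin n → Finset (Fin P))
    (G : SimpleGraph (Fin n)) : Finset (Fin n) :=
  Aᶜ.filter fun v => (nbrsIn A S G v).Nonempty

/-- Given the key rings of the nodes in `A`, the expectation of `ψ N` where `N` is the set of the
neighbours in `A` of a node outside `A`: here `W` is the key ring of the outside node, and `C` is
the set of the nodes of `A` to which it has a channel that is on. -/
noncomputable def typeMean {n P : ℕ} (K : ℕ) (p : ℝ) (A : Finset (Fin n))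
    (S : Fin n → Finset (Fin P)) (ψ : Finset (Fin n) → ℝ) : ℝ :=
  ringMean K fun W => ∑ C ∈ A.powerset,
    subsetWeight p A C * ψ (C.filter fun i => ¬ Disjoint W (S i))

/-- Given the key rings of the nodes in `A`, the probability that a node outside `A` has no
neighbour in `A`. -/
noncomputable def missProb {n P : ℕ} (K : ℕ) (p : ℝ) (A : Finset (Fin n))
    (S : Fin n → Finset (Fin P)) : ℝ :=
  typeMean K p A S fun B => if B = ∅ then 1 else 0

section Links
variable {n P K : ℕ} {p : ℝ}

lemma chanMean_prod_of_injective {ι : Type*} [Fintype ι] (e : ι → Sym2 (Fin n))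
    (he : Function.Injective e) (hE : ∀ x, e x ∈ channels n) (a b : ι → ℝ)
    [∀ G : SimpleGraph (Fin n), DecidablePred (· ∈ G.edgeSet)] :
    chanMean p (fun G => ∏ x, if e x ∈ G.edgeSet then a x else b x) =
      ∏ x, (p * a x + (1 - p) * b x) := by
  classical
  have := chanMean_prod p (Finset.univ.image e)
    (fun y hy => by obtain ⟨x, -, rfl⟩ := Finset.mem_image.1 hy; exact hE x)
    (Function.extend e a 0) (Function.extend e b 0)
  simpa only [Finset.prod_image he.injOn, he.extend_apply] using this

/-- The generating function of the set of the channels that are on. -/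
lemma sum_subsetWeight_mul_prod (A : Finset (Fin n)) (x : Fin n → ℝ) :
    ∑ C ∈ A.powerset, subsetWeight p A C * ∏ i ∈ C, x i = ∏ i ∈ A, (p * x i + (1 - p)) := by
  rw [Finset.prod_add]
  refine Finset.sum_congr rfl fun C _ => ?_
  simp only [subsetWeight, Finset.prod_mul_distrib, Finset.prod_const]
  ring

lemma sum_subsetWeight (A : Finset (Fin n)) : ∑ C ∈ A.powerset, subsetWeight p A C = 1 := by
  have := sum_subsetWeight_mul_prod (p := p) A fun _ => 1
  simpa using this

lemma sum_subsetWeight_mem (A : Finset (Fin n)) {i : Fin n} (hi : i ∈ A) :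
    ∑ C ∈ A.powerset, subsetWeight p A C * (if i ∈ C then 1 else 0) = p := by
  have h := Finset.prod_add (fun _ => p) (fun j => if j = i then 0 else 1 - p) A
  have h2 : ∏ j ∈ A, (p + if j = i then 0 else 1 - p) = p := by
    rw [← Finset.mul_prod_erase _ _ hi, Finset.prod_eq_one]
    · simp
    · intro j hj
      simp [Finset.ne_of_mem_erase hj]
  refine Eq.trans ?_ (h.symm.trans h2)
  refine Finset.sum_congr rfl fun C hC => ?_
  unfold subsetWeight
  by_cases hiC : i ∈ C
  · rw [Finset.prod_congr rfl (g := fun _ => 1 - p) fun j hj => if_neg (by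
      rintro rfl; exact (Finset.mem_sdiff.1 hj).2 hiC)]
    simp [hiC]
  · rw [Finset.prod_eq_zero (i := i) (s := A \ C) (by simp [hi, hiC]) (by simp)]
    simp [hiC]

lemma subsetWeight_nonneg (h0 : 0 ≤ p) (h1 : p ≤ 1) (A C : Finset (Fin n)) :
    0 ≤ subsetWeight p A C :=
  mul_nonneg (pow_nonneg h0 _) (pow_nonneg (by linarith) _)

open Classical in
/-- The sets of channels that link the nodes outside `A` to `A` are independent. -/
lemma chanMean_prod_nbrs (A : Finset (Fin n)) (F : Fin n → Finset (Fin n) → ℝ) :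
    chanMean p (fun G => ∏ v ∈ Aᶜ, F v (A.filter fun i => G.Adj i v)) =
      ∏ v ∈ Aᶜ, ∑ C ∈ A.powerset, subsetWeight p A C * F v C := by
  have hF : ∀ (G : SimpleGraph (Fin n)) (v : {v // v ∈ Aᶜ}),
      F v (A.filter fun i => G.Adj i v) = ∑ C ∈ A.powerset, F v C *
        ∏ i : {i // i ∈ A}, if s((i : Fin n), (v : Fin n)) ∈ G.edgeSet then
          (if (i : Fin n) ∈ C then (1 : ℝ) else 0) else (if (i : Fin n) ∈ C then 0 else 1) := by
    intro G v
    have hp : ∀ C ∈ A.powerset, (∏ i : {i // i ∈ A}, if s((i : Fin n), (v : Fin n)) ∈ G.edgeSet then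
          (if (i : Fin n) ∈ C then (1 : ℝ) else 0) else (if (i : Fin n) ∈ C then 0 else 1)) =
          if C = A.filter (fun i => G.Adj i v) then 1 else 0 := by
      intro C hC
      have hC := Finset.mem_powerset.1 hC
      simp only [SimpleGraph.mem_edgeSet]
      split_ifs with h
      · refine Finset.prod_eq_one fun i _ => ?_
        subst h
        by_cases hG : G.Adj i v <;> simp [hG]
      · obtain ⟨i, hi⟩ : ∃ i, ¬ (i ∈ C ↔ i ∈ A.filter fun i => G.Adj i v) := by
          by_contra hcon
          push Not at hcon
          exact h (Finset.ext hcon)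
        have hiA : i ∈ A := by
          by_contra hiA
          exact hi ⟨fun h => absurd (hC h) hiA, fun h => absurd (Finset.mem_filter.1 h).1 hiA⟩
        refine Finset.prod_eq_zero (Finset.mem_univ (⟨i, hiA⟩ : {i // i ∈ A})) ?_
        by_cases hG : G.Adj i v <;> by_cases hiC : i ∈ C <;> simp_all
    rw [Finset.sum_congr rfl fun C hC => by rw [hp C hC]]
    simp
  have hinj : Function.Injective fun x : {v // v ∈ Aᶜ} × {i // i ∈ A} =>
      s((x.2 : Fin n), (x.1 : Fin n)) := by
    rintro ⟨⟨v, hv⟩, ⟨i, hi⟩⟩ ⟨⟨v', hv'⟩, ⟨i', hi'⟩⟩ h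
    simp only [Sym2.eq_iff] at h
    rcases h with ⟨rfl, rfl⟩ | ⟨rfl, rfl⟩
    · rfl
    · exact absurd hi (Finset.mem_compl.1 hv')
  have hchan : ∀ x : {v // v ∈ Aᶜ} × {i // i ∈ A},
      s((x.2 : Fin n), (x.1 : Fin n)) ∈ channels n := by
    rintro ⟨⟨v, hv⟩, ⟨i, hi⟩⟩
    simp only [channels, Finset.mem_filter, Finset.mem_univ, true_and, Sym2.mk_isDiag_iff]
    rintro rfl
    exact (Finset.mem_compl.1 hv) hi
  simp only [← Finset.prod_coe_sort Aᶜ]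
  simp only [hF]
  simp only [Finset.prod_univ_sum, chanMean_sum]
  refine Finset.sum_congr rfl fun c hc => ?_
  simp only [Finset.prod_mul_distrib, chanMean_const_mul]
  have := chanMean_prod_of_injective (p := p) _ hinj hchan
    (fun x => if (x.2 : Fin n) ∈ c x.1 then 1 else 0) (fun x => if (x.2 : Fin n) ∈ c x.1 then 0 else 1)
  simp only [Fintype.prod_prod_type] at this
  rw [this, mul_comm]
  congr 1
  refine Finset.prod_congr rfl fun v _ => ?_
  have hcv : c v ⊆ A := Finset.mem_powerset.1 (Fintype.mem_piFinset.1 hc v)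
  rw [Finset.prod_coe_sort A fun i => (p * (if i ∈ c v then (1 : ℝ) else 0) +
    (1 - p) * (if i ∈ c v then 0 else 1)), ← Finset.prod_sdiff hcv, mul_comm]
  unfold subsetWeight
  congr 1
  · rw [Finset.prod_congr rfl (g := fun _ => p) fun i hi => by simp [hi]]
    simp
  · rw [Finset.prod_congr rfl (g := fun _ => 1 - p) fun i hi => by simp [(Finset.mem_sdiff.1 hi).2]]
    simp

/-- Given the key rings of the nodes in `A`, the sets of neighbours in `A` of the other nodes are
independent. -/
lemma netMean_prod_nbrsIn (h : K ≤ P) (A : Finset (Fin n))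
    (χ : (Fin n → Finset (Fin P)) → ℝ) (hχ : ∀ S S', (∀ i ∈ A, S i = S' i) → χ S = χ S')
    (ψ : Fin n → Finset (Fin n) → ℝ) :
    netMean K p (fun S G => χ S * ∏ v ∈ Aᶜ, ψ v (nbrsIn A S G v)) =
      keyMean K fun S => χ S * ∏ v ∈ Aᶜ, typeMean K p A S (ψ v) := by
  classical
  have e : ∀ (S : Fin n → Finset (Fin P)) (G : SimpleGraph (Fin n)), ∏ v ∈ Aᶜ, ψ v (nbrsIn A S G v) =
      ∏ v ∈ Aᶜ, ψ v ((A.filter fun i => G.Adj i v).filter fun i => ¬ Disjoint (S v) (S i)) := by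
    intro S G
    refine Finset.prod_congr rfl fun v hv => ?_
    congr 1
    ext i
    have hv := Finset.mem_compl.1 hv
    simp only [nbrsIn, Finset.mem_filter, SimpleGraph.inf_adj, keyGraph,
      Finset.not_disjoint_iff_nonempty_inter, Finset.inter_comm (S v)]
    constructor
    · rintro ⟨h1, h2, h3⟩; exact ⟨⟨h1, h3⟩, h2.2⟩
    · rintro ⟨⟨h1, h3⟩, h2⟩
      exact ⟨h1, ⟨fun h => hv (h ▸ h1), h2⟩, h3⟩
  unfold netMean
  simp only [e, chanMean_const_mul]
  have e2 : ∀ S : Fin n → Finset (Fin P), chanMean p (fun G => ∏ v ∈ Aᶜ,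
      ψ v ((A.filter fun i => G.Adj i v).filter fun i => ¬ Disjoint (S v) (S i))) =
      ∏ v ∈ Aᶜ, ∑ C ∈ A.powerset, subsetWeight p A C *
        ψ v (C.filter fun i => ¬ Disjoint (S v) (S i)) := fun S =>
    chanMean_prod_nbrs A fun v C => ψ v (C.filter fun i => ¬ Disjoint (S v) (S i))
  simp only [e2]
  refine keyMean_prod h Aᶜ χ (fun v S W => ∑ C ∈ A.powerset, subsetWeight p A C *
        ψ v (C.filter fun i => ¬ Disjoint W (S i))) ?_ ?_
  · intro S S' hS
    exact hχ S S' fun i hi => hS i (by simpa using hi)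
  · intro v _ S S' hS
    funext W
    refine Finset.sum_congr rfl fun C hC => ?_
    have hC := Finset.mem_powerset.1 hC
    rw [Finset.filter_congr fun i hi => by rw [hS i (by simpa using hC hi)]]

/-! #### The law of the set of neighbours of an outside node -/

lemma typeMean_mono (h0 : 0 ≤ p) (h1 : p ≤ 1) {A : Finset (Fin n)} {S : Fin n → Finset (Fin P)}
    {ψ ψ' : Finset (Fin n) → ℝ} (h : ∀ B ⊆ A, ψ B ≤ ψ' B) :
    typeMean K p A S ψ ≤ typeMean K p A S ψ' :=
  ringMean_mono fun _ _ => Finset.sum_le_sum fun C hC =>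
    mul_le_mul_of_nonneg_left
      (h _ ((Finset.filter_subset _ _).trans (Finset.mem_powerset.1 hC)))
      (subsetWeight_nonneg h0 h1 A C)

lemma typeMean_const (h : K ≤ P) (A : Finset (Fin n)) (S : Fin n → Finset (Fin P)) (c : ℝ) :
    typeMean K p A S (fun _ => c) = c := by
  simp [typeMean, ← Finset.sum_mul, sum_subsetWeight, ringMean_const h]

lemma typeMean_sub (A : Finset (Fin n)) (S : Fin n → Finset (Fin P)) (ψ ψ' : Finset (Fin n) → ℝ) :
    typeMean K p A S (fun B => ψ B - ψ' B) = typeMean K p A S ψ - typeMean K p A S ψ' := by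
  simp only [typeMean, mul_sub, Finset.sum_sub_distrib, ringMean_sub]

lemma typeMean_sum {ι : Type*} (s : Finset ι) (A : Finset (Fin n)) (S : Fin n → Finset (Fin P))
    (ψ : ι → Finset (Fin n) → ℝ) :
    typeMean K p A S (fun B => ∑ i ∈ s, ψ i B) = ∑ i ∈ s, typeMean K p A S (ψ i) := by
  simp only [typeMean, Finset.mul_sum, ← ringMean_sum]
  congr 1
  funext W
  exact Finset.sum_comm

lemma typeMean_mem (A : Finset (Fin n)) (S : Fin n → Finset (Fin P)) {i : Fin n} (hi : i ∈ A) :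
    typeMean K p A S (fun B => if i ∈ B then 1 else 0) =
      p * ringMean K (fun W => if Disjoint W (S i) then 0 else 1) := by
  unfold typeMean
  rw [← ringMean_const_mul]
  congr 1
  funext W
  by_cases hd : Disjoint W (S i)
  · simp [hd]
  · simpa [hd] using sum_subsetWeight_mem A hi

lemma typeMean_mem_le (h : K ≤ P) (h0 : 0 ≤ p) {A : Finset (Fin n)} {S : Fin n → Finset (Fin P)}
    {i : Fin n} (hi : i ∈ A) (hS : (S i).card = K) :
    typeMean K p A S (fun B => if i ∈ B then 1 else 0) ≤ p * ((K : ℝ) ^ 2 / P) := by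
  rw [typeMean_mem A S hi]
  refine mul_le_mul_of_nonneg_left ((ringMean_not_disjoint_le h _).trans_eq ?_) h0
  rw [hS]; ring

lemma missProb_nonneg (h0 : 0 ≤ p) (h1 : p ≤ 1) (A : Finset (Fin n))
    (S : Fin n → Finset (Fin P)) : 0 ≤ missProb K p A S := by
  unfold missProb typeMean
  refine ringMean_nonneg fun W _ => Finset.sum_nonneg fun C _ =>
    mul_nonneg (subsetWeight_nonneg h0 h1 A C) ?_
  beta_reduce
  split_ifs <;> norm_num

lemma missProb_le_one (h : K ≤ P) (h0 : 0 ≤ p) (h1 : p ≤ 1) (A : Finset (Fin n))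
    (S : Fin n → Finset (Fin P)) : missProb K p A S ≤ 1 := by
  refine (typeMean_mono h0 h1 (ψ' := fun _ => 1) fun B _ => ?_).trans_eq (typeMean_const h A S 1)
  split_ifs <;> norm_num

lemma typeMean_nonempty (h : K ≤ P) (A : Finset (Fin n)) (S : Fin n → Finset (Fin P)) :
    typeMean K p A S (fun B => if B = ∅ then 0 else 1) = 1 - missProb K p A S := by
  have h1 := typeMean_sub (K := K) (p := p) A S (fun _ => 1) fun B => if B = ∅ then 1 else 0
  rw [typeMean_const h] at h1
  rw [missProb, ← h1]
  congr 1
  funext B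
  split_ifs <;> norm_num

/-- A union bound over the nodes of `A`. -/
lemma one_sub_missProb_le (h : K ≤ P) (h0 : 0 ≤ p) (h1 : p ≤ 1) {A : Finset (Fin n)}
    {S : Fin n → Finset (Fin P)} (hS : ∀ i, (S i).card = K) :
    1 - missProb K p A S ≤ A.card * (p * ((K : ℝ) ^ 2 / P)) := by
  rw [← typeMean_nonempty h]
  calc typeMean K p A S (fun B => if B = ∅ then 0 else 1)
      ≤ typeMean K p A S (fun B => ∑ i ∈ A, if i ∈ B then 1 else 0) := by
        refine typeMean_mono h0 h1 fun B hB => ?_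
        have hnn : ∀ i ∈ A, (0 : ℝ) ≤ if i ∈ B then 1 else 0 := fun i _ => by
          split_ifs <;> norm_num
        split_ifs with hB'
        · exact Finset.sum_nonneg hnn
        · obtain ⟨i, hi⟩ := Finset.nonempty_iff_ne_empty.2 hB'
          refine le_trans ?_ (Finset.single_le_sum hnn (hB hi))
          simp [hi]
    _ = ∑ i ∈ A, typeMean K p A S (fun B => if i ∈ B then 1 else 0) := typeMean_sum _ _ _ _
    _ ≤ ∑ i ∈ A, p * ((K : ℝ) ^ 2 / P) :=
        Finset.sum_le_sum fun i hi => typeMean_mem_le h h0 hi (hS i)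
    _ = _ := by simp

lemma typeMean_singleton_le (h : K ≤ P) (h0 : 0 ≤ p) (h1 : p ≤ 1) {A : Finset (Fin n)}
    {S : Fin n → Finset (Fin P)} {i : Fin n} (hi : i ∈ A) (hS : (S i).card = K) :
    typeMean K p A S (fun B => if B = {i} then 1 else 0) ≤ p * ((K : ℝ) ^ 2 / P) := by
  refine (typeMean_mono h0 h1 fun B _ => ?_).trans (typeMean_mem_le h h0 hi hS)
  by_cases hB : B = {i}
  · simp [hB]
  · simp only [hB, if_false]; split_ifs <;> norm_num

/-- If the key rings of the nodes in `A` are disjoint, then an outside node is linked to `i` but to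
no other node of `A` with probability nearly `p * K ^ 2 / P`. -/
lemma le_typeMean_singleton (h : K ≤ P) (h0 : 0 ≤ p) (h1 : p ≤ 1) {A : Finset (Fin n)}
    {S : Fin n → Finset (Fin P)} (hS : ∀ i, (S i).card = K) (hA : excess K A S = 0)
    {i : Fin n} (hi : i ∈ A) :
    p * (1 - Real.exp (-((K : ℝ) ^ 2 / P)) - A.card * ((K : ℝ) ^ 2 / P) ^ 2) ≤
      typeMean K p A S (fun B => if B = {i} then 1 else 0) := by
  have hpair : ∀ j ∈ A.erase i, typeMean K p A S (fun B => if i ∈ B ∧ j ∈ B then 1 else 0) ≤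
      p * ((K : ℝ) ^ 2 / P) ^ 2 := by
    intro j hj
    have hij := (Finset.ne_of_mem_erase hj).symm
    have hdis := disjoint_of_excess_eq_zero hS hA hi (Finset.mem_of_mem_erase hj) hij
    calc typeMean K p A S (fun B => if i ∈ B ∧ j ∈ B then 1 else 0)
        ≤ ringMean K (fun W => p * if Disjoint W (S i) ∨ Disjoint W (S j) then 0 else 1) := by
          refine ringMean_mono fun W _ => ?_
          split_ifs with hd
          · rw [mul_zero]
            refine (Finset.sum_eq_zero fun C _ => ?_).le
            beta_reduce
            rw [if_neg, mul_zero]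
            rintro ⟨hB1, hB2⟩
            rcases hd with hd | hd
            · exact (Finset.mem_filter.1 hB1).2 hd
            · exact (Finset.mem_filter.1 hB2).2 hd
          · refine le_trans ?_ ((sum_subsetWeight_mem (p := p) A hi).trans (mul_one p).symm).le
            refine Finset.sum_le_sum fun C _ =>
              mul_le_mul_of_nonneg_left ?_ (subsetWeight_nonneg h0 h1 A C)
            by_cases hiC : i ∈ C
            · simp only [hiC, if_true]; split_ifs <;> norm_num
            · simp [hiC]
      _ = p * ringMean K (fun W => if Disjoint W (S i) ∨ Disjoint W (S j) then 0 else 1) :=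
          ringMean_const_mul _ _
      _ ≤ p * ((S i).card * (S j).card * (K / P : ℝ) ^ 2) :=
          mul_le_mul_of_nonneg_left (ringMean_not_disjoint_both_le h _ _ hdis) h0
      _ = _ := by rw [hS, hS]; ring
  have hmem : p * (1 - Real.exp (-((K : ℝ) ^ 2 / P))) ≤
      typeMean K p A S (fun B => if i ∈ B then 1 else 0) := by
    rw [typeMean_mem A S hi]
    refine mul_le_mul_of_nonneg_left (le_trans (le_of_eq ?_) (le_ringMean_not_disjoint h _)) h0
    rw [hS, show (K : ℝ) * (K / P) = (K : ℝ) ^ 2 / P by ring]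
  calc p * (1 - Real.exp (-((K : ℝ) ^ 2 / P)) - A.card * ((K : ℝ) ^ 2 / P) ^ 2)
      = p * (1 - Real.exp (-((K : ℝ) ^ 2 / P))) - ∑ j ∈ A, p * ((K : ℝ) ^ 2 / P) ^ 2 := by
        simp; ring
    _ ≤ typeMean K p A S (fun B => if i ∈ B then 1 else 0) -
          ∑ j ∈ A.erase i, typeMean K p A S (fun B => if i ∈ B ∧ j ∈ B then 1 else 0) := by
        refine sub_le_sub hmem ((Finset.sum_le_sum hpair).trans ?_)
        exact Finset.sum_le_sum_of_subset_of_nonneg (Finset.erase_subset _ _)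
          fun _ _ _ => by positivity
    _ = typeMean K p A S (fun B => (if i ∈ B then 1 else 0) -
          ∑ j ∈ A.erase i, if i ∈ B ∧ j ∈ B then 1 else 0) := by
        rw [typeMean_sub, typeMean_sum]
    _ ≤ _ := by
        refine typeMean_mono h0 h1 fun B hB => ?_
        have hnn : ∀ j ∈ A.erase i, (0 : ℝ) ≤ if i ∈ B ∧ j ∈ B then 1 else 0 := fun j _ => by
          split_ifs <;> norm_num
        by_cases hiB : i ∈ B
        · rw [if_pos hiB]
          by_cases hBi : B = {i}
          · rw [if_pos hBi]
            linarith [Finset.sum_nonneg hnn]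
          · obtain ⟨j, hj, hji⟩ : ∃ j ∈ B, j ≠ i := by
              by_contra hcon
              push Not at hcon
              exact hBi (Finset.eq_singleton_iff_unique_mem.2 ⟨hiB, hcon⟩)
            have := Finset.single_le_sum hnn (Finset.mem_erase.2 ⟨hji, hB hj⟩)
            rw [if_pos ⟨hiB, hj⟩] at this
            rw [if_neg hBi]
            linarith
        · have := Finset.sum_nonneg hnn
          simp only [hiB, if_false]
          have h2 : B ≠ {i} := fun h => hiB (by simp [h])
          simp [h2]

/-! #### Bounds for the probability of having no neighbour in `A` -/

/-- The outside node has no neighbour in `A` if its ring avoids the rings of the nodes in the set `C`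
of those to which its channels are on. -/
lemma missProb_le_sum (h : K ≤ P) (h0 : 0 ≤ p) (h1 : p ≤ 1) (A : Finset (Fin n))
    (S : Fin n → Finset (Fin P)) :
    missProb K p A S ≤ ∑ C ∈ A.powerset, subsetWeight p A C *
      Real.exp (-((C.biUnion S).card * (K / P : ℝ))) := by
  unfold missProb typeMean
  rw [ringMean_sum]
  refine Finset.sum_le_sum fun C _ => ?_
  rw [ringMean_const_mul]
  refine mul_le_mul_of_nonneg_left (le_trans (le_of_eq ?_) (ringMean_disjoint_le h _))
    (subsetWeight_nonneg h0 h1 A C)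
  congr 1
  funext W
  simp [Finset.filter_eq_empty_iff, Finset.disjoint_biUnion_right]

/-- The keys of a union of rings can be divided among the rings that hold them. -/
lemma exists_key_owners (A : Finset (Fin n)) (S : Fin n → Finset (Fin P)) :
    ∃ d : Fin n → ℕ, (∀ i, d i ≤ (S i).card) ∧ ∑ i ∈ A, d i = (A.biUnion S).card ∧
      ∀ C ⊆ A, ∑ i ∈ C, d i ≤ (C.biUnion S).card := by
  classical
  have hex : ∀ x ∈ A.biUnion S, ∃ i ∈ A, x ∈ S i := fun x hx => by simpa using hx
  rcases A.eq_empty_or_nonempty with rfl | ⟨a, -⟩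
  · exact ⟨0, by simp, by simp, by simp⟩
  have : Nonempty (Fin n) := ⟨a⟩
  choose! o ho using hex
  refine ⟨fun i => ((A.biUnion S).filter fun x => o x = i).card, fun i => ?_, ?_, fun C hC => ?_⟩
  · refine Finset.card_le_card fun x hx => ?_
    obtain ⟨h1, rfl⟩ := Finset.mem_filter.1 hx
    exact (ho x h1).2
  · exact (Finset.card_eq_sum_card_fiberwise fun x hx => (ho x hx).1).symm
  · have : ∑ i ∈ C, ((A.biUnion S).filter fun x => o x = i).card =
        ((A.biUnion S).filter fun x => o x ∈ C).card := by
      rw [Finset.card_eq_sum_card_fiberwise (t := C) (f := o)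
        (s := (A.biUnion S).filter fun x => o x ∈ C) fun x hx => (Finset.mem_filter.1 hx).2]
      refine Finset.sum_congr rfl fun i hi => ?_
      congr 1
      ext x
      simp only [Finset.mem_filter]
      constructor
      · rintro ⟨h1, rfl⟩; exact ⟨⟨h1, hi⟩, rfl⟩
      · rintro ⟨⟨h1, -⟩, h2⟩; exact ⟨h1, h2⟩
    rw [this]
    refine Finset.card_le_card fun x hx => ?_
    obtain ⟨h1, h2⟩ := Finset.mem_filter.1 hx
    exact Finset.mem_biUnion.2 ⟨o x, h2, (ho x h1).2⟩

/-- Convexity of the exponential function on `[-σ, 0]`. -/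
lemma mul_one_sub_exp_le {t σ : ℝ} (ht0 : 0 ≤ t) (ht1 : t ≤ 1) :
    t * (1 - Real.exp (-σ)) ≤ 1 - Real.exp (-(t * σ)) := by
  have := convexOn_exp.2 (Set.mem_univ (-σ)) (Set.mem_univ 0) ht0 (sub_nonneg.2 ht1) (by ring)
  simp only [smul_eq_mul, mul_zero, add_zero, Real.exp_zero, mul_one] at this
  rw [show t * -σ = -(t * σ) by ring] at this
  linarith

/-- Every key lost to an overlap costs at most `1 / K` of the contribution of a node: assigning every
key to one of its owners, one may treat the rings as disjoint but smaller. -/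
lemma missProb_le_exp (h : K ≤ P) (hK : 0 < K) (h0 : 0 ≤ p) (h1 : p ≤ 1) {A : Finset (Fin n)}
    {S : Fin n → Finset (Fin P)} (hS : ∀ i, (S i).card = K) :
    missProb K p A S ≤ Real.exp (-(p * (1 - Real.exp (-((K : ℝ) ^ 2 / P))) *
      (A.card - (excess K A S : ℝ) / K))) := by
  obtain ⟨d, hd1, hd2, hd3⟩ := exists_key_owners A S
  have hK' : (0 : ℝ) < K := by exact_mod_cast hK
  set s := 1 - Real.exp (-((K : ℝ) ^ 2 / P)) with hs
  calc missProb K p A S ≤ ∑ C ∈ A.powerset, subsetWeight p A C *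
        Real.exp (-((C.biUnion S).card * (K / P : ℝ))) := missProb_le_sum h h0 h1 A S
    _ ≤ ∑ C ∈ A.powerset, subsetWeight p A C * ∏ i ∈ C, Real.exp (-(d i * (K / P : ℝ))) := by
        refine Finset.sum_le_sum fun C hC =>
          mul_le_mul_of_nonneg_left ?_ (subsetWeight_nonneg h0 h1 A C)
        rw [← Real.exp_sum]
        refine Real.exp_le_exp.2 ?_
        rw [Finset.sum_neg_distrib, ← Finset.sum_mul]
        have : ∑ i ∈ C, (d i : ℝ) ≤ (C.biUnion S).card := by
          exact_mod_cast hd3 C (Finset.mem_powerset.1 hC)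
        have hKP : (0 : ℝ) ≤ K / P := by positivity
        nlinarith
    _ = ∏ i ∈ A, (p * Real.exp (-(d i * (K / P : ℝ))) + (1 - p)) := sum_subsetWeight_mul_prod _ _
    _ ≤ ∏ i ∈ A, Real.exp (-(p * s * (d i / K))) := by
        refine Finset.prod_le_prod (fun i _ => ?_) fun i _ => ?_
        · have : 0 ≤ 1 - p := by linarith
          positivity
        · have hdK : (d i : ℝ) / K ≤ 1 := by
            rw [div_le_one hK']; exact_mod_cast (hS i) ▸ hd1 i
          have := mul_one_sub_exp_le (σ := (K : ℝ) ^ 2 / P) (by positivity : 0 ≤ (d i : ℝ) / K) hdK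
          rw [show (d i : ℝ) / K * ((K : ℝ) ^ 2 / P) = d i * (K / P) by field_simp] at this
          have h3 := Real.add_one_le_exp (-(p * s * (d i / K)))
          nlinarith [mul_le_mul_of_nonneg_left this h0]
    _ = Real.exp (-(p * s * ((A.biUnion S).card / K))) := by
        rw [← Real.exp_sum, Finset.sum_neg_distrib, ← Finset.mul_sum, ← Finset.sum_div, ← hd2]
        push_cast
        rfl
    _ = _ := by
        have := excess_add hS A
        have : (excess K A S : ℝ) + (A.biUnion S).card = A.card * K := by exact_mod_cast this
        congr 4
        field_simp
        linarith

end Links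

/-! ### Sets of nodes with few outside neighbours -/

section Boundary
variable {n P K : ℕ} {p : ℝ}

/-- The number of sets of at most `J` elements, weighted by powers of `x`. -/
lemma sum_pow_card_le (D : Finset (Fin n)) (J : ℕ) {x : ℝ} (hx : 0 ≤ x) :
    ∑ T ∈ D.powerset.filter (fun T => T.card ≤ J), x ^ T.card ≤ (1 + D.card * x) ^ J := by
  rw [Finset.sum_filter, Finset.sum_powerset_apply_card (fun t => if t ≤ J then x ^ t else 0)]
  simp only [nsmul_eq_mul, mul_ite, mul_zero]
  rw [← Finset.sum_filter, add_comm (1 : ℝ), add_pow]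
  calc ∑ t ∈ (Finset.range (D.card + 1)).filter (· ≤ J), ((D.card.choose t : ℕ) : ℝ) * x ^ t
      ≤ ∑ t ∈ Finset.range (J + 1), ((D.card.choose t : ℕ) : ℝ) * x ^ t := by
        refine Finset.sum_le_sum_of_subset_of_nonneg (fun t ht => ?_) fun _ _ _ => by positivity
        have := (Finset.mem_filter.1 ht).2
        simpa using Nat.lt_succ_of_le this
    _ ≤ ∑ t ∈ Finset.range (J + 1), ((D.card : ℝ) * x) ^ t * 1 ^ (J - t) * (J.choose t : ℕ) := by
        refine Finset.sum_le_sum fun t ht => ?_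
        have h1 : ((D.card.choose t : ℕ) : ℝ) ≤ (D.card : ℝ) ^ t := by
          exact_mod_cast Nat.choose_le_pow _ _
        have h2 : (1 : ℝ) ≤ (J.choose t : ℕ) := by
          exact_mod_cast Nat.choose_pos (Nat.lt_succ_iff.1 (Finset.mem_range.1 ht))
        rw [one_pow, mul_one, mul_pow]
        calc ((D.card.choose t : ℕ) : ℝ) * x ^ t ≤ (D.card : ℝ) ^ t * x ^ t := by gcongr
          _ ≤ _ := le_mul_of_one_le_right (by positivity) h2

/-- The probability that `A` has at most `J` outside neighbours, in terms of the conditional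
probability that an outside node has no neighbour in `A`. The function `χ` restricts to an event
that depends on the key rings of `A` only. -/
lemma netMean_boundary_card_le (h : K ≤ P) (h0 : 0 ≤ p) (h1 : p ≤ 1) (A : Finset (Fin n)) (J : ℕ)
    (χ : (Fin n → Finset (Fin P)) → ℝ) (hχ : ∀ S S', (∀ i ∈ A, S i = S' i) → χ S = χ S')
    (hχ0 : ∀ S, 0 ≤ χ S) :
    netMean K p (fun S G => χ S * if (boundary A S G).card ≤ J then 1 else 0) ≤
      (1 + A.card * (n * (p * ((K : ℝ) ^ 2 / P)))) ^ J *
        keyMean K fun S => χ S * missProb K p A S ^ (n - A.card - J) := by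
  classical
  -- `∏ v ∈ Aᶜ, ψ T v (nbrsIn A S G v)` is the indicator that `T` is the boundary of `A`
  set ψ : Finset (Fin n) → Fin n → Finset (Fin n) → ℝ := fun T v B =>
    if v ∈ T then (if B = ∅ then 0 else 1) else (if B = ∅ then 1 else 0) with hψ
  set 𝒯 := Aᶜ.powerset.filter (fun T => T.card ≤ J) with h𝒯
  have hσ : 0 ≤ p * ((K : ℝ) ^ 2 / P) := by positivity
  have hcardA : Aᶜ.card = n - A.card := by rw [Finset.card_compl, Fintype.card_fin]
  calc netMean K p (fun S G => χ S * if (boundary A S G).card ≤ J then 1 else 0)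
      ≤ netMean K p (fun S G => ∑ T ∈ 𝒯, χ S * ∏ v ∈ Aᶜ, ψ T v (nbrsIn A S G v)) := by
        refine netMean_mono h0 h1 fun S G _ => ?_
        rw [← Finset.mul_sum]
        refine mul_le_mul_of_nonneg_left ?_ (hχ0 S)
        have hnn : ∀ T ∈ 𝒯, 0 ≤ ∏ v ∈ Aᶜ, ψ T v (nbrsIn A S G v) := fun T _ =>
          Finset.prod_nonneg fun v _ => by simp only [hψ]; split_ifs <;> norm_num
        split_ifs with hJ
        · have hmem : boundary A S G ∈ 𝒯 :=
            Finset.mem_filter.2 ⟨Finset.mem_powerset.2 (Finset.filter_subset _ _), hJ⟩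
          refine le_trans (le_of_eq ?_) (Finset.single_le_sum hnn hmem)
          symm
          refine Finset.prod_eq_one fun v hv => ?_
          have : v ∈ boundary A S G ↔ nbrsIn A S G v ≠ ∅ := by
            simp only [boundary, Finset.mem_filter, hv, true_and, Finset.nonempty_iff_ne_empty]
          simp only [hψ, this]
          by_cases hN : nbrsIn A S G v = ∅ <;> simp [hN]
        · exact Finset.sum_nonneg hnn
    _ = ∑ T ∈ 𝒯, keyMean K fun S => χ S * ∏ v ∈ Aᶜ, typeMean K p A S (ψ T v) := by
        rw [netMean_sum]
        exact Finset.sum_congr rfl fun T _ => netMean_prod_nbrsIn h A χ hχ (ψ T)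
    _ ≤ ∑ T ∈ 𝒯, (A.card * (p * ((K : ℝ) ^ 2 / P))) ^ T.card *
          keyMean K fun S => χ S * missProb K p A S ^ (n - A.card - J) := by
        refine Finset.sum_le_sum fun T hT => ?_
        obtain ⟨hT1, hT2⟩ := Finset.mem_filter.1 hT
        have hT1 := Finset.mem_powerset.1 hT1
        rw [← keyMean_const_mul]
        refine keyMean_mono fun S hS => ?_
        have hf0 := missProb_nonneg (K := K) h0 h1 A S
        have hf1 := missProb_le_one h h0 h1 A S
        have hprod : ∏ v ∈ Aᶜ, typeMean K p A S (ψ T v) =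
            (1 - missProb K p A S) ^ T.card * missProb K p A S ^ (Aᶜ \ T).card := by
          rw [← Finset.prod_sdiff hT1, mul_comm, ← Finset.prod_const, ← Finset.prod_const]
          congr 1
          · refine Finset.prod_congr rfl fun v hv => ?_
            rw [← typeMean_nonempty h]
            simp only [hψ, hv, if_true]
          · refine Finset.prod_congr rfl fun v hv => ?_
            simp only [hψ, (Finset.mem_sdiff.1 hv).2, if_false, missProb]
        rw [hprod]
        have hcard : n - A.card - J ≤ (Aᶜ \ T).card := by
          rw [Finset.card_sdiff_of_subset hT1, hcardA]; omega
        calc χ S * ((1 - missProb K p A S) ^ T.card * missProb K p A S ^ (Aᶜ \ T).card)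
            ≤ χ S * ((A.card * (p * ((K : ℝ) ^ 2 / P))) ^ T.card *
                missProb K p A S ^ (n - A.card - J)) := by
              refine mul_le_mul_of_nonneg_left ?_ (hχ0 S)
              refine mul_le_mul ?_ (pow_le_pow_of_le_one hf0 hf1 hcard) (by positivity)
                (by positivity)
              exact pow_le_pow_left₀ (by linarith) (one_sub_missProb_le h h0 h1 hS) _
          _ = _ := by ring
    _ ≤ _ := by
        rw [← Finset.sum_mul]
        have hk : 0 ≤ keyMean K fun S : Fin n → Finset (Fin P) =>
            χ S * missProb K p A S ^ (n - A.card - J) :=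
          keyMean_nonneg fun S _ => mul_nonneg (hχ0 S) (pow_nonneg (missProb_nonneg h0 h1 A S) _)
        refine mul_le_mul_of_nonneg_right ((sum_pow_card_le Aᶜ J (by positivity)).trans ?_) hk
        refine pow_le_pow_left₀ (by positivity) ?_ _
        have : (Aᶜ.card : ℝ) ≤ n := by
          rw [hcardA]; exact_mod_cast Nat.sub_le _ _
        have h3 : (Aᶜ.card : ℝ) * (A.card * (p * ((K : ℝ) ^ 2 / P))) ≤
          n * (A.card * (p * ((K : ℝ) ^ 2 / P))) := by gcongr
        linarith

/-! ### Families of disjoint sets -/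

open Classical in
/-- The families of disjoint `d`-element subsets of `D` indexed by the nodes in `A` (extended by
the empty set outside `A`). -/
noncomputable def disjFamilies (d : ℕ) (A D : Finset (Fin n)) : Finset (Fin n → Finset (Fin n)) :=
  (Fintype.piFinset fun i => if i ∈ A then D.powersetCard d else {∅}).filter fun T =>
    ∀ i ∈ A, ∀ j ∈ A, i ≠ j → Disjoint (T i) (T j)

lemma mem_disjFamilies {d : ℕ} {A D : Finset (Fin n)} {T : Fin n → Finset (Fin n)} :
    T ∈ disjFamilies d A D ↔ (∀ i ∈ A, T i ⊆ D ∧ (T i).card = d) ∧ (∀ i ∉ A, T i = ∅) ∧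
      ∀ i ∈ A, ∀ j ∈ A, i ≠ j → Disjoint (T i) (T j) := by
  simp only [disjFamilies, Finset.mem_filter, Fintype.mem_piFinset, ← and_assoc]
  refine and_congr_left fun _ => ?_
  constructor
  · refine fun h => ⟨fun i hi => ?_, fun i hi => ?_⟩
    · have := h i
      rw [if_pos hi] at this
      exact Finset.mem_powersetCard.1 this
    · have := h i
      rw [if_neg hi] at this
      exact Finset.mem_singleton.1 this
  · rintro ⟨h1, h2⟩ i
    by_cases hi : i ∈ A
    · rw [if_pos hi]; exact Finset.mem_powersetCard.2 (h1 i hi)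
    · rw [if_neg hi]; exact Finset.mem_singleton.2 (h2 i hi)

lemma card_disjFamilies_le (d : ℕ) (A D : Finset (Fin n)) :
    (disjFamilies d A D).card ≤ D.card.choose d ^ A.card := by
  classical
  refine (Finset.card_filter_le _ _).trans_eq ?_
  rw [Fintype.card_piFinset]
  have : ∀ i, (if i ∈ A then D.powersetCard d else {∅}).card =
      if i ∈ A then D.card.choose d else 1 := by
    intro i; split_ifs <;> simp
  simp only [this, Finset.prod_ite_mem, Finset.univ_inter, Finset.prod_const]

lemma le_card_disjFamilies (d : ℕ) (A D : Finset (Fin n)) :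
    (D.card - A.card * d).choose d ^ A.card ≤ (disjFamilies d A D).card := by
  classical
  induction A using Finset.induction_on with
  | empty =>
    rw [Finset.card_empty, pow_zero, Nat.one_le_iff_ne_zero, Finset.card_ne_zero]
    exact ⟨fun _ => ∅, mem_disjFamilies.2 (by simp)⟩
  | insert a A ha ih =>
    rw [Finset.card_insert_of_notMem ha, pow_succ]
    have hmono : (D.card - (A.card + 1) * d).choose d ≤ (D.card - A.card * d).choose d :=
      Nat.choose_le_choose _ (by rw [add_mul]; omega)
    -- a family indexed by `A` extends to `insert a A` by any set that avoids its members
    set Q := (disjFamilies d A D).sigma fun T => (D \ A.biUnion T).powersetCard d with hQ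
    have hQcard : (disjFamilies d A D).card * (D.card - (A.card + 1) * d).choose d ≤ Q.card := by
      rw [hQ, Finset.card_sigma, ← smul_eq_mul, ← Finset.sum_const]
      refine Finset.sum_le_sum fun T hT => ?_
      obtain ⟨h1, -, -⟩ := mem_disjFamilies.1 hT
      rw [Finset.card_powersetCard]
      refine Nat.choose_le_choose _ ?_
      have h2 : (A.biUnion T).card ≤ A.card * d :=
        Finset.card_biUnion_le_card_mul _ _ _ fun i hi => (h1 i hi).2.le
      have h3 := Finset.le_card_sdiff (A.biUnion T) D
      rw [add_mul]
      omega
    calc (D.card - (A.card + 1) * d).choose d ^ A.card * (D.card - (A.card + 1) * d).choose d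
        ≤ (disjFamilies d A D).card * (D.card - (A.card + 1) * d).choose d :=
          Nat.mul_le_mul_right _ ((Nat.pow_le_pow_left hmono _).trans ih)
      _ ≤ Q.card := hQcard
      _ ≤ _ := by
        refine Finset.card_le_card_of_injOn (fun x => Function.update x.1 a x.2) ?_ ?_
        · rintro ⟨T, X⟩ hx
          obtain ⟨hT, hX⟩ := Finset.mem_sigma.1 hx
          obtain ⟨h1, h2, h3⟩ := mem_disjFamilies.1 hT
          obtain ⟨hX1, hX2⟩ := Finset.mem_powersetCard.1 hX
          have hu : ∀ i ∈ A, Function.update T a X i = T i := fun i hi =>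
            Function.update_of_ne (by rintro rfl; exact ha hi) _ _
          have hXT : ∀ i ∈ A, Disjoint X (T i) := fun i hi =>
            (Finset.disjoint_of_subset_left hX1 Finset.sdiff_disjoint).mono_right
              (Finset.subset_biUnion_of_mem T hi)
          refine mem_disjFamilies.2 ⟨fun i hi => ?_, fun i hi => ?_, fun i hi j hj hij => ?_⟩
          · rcases Finset.mem_insert.1 hi with rfl | hi
            · simpa using ⟨hX1.trans Finset.sdiff_subset, hX2⟩
            · simpa [hu i hi] using h1 i hi
          · simp only [Finset.mem_insert, not_or] at hi
            simpa [Function.update_of_ne hi.1] using h2 i hi.2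
          · rcases Finset.mem_insert.1 hi with rfl | hi' <;>
              rcases Finset.mem_insert.1 hj with rfl | hj'
            · exact absurd rfl hij
            · simpa [hu j hj'] using hXT j hj'
            · simpa [hu i hi'] using (hXT i hi').symm
            · simpa [hu i hi', hu j hj'] using h3 i hi' j hj' hij
        · rintro ⟨T, X⟩ hx ⟨T', X'⟩ hx' he
          obtain ⟨hT, -⟩ := Finset.mem_sigma.1 hx
          obtain ⟨hT', -⟩ := Finset.mem_sigma.1 hx'
          have h2 := (mem_disjFamilies.1 hT).2.1 a ha
          have h2' := (mem_disjFamilies.1 hT').2.1 a ha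
          have he1 : X = X' := by simpa using congrFun he a
          have he2 : T = T' := by
            funext i
            by_cases hi : i = a
            · subst hi; exact h2.trans h2'.symm
            · simpa [hi] using congrFun he i
          rw [he1, he2]

/-! ### Nodes of prescribed degree -/

open Classical in
/-- The neighbours of a node in the network. -/
noncomputable def nbrs (S : Fin n → Finset (Fin P)) (G : SimpleGraph (Fin n)) (i : Fin n) :
    Finset (Fin n) :=
  Finset.univ.filter fun j => (keyGraph S ⊓ G).Adj i j

lemma mem_nbrs {S : Fin n → Finset (Fin P)} {G : SimpleGraph (Fin n)} {i j : Fin n} :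
    j ∈ nbrs S G i ↔ (keyGraph S ⊓ G).Adj i j := by
  simp [nbrs]

lemma mem_nbrsIn {A : Finset (Fin n)} {S : Fin n → Finset (Fin P)} {G : SimpleGraph (Fin n)}
    {i v : Fin n} : i ∈ nbrsIn A S G v ↔ i ∈ A ∧ (keyGraph S ⊓ G).Adj i v := by
  simp only [nbrsIn, Finset.mem_filter]

lemma boundary_subset_biUnion_nbrs (A : Finset (Fin n)) (S : Fin n → Finset (Fin P))
    (G : SimpleGraph (Fin n)) : boundary A S G ⊆ A.biUnion (nbrs S G) := by
  intro v hv
  obtain ⟨i, hi⟩ := (Finset.mem_filter.1 hv).2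
  obtain ⟨hiA, hadj⟩ := mem_nbrsIn.1 hi
  exact Finset.mem_biUnion.2 ⟨i, hiA, mem_nbrs.2 hadj⟩

lemma boundary_card_le_of_nbrs {A : Finset (Fin n)} {S : Fin n → Finset (Fin P)}
    {G : SimpleGraph (Fin n)} {d : ℕ} (hd : ∀ i ∈ A, (nbrs S G i).card = d) :
    (boundary A S G).card ≤ A.card * d :=
  (Finset.card_le_card (boundary_subset_biUnion_nbrs A S G)).trans
    (Finset.card_biUnion_le_card_mul _ _ _ fun i hi => (hd i hi).le)

/-- There is no link within a set of nodes with disjoint key rings. -/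
lemma nbrs_eq_of_excess_eq_zero {A : Finset (Fin n)} {S : Fin n → Finset (Fin P)}
    (hS : ∀ i, (S i).card = K) (hA : excess K A S = 0) (G : SimpleGraph (Fin n)) {i : Fin n}
    (hi : i ∈ A) : nbrs S G i = Aᶜ.filter fun v => i ∈ nbrsIn A S G v := by
  ext v
  rw [Finset.mem_filter, mem_nbrs, mem_nbrsIn, Finset.mem_compl]
  refine ⟨fun h => ⟨fun hv => ?_, hi, h⟩, fun h => h.2.2⟩
  have h1 : (keyGraph S).Adj i v := h.1
  have := disjoint_of_excess_eq_zero hS hA hi hv h1.1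
  rw [Finset.disjoint_iff_inter_eq_empty] at this
  exact (Finset.nonempty_iff_ne_empty.1 h1.2) this

/-- The indicator that every node of `A` has `d` neighbours outside `A`, and that no two nodes of
`A` have a common neighbour outside `A` (`separated_eq`): the sum is over the possible families
`T` of neighbourhoods. -/
noncomputable def separated (d : ℕ) (A : Finset (Fin n)) (S : Fin n → Finset (Fin P))
    (G : SimpleGraph (Fin n)) : ℝ :=
  ∑ T ∈ disjFamilies d A Aᶜ, ∏ v ∈ Aᶜ, if nbrsIn A S G v = A.filter (fun i => v ∈ T i) then 1 else 0

open Classical in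
lemma separated_eq (d : ℕ) (A : Finset (Fin n)) (S : Fin n → Finset (Fin P))
    (G : SimpleGraph (Fin n)) : separated d A S G =
      if (fun i => if i ∈ A then Aᶜ.filter fun v => i ∈ nbrsIn A S G v else ∅) ∈
        disjFamilies d A Aᶜ then 1 else 0 := by
  set T₀ : Fin n → Finset (Fin n) :=
    fun i => if i ∈ A then Aᶜ.filter fun v => i ∈ nbrsIn A S G v else ∅ with hT₀
  have : ∀ T ∈ disjFamilies d A Aᶜ, (∏ v ∈ Aᶜ, if nbrsIn A S G v = A.filter (fun i => v ∈ T i)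
      then (1 : ℝ) else 0) = if T = T₀ then 1 else 0 := by
    intro T hT
    obtain ⟨h1, h2, -⟩ := mem_disjFamilies.1 hT
    split_ifs with he
    · refine Finset.prod_eq_one fun v hv => if_pos ?_
      subst he
      ext i
      by_cases hi : i ∈ A
      · simp [hT₀, hi, Finset.mem_compl.1 hv]
      · simp [nbrsIn, hi]
    · obtain ⟨i, hi⟩ := Function.ne_iff.1 he
      have hiA : i ∈ A := by
        by_contra hiA
        exact hi (by simp [hT₀, hiA, h2 i hiA])
      obtain ⟨v, hv⟩ : ∃ v, ¬ (v ∈ T i ↔ v ∈ T₀ i) := by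
        by_contra hcon
        push Not at hcon
        exact hi (Finset.ext hcon)
      have hvA : v ∈ Aᶜ := by
        by_contra hvA
        refine hv ⟨fun h => absurd ((h1 i hiA).1 h) hvA, fun h => ?_⟩
        simp only [hT₀, hiA, if_true] at h
        exact absurd (Finset.mem_filter.1 h).1 hvA
      refine Finset.prod_eq_zero hvA (if_neg fun hN => hv ?_)
      simp only [hT₀, hiA, if_true, Finset.mem_filter, hvA, true_and, hN]
  unfold separated
  rw [Finset.sum_congr rfl this]
  simp

lemma separated_le {d : ℕ} {A : Finset (Fin n)} {S : Fin n → Finset (Fin P)}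
    (hS : ∀ i, (S i).card = K) (hA : excess K A S = 0) (G : SimpleGraph (Fin n)) :
    separated d A S G ≤ if ∀ i ∈ A, (nbrs S G i).card = d then 1 else 0 := by
  classical
  rw [separated_eq]
  split_ifs with h1 h2 h2
  · exact le_rfl
  · refine absurd (fun i hi => ?_) h2
    have := ((mem_disjFamilies.1 h1).1 i hi).2
    rw [if_pos hi, ← nbrs_eq_of_excess_eq_zero hS hA G hi] at this
    exact this
  · norm_num
  · exact le_rfl

/-- If `A` has the largest number of outside neighbours that is compatible with the degrees, then
its nodes have no common neighbours. -/
lemma separated_eq_one {d : ℕ} {A : Finset (Fin n)} {S : Fin n → Finset (Fin P)}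
    (hS : ∀ i, (S i).card = K) (hA : excess K A S = 0) {G : SimpleGraph (Fin n)}
    (hd : ∀ i ∈ A, (nbrs S G i).card = d) (hb : A.card * d ≤ (boundary A S G).card) :
    separated d A S G = 1 := by
  classical
  rw [separated_eq, if_pos]
  have e : ∀ i ∈ A, (if i ∈ A then Aᶜ.filter fun v => i ∈ nbrsIn A S G v else ∅) = nbrs S G i :=
    fun i hi => by rw [if_pos hi, nbrs_eq_of_excess_eq_zero hS hA G hi]
  refine mem_disjFamilies.2 ⟨fun i hi => ?_, fun i hi => if_neg hi, fun i hi j hj hij => ?_⟩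
  · rw [e i hi]
    refine ⟨?_, hd i hi⟩
    rw [nbrs_eq_of_excess_eq_zero hS hA G hi]
    exact Finset.filter_subset _ _
  · rw [e i hi, e j hj]
    by_contra hcon
    obtain ⟨v, hvi, hvj⟩ := Finset.not_disjoint_iff.1 hcon
    -- the common neighbour `v` of `i` and `j` is counted once only
    have hsub : boundary A S G ⊆ (A.erase i).biUnion (nbrs S G) ∪ (nbrs S G i).erase v := by
      intro w hw
      obtain ⟨l, hl, hwl⟩ := Finset.mem_biUnion.1 (boundary_subset_biUnion_nbrs A S G hw)
      by_cases hwv : w = v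
      · subst hwv
        exact Finset.mem_union_left _
          (Finset.mem_biUnion.2 ⟨j, Finset.mem_erase.2 ⟨hij.symm, hj⟩, hvj⟩)
      · by_cases hli : l = i
        · subst hli
          exact Finset.mem_union_right _ (Finset.mem_erase.2 ⟨hwv, hwl⟩)
        · exact Finset.mem_union_left _
            (Finset.mem_biUnion.2 ⟨l, Finset.mem_erase.2 ⟨hli, hl⟩, hwl⟩)
    have h1 := (Finset.card_le_card hsub).trans (Finset.card_union_le _ _)
    have h2 : ((A.erase i).biUnion (nbrs S G)).card ≤ (A.erase i).card * d :=
      Finset.card_biUnion_le_card_mul _ _ _ fun l hl => (hd l (Finset.mem_of_mem_erase hl)).le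
    have h3 := Finset.card_erase_of_mem hvi
    have h4 := Finset.card_pos.2 ⟨v, hvi⟩
    have h5 := Finset.card_erase_add_one hi
    rw [hd i hi] at h3 h4
    rw [← h5, add_mul, one_mul] at hb
    omega

/-- The expectation of the indicator `separated`, for a set of nodes with disjoint key rings. -/
lemma netMean_separated (h : K ≤ P) (d : ℕ) (A : Finset (Fin n)) :
    netMean K p (fun (S : Fin n → Finset (Fin P)) G =>
        (if excess K A S = 0 then 1 else 0) * separated d A S G) =
      keyMean K fun S : Fin n → Finset (Fin P) => (if excess K A S = 0 then 1 else 0) *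
        ((disjFamilies d A Aᶜ).card * (missProb K p A S ^ (n - A.card - A.card * d) *
          ∏ i ∈ A, typeMean K p A S (fun B => if B = {i} then 1 else 0) ^ d)) := by
  classical
  unfold separated
  simp only [Finset.mul_sum]
  rw [netMean_sum]
  have hT : ∀ T ∈ disjFamilies d A Aᶜ, ∀ S : Fin n → Finset (Fin P), ∏ v ∈ Aᶜ, typeMean K p A S
      (fun B => if B = A.filter (fun i => v ∈ T i) then 1 else 0) =
      missProb K p A S ^ (n - A.card - A.card * d) *
          ∏ i ∈ A, typeMean K p A S (fun B => if B = {i} then 1 else 0) ^ d := by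
    intro T hT S
    obtain ⟨h1, h2, h3⟩ := mem_disjFamilies.1 hT
    have hsub : A.biUnion T ⊆ Aᶜ := Finset.biUnion_subset.2 fun i hi => (h1 i hi).1
    rw [← Finset.prod_sdiff hsub]
    congr 1
    · have hc : (Aᶜ \ A.biUnion T).card = n - A.card - A.card * d := by
        rw [Finset.card_sdiff_of_subset hsub, Finset.card_biUnion h3,
          Finset.sum_congr rfl fun i hi => (h1 i hi).2, Finset.sum_const, smul_eq_mul,
          Finset.card_compl, Fintype.card_fin]
      rw [← hc, ← Finset.prod_const]
      refine Finset.prod_congr rfl fun v hv => ?_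
      have hv := (Finset.mem_sdiff.1 hv).2
      have : A.filter (fun i => v ∈ T i) = ∅ := by
        refine Finset.filter_false_of_mem fun i hi hvi => hv (Finset.mem_biUnion.2 ⟨i, hi, hvi⟩)
      simp only [this, missProb]
    · rw [Finset.prod_biUnion h3]
      refine Finset.prod_congr rfl fun i hi => ?_
      rw [← (h1 i hi).2, ← Finset.prod_const]
      refine Finset.prod_congr rfl fun v hv => ?_
      have : A.filter (fun j => v ∈ T j) = {i} := by
        ext j
        simp only [Finset.mem_filter, Finset.mem_singleton]
        constructor
        · rintro ⟨hj, hvj⟩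
          by_contra hji
          exact Finset.disjoint_left.1 (h3 i hi j hj (Ne.symm hji)) hv hvj
        · rintro rfl; exact ⟨hi, hv⟩
      simp only [this]
  have key : ∀ T ∈ disjFamilies d A Aᶜ, netMean K p (fun (S : Fin n → Finset (Fin P)) G =>
      (if excess K A S = 0 then (1 : ℝ) else 0) * ∏ v ∈ Aᶜ,
        if nbrsIn A S G v = A.filter (fun i => v ∈ T i) then 1 else 0) =
      keyMean K fun S : Fin n → Finset (Fin P) => (if excess K A S = 0 then 1 else 0) *
        (missProb K p A S ^ (n - A.card - A.card * d) *
          ∏ i ∈ A, typeMean K p A S (fun B => if B = {i} then 1 else 0) ^ d) := by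
    intro T hT'
    rw [netMean_prod_nbrsIn h A (fun S => if excess K A S = 0 then (1 : ℝ) else 0)
      (fun S S' hS => by rw [excess_congr hS])
      (fun v B => if B = A.filter (fun i => v ∈ T i) then 1 else 0)]
    exact keyMean_congr fun S _ => by rw [hT T hT' S]
  rw [Finset.sum_congr rfl key, Finset.sum_const, nsmul_eq_mul, ← keyMean_const_mul]
  exact keyMean_congr fun S _ => by ring

end Boundary

/-! ### `k`-connectivity, degrees and outside neighbours -/

section Graph
variable {n k : ℕ}

/-- Otherwise the deletion of the neighbours of `i` isolates `i` from the remaining nodes. -/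
lemma IsKConnected.le_degree {H : SimpleGraph (Fin n)} (hH : IsKConnected H k)
    [∀ i, DecidablePred (H.Adj i)] (i : Fin n) : k ≤ (Finset.univ.filter (H.Adj i)).card := by
  by_contra hlt
  push Not at hlt
  set N := Finset.univ.filter (H.Adj i) with hN
  have hconn := hH.2 N ∅ (by simpa using hlt)
  have hi : i ∈ ((N : Set (Fin n))ᶜ) := by simp [hN]
  obtain ⟨j, hj⟩ : ∃ j, j ∉ insert i N := by
    by_contra hcon
    push Not at hcon
    have h1 : (insert i N).card = n := by
      rw [Finset.eq_univ_of_forall hcon]; simp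
    have h2 := Finset.card_insert_le i N
    have h3 : k < n := by simpa using hH.1
    omega
  simp only [Finset.mem_insert, not_or] at hj
  have hj' : j ∈ ((N : Set (Fin n))ᶜ) := by simpa using hj.2
  obtain ⟨w⟩ := hconn.preconnected ⟨i, hi⟩ ⟨j, hj'⟩
  cases w with
  | nil => exact hj.1 rfl
  | @cons _ v _ hadj _ =>
    have h1 : H.Adj i v := by
      have := (SimpleGraph.induce_adj.1 hadj)
      rw [SimpleGraph.deleteEdges_adj] at this
      exact this.1
    exact v.2 (by simpa [hN] using h1)

/-- The smaller of two components after the deletion has few outside neighbours: each of them is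
either a deleted node or the end of a deleted link. -/
lemma exists_small_boundary {H : SimpleGraph (Fin n)} (hk : k < n) (hH : ¬ IsKConnected H k)
    [∀ i, DecidablePred (H.Adj i)] :
    ∃ A : Finset (Fin n), A.Nonempty ∧ 2 * A.card ≤ n ∧
      (Aᶜ.filter fun v => ∃ i ∈ A, H.Adj i v).card < k := by
  classical
  have h1 : ¬ ∀ (S : Finset (Fin n)) (F : Finset (Sym2 (Fin n))), S.card + F.card < k →
      ((H.deleteEdges (F : Set (Sym2 (Fin n)))).induce ((S : Set (Fin n))ᶜ)).Connected :=
    fun h => hH ⟨by simpa using hk, h⟩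
  push Not at h1
  obtain ⟨S, F, hSF, hnc⟩ := h1
  set H' := (H.deleteEdges (F : Set (Sym2 (Fin n)))).induce ((S : Set (Fin n))ᶜ) with hH'
  have hne : Nonempty (((S : Set (Fin n))ᶜ : Set (Fin n))) := by
    by_contra hcon
    rw [nonempty_subtype] at hcon
    push Not at hcon
    have : S = Finset.univ := Finset.eq_univ_of_forall fun i => by simpa using hcon i
    rw [this] at hSF
    simp at hSF
    omega
  have hpre : ¬ H'.Preconnected := fun h => hnc ⟨h⟩
  unfold SimpleGraph.Preconnected at hpre
  push Not at hpre
  obtain ⟨u, w, huw⟩ := hpre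
  have comp : ∀ u : (((S : Set (Fin n))ᶜ : Set (Fin n))),
      ((Finset.univ.filter fun x : Fin n => ∃ hx : x ∈ ((S : Set (Fin n))ᶜ), H'.Reachable u ⟨x, hx⟩)ᶜ.filter
        fun v => ∃ i ∈ Finset.univ.filter fun x : Fin n =>
          ∃ hx : x ∈ ((S : Set (Fin n))ᶜ), H'.Reachable u ⟨x, hx⟩, H.Adj i v).card < k := by
    intro u
    set A := Finset.univ.filter fun x : Fin n => ∃ hx : x ∈ ((S : Set (Fin n))ᶜ), H'.Reachable u ⟨x, hx⟩
      with hA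
    have hmemA : ∀ x, x ∈ A ↔ ∃ hx : x ∈ ((S : Set (Fin n))ᶜ), H'.Reachable u ⟨x, hx⟩ := by
      intro x; simp [hA]
    set D := Aᶜ.filter fun v => ∃ i ∈ A, H.Adj i v with hD
    have hF : ∀ v ∈ D \ S, ∃ i ∈ A, s(i, v) ∈ F := by
      intro v hv
      obtain ⟨hvD, hvS⟩ := Finset.mem_sdiff.1 hv
      obtain ⟨hvA, i, hi, hadj⟩ := Finset.mem_filter.1 hvD
      refine ⟨i, hi, ?_⟩
      by_contra hiF
      refine (Finset.mem_compl.1 hvA) ((hmemA v).2 ⟨by simpa using hvS, ?_⟩)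
      obtain ⟨hiS, hr⟩ := (hmemA i).1 hi
      refine hr.trans (SimpleGraph.Adj.reachable ?_)
      rw [hH', SimpleGraph.induce_adj, SimpleGraph.deleteEdges_adj]
      exact ⟨hadj, by simpa using hiF⟩
    choose! o ho using hF
    have hcard : (D \ S).card ≤ F.card := by
      refine Finset.card_le_card_of_injOn (fun v => s(o v, v)) (fun v hv => (ho v hv).2) ?_
      intro v hv v' hv' he
      have hvA : v ∉ A := Finset.mem_compl.1 (Finset.mem_filter.1 (Finset.mem_sdiff.1 hv).1).1
      rcases Sym2.eq_iff.1 he with ⟨-, h⟩ | ⟨-, h⟩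
      · exact h
      · exact absurd (h ▸ (ho v' hv').1) hvA
    have := Finset.le_card_sdiff S D
    omega
  have hself : ∀ u : (((S : Set (Fin n))ᶜ : Set (Fin n))), (Finset.univ.filter fun x : Fin n =>
      ∃ hx : x ∈ ((S : Set (Fin n))ᶜ), H'.Reachable u ⟨x, hx⟩).Nonempty := fun u =>
    ⟨u, Finset.mem_filter.2 ⟨Finset.mem_univ _, u.2, SimpleGraph.Reachable.refl _⟩⟩
  have hdisj : Disjoint
      (Finset.univ.filter fun x : Fin n => ∃ hx : x ∈ ((S : Set (Fin n))ᶜ), H'.Reachable u ⟨x, hx⟩)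
      (Finset.univ.filter fun x : Fin n => ∃ hx : x ∈ ((S : Set (Fin n))ᶜ), H'.Reachable w ⟨x, hx⟩) := by
    rw [Finset.disjoint_left]
    intro x hx hx'
    obtain ⟨h1, h2⟩ := (Finset.mem_filter.1 hx).2
    obtain ⟨h3, h4⟩ := (Finset.mem_filter.1 hx').2
    exact huw (h2.trans h4.symm)
  have hsum := Finset.card_union_of_disjoint hdisj
  have hle := Finset.card_le_univ (Finset.filter
    (fun x : Fin n => ∃ hx : x ∈ ((S : Set (Fin n))ᶜ), H'.Reachable u ⟨x, hx⟩) Finset.univ ∪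
    Finset.univ.filter fun x : Fin n => ∃ hx : x ∈ ((S : Set (Fin n))ᶜ), H'.Reachable w ⟨x, hx⟩)
  rw [hsum, Fintype.card_fin] at hle
  rcases le_total (Finset.univ.filter fun x : Fin n =>
      ∃ hx : x ∈ ((S : Set (Fin n))ᶜ), H'.Reachable u ⟨x, hx⟩).card
    (Finset.univ.filter fun x : Fin n =>
      ∃ hx : x ∈ ((S : Set (Fin n))ᶜ), H'.Reachable w ⟨x, hx⟩).card with hc | hc
  · exact ⟨_, hself u, by omega, comp u⟩
  · exact ⟨_, hself w, by omega, comp w⟩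

end Graph

section Network
variable {n P K k : ℕ} {p : ℝ} {S : Fin n → Finset (Fin P)} {G : SimpleGraph (Fin n)}

lemma le_card_nbrs_of_isKConnected (h : IsKConnected (keyGraph S ⊓ G) k) (i : Fin n) :
    k ≤ (nbrs S G i).card := by
  classical
  have := h.le_degree i
  convert this using 2
  ext j
  simp [mem_nbrs]

lemma exists_boundary_card_lt (hk : k < n) (h : ¬ IsKConnected (keyGraph S ⊓ G) k) :
    ∃ A : Finset (Fin n), A.Nonempty ∧ 2 * A.card ≤ n ∧ (boundary A S G).card < k := by
  classical
  obtain ⟨A, h1, h2, h3⟩ := exists_small_boundary hk h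
  refine ⟨A, h1, h2, lt_of_le_of_lt (Finset.card_le_card fun v hv => ?_) h3⟩
  obtain ⟨hvA, i, hi⟩ := Finset.mem_filter.1 hv
  exact Finset.mem_filter.2 ⟨hvA, i, mem_nbrsIn.1 hi⟩

/-- If every node has at least `k` neighbours, then a set with fewer than `k` outside neighbours
contains a link, and therefore two nodes with a common key. -/
lemma excess_ne_zero_of_boundary (hS : ∀ i, (S i).card = K) (hd : ∀ i, k ≤ (nbrs S G i).card)
    {A : Finset (Fin n)} (hA : A.Nonempty) (hb : (boundary A S G).card < k) :
    excess K A S ≠ 0 := by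
  intro h0
  obtain ⟨i, hi⟩ := hA
  have := hd i
  rw [nbrs_eq_of_excess_eq_zero hS h0 G hi] at this
  have h2 : (Aᶜ.filter fun v => i ∈ nbrsIn A S G v).card ≤ (boundary A S G).card :=
    Finset.card_le_card fun v hv =>
      Finset.mem_filter.2 ⟨(Finset.mem_filter.1 hv).1, i, (Finset.mem_filter.1 hv).2⟩
  omega

lemma boundary_singleton_card_le (i : Fin n) :
    (boundary {i} S G).card ≤ (nbrs S G i).card := by
  simpa using Finset.card_le_card (boundary_subset_biUnion_nbrs {i} S G)

/-! ### The probability as a finite expectation -/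

lemma uniformOn_real_singleton (W : Finset (Fin P)) :
    (uniformOn {s : Finset (Fin P) | s.card = K}).real {W} = ringWeight K W := by
  classical
  have e : {s : Finset (Fin P) | s.card = K} = (((Finset.univ : Finset (Fin P)).powersetCard K :
      Finset (Finset (Fin P))) : Set (Finset (Fin P))) := by
    ext s; simp [Finset.mem_powersetCard]
  have e2 : ({W} : Set (Finset (Fin P))) = (({W} : Finset (Finset (Fin P))) : Set _) := by simp
  rw [Measure.real, e, e2, uniformOn_apply_finset, ENNReal.toReal_div]
  simp only [ringWeight, ENNReal.toReal_natCast, Finset.card_powersetCard, Finset.card_univ,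
    Fintype.card_fin]
  split_ifs with hW
  · rw [Finset.inter_singleton_of_mem (by simp [Finset.mem_powersetCard, hW])]
    simp
  · rw [Finset.inter_singleton_of_notMem (by simp [Finset.mem_powersetCard, hW])]
    simp

lemma binomialRandom_real_singleton (p : unitInterval) (G : SimpleGraph (Fin n)) :
    (SimpleGraph.binomialRandom (Fin n) p).real {G} = chanWeight (p : ℝ) G := by
  classical
  have hc : (channels n).card = n.choose 2 := by
    have := Sym2.card_subtype_not_diag (α := Fin n)
    rw [Fintype.card_subtype, Fintype.card_fin] at this
    exact this
  have hsub : (channels n).filter (· ∈ G.edgeSet) = G.edgeSet.toFinset := by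
    ext e
    simp only [Finset.mem_filter, Set.mem_toFinset, channels, Finset.mem_univ, true_and]
    exact ⟨fun h => h.2, fun h => ⟨G.not_isDiag_of_mem_edgeSet h, h⟩⟩
  have hcard : ((channels n).filter (· ∈ G.edgeSet)).card = G.edgeSet.ncard := by
    rw [hsub, Set.ncard_eq_toFinset_card']
  have hcard' : ((channels n).filter (· ∉ G.edgeSet)).card = n.choose 2 - G.edgeSet.ncard := by
    have := Finset.card_filter_add_card_filter_not (s := channels n) (· ∈ G.edgeSet)
    omega
  rw [Measure.real, SimpleGraph.binomialRandom_singleton]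
  unfold chanWeight
  rw [Finset.prod_ite, Finset.prod_const, Finset.prod_const, hcard, hcard']
  simp

instance : MeasurableSingletonClass (SimpleGraph (Fin n)) where
  measurableSet_singleton G := by
    rw [← SimpleGraph.measurableEmbedding_edgeSet.measurableSet_image, Set.image_singleton]
    exact measurableSet_singleton _

open Classical in
/-- Probabilities in the model are finite weighted sums. -/
lemma networkMeasure_real (h : K ≤ P) (p : unitInterval)
    (E : Set ((Fin n → Finset (Fin P)) × SimpleGraph (Fin n))) :
    (networkMeasure n K P p).real E =
      netMean K (p : ℝ) fun S G => if (S, G) ∈ E then 1 else 0 := by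
  have : IsProbabilityMeasure (uniformOn {s : Finset (Fin P) | s.card = K}) := by
    refine isProbabilityMeasure_uniformOn (Set.toFinite _) ?_
    obtain ⟨s, -, hs⟩ := Finset.exists_subset_card_eq (s := (Finset.univ : Finset (Fin P)))
      (n := K) (by simpa using h)
    exact ⟨s, hs⟩
  have : IsFiniteMeasure (networkMeasure n K P p) := by unfold networkMeasure; infer_instance
  have hsing : ∀ x : (Fin n → Finset (Fin P)) × SimpleGraph (Fin n),
      (networkMeasure n K P p).real {x} = keyWeight K x.1 * chanWeight (p : ℝ) x.2 := by
    rintro ⟨S, G⟩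
    rw [← Set.singleton_prod_singleton, networkMeasure, measureReal_prod_prod,
      binomialRandom_real_singleton]
    congr 1
    rw [Measure.real, Measure.pi_singleton, ENNReal.toReal_prod]
    exact Finset.prod_congr rfl fun i _ => uniformOn_real_singleton (S i)
  rw [← Set.coe_toFinset E, ← sum_measureReal_singleton, Finset.sum_congr rfl fun x _ => hsing x]
  unfold netMean keyMean chanMean
  simp only [Finset.mul_sum, ← Fintype.sum_prod_type', Set.coe_toFinset]
  rw [← Finset.sum_subset (Finset.subset_univ E.toFinset)]
  · refine Finset.sum_congr rfl fun x hx => ?_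
    rw [Set.mem_toFinset] at hx
    simp [hx]
  · intro x _ hx
    rw [Set.mem_toFinset] at hx
    simp [hx]

/-! ### Bonferroni inequalities -/

/-- The expected number of `r`-element sets of nodes of degree `d`, that is, the `r`-th factorial
moment of the number of these nodes divided by `r!`. -/
noncomputable def degreeMoment (n P K : ℕ) (p : ℝ) (d r : ℕ) : ℝ :=
  ∑ A ∈ (Finset.univ : Finset (Fin n)).powersetCard r,
    netMean K p fun (S : Fin n → Finset (Fin P)) G =>
      if ∀ i ∈ A, (nbrs S G i).card = d then 1 else 0

lemma sum_powersetCard_indicator (d r : ℕ) (S : Fin n → Finset (Fin P))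
    (G : SimpleGraph (Fin n)) : (∑ A ∈ (Finset.univ : Finset (Fin n)).powersetCard r,
      if ∀ i ∈ A, (nbrs S G i).card = d then (1 : ℝ) else 0) =
      (((Finset.univ.filter fun i => (nbrs S G i).card = d).card.choose r : ℕ) : ℝ) := by
  rw [← Finset.sum_filter, Finset.sum_const, nsmul_eq_mul, mul_one, ← Finset.card_powersetCard]
  congr 2
  ext A
  simp only [Finset.mem_filter, Finset.mem_powersetCard, Finset.subset_univ, true_and]
  rw [and_comm]
  refine and_congr_left fun _ => ?_
  constructor
  · exact fun h i hi => Finset.mem_filter.2 ⟨Finset.mem_univ _, h i hi⟩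
  · exact fun h i hi => (Finset.mem_filter.1 (h hi)).2

lemma sum_neg_one_pow_mul_degreeMoment (d J : ℕ) :
    ∑ r ∈ Finset.range (J + 1), (-1) ^ r * degreeMoment n P K p d r =
      netMean K p fun (S : Fin n → Finset (Fin P)) G => ∑ r ∈ Finset.range (J + 1), (-1) ^ r *
        (((Finset.univ.filter fun i => (nbrs S G i).card = d).card.choose r : ℕ) : ℝ) := by
  rw [netMean_sum]
  refine Finset.sum_congr rfl fun r _ => ?_
  rw [netMean_const_mul, degreeMoment, ← netMean_sum]
  simp only [sum_powersetCard_indicator]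

/-- A truncated alternating sum of binomial coefficients has the sign of its last term. -/
lemma alternating_sum_choose (x J : ℕ) :
    (∑ r ∈ Finset.range (J + 1), (-1) ^ r * ((x.choose r : ℕ) : ℝ)) =
      if x = 0 then 1 else (-1) ^ J * (((x - 1).choose J : ℕ) : ℝ) := by
  cases x with
  | zero =>
    rw [if_pos rfl, Finset.sum_eq_single 0]
    · simp
    · intro r _ hr
      rw [Nat.choose_eq_zero_of_lt (Nat.pos_of_ne_zero hr)]; simp
    · simp
  | succ x =>
    have := Int.alternating_sum_range_choose_eq_choose (n := x) (m := J)
    rw [if_neg (Nat.succ_ne_zero x), Nat.add_sub_cancel]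
    exact_mod_cast this

/-- Bonferroni's inequalities for the probability that no node has degree `d`. -/
lemma bonferroni (h0 : 0 ≤ p) (h1 : p ≤ 1) (d J : ℕ) :
    (Even J → (netMean K p fun (S : Fin n → Finset (Fin P)) G =>
        if ∀ i, (nbrs S G i).card ≠ d then 1 else 0) ≤
      ∑ r ∈ Finset.range (J + 1), (-1) ^ r * degreeMoment n P K p d r) ∧
    (Odd J → ∑ r ∈ Finset.range (J + 1), (-1) ^ r * degreeMoment n P K p d r ≤
      netMean K p fun (S : Fin n → Finset (Fin P)) G =>
        if ∀ i, (nbrs S G i).card ≠ d then 1 else 0) := by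
  rw [sum_neg_one_pow_mul_degreeMoment]
  simp only [alternating_sum_choose, Finset.card_eq_zero, Finset.filter_eq_empty_iff,
    Finset.mem_univ, true_implies]
  constructor
  · refine fun hJ => netMean_mono h0 h1 fun S G _ => ?_
    simp only [hJ.neg_one_pow, one_mul]
    split_ifs
    · exact le_rfl
    · positivity
  · refine fun hJ => netMean_mono h0 h1 fun S G _ => ?_
    simp only [hJ.neg_one_pow]
    split_ifs
    · exact le_rfl
    · have : (0 : ℝ) ≤ (((Finset.univ.filter fun i => (nbrs S G i).card = d).card - 1).choose J : ℕ) := by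
        positivity
      linarith

end Network

/-! ### Bounds for a fixed number of nodes -/

/-- The approximate mean degree `n * p * K ^ 2 / P` of a node. -/
noncomputable def load (n K P : ℕ) (p : ℝ) : ℝ := n * (p * ((K : ℝ) ^ 2 / P))

section Bounds
variable {n P K : ℕ} {p : ℝ}

lemma load_nonneg (h0 : 0 ≤ p) : 0 ≤ load n K P p := by unfold load; positivity

lemma sub_sq_le_one_sub_exp {σ : ℝ} (h0 : 0 ≤ σ) (h1 : σ ≤ 1) :
    σ - σ ^ 2 ≤ 1 - Real.exp (-σ) := by
  have := Real.abs_exp_sub_one_sub_id_le (x := -σ) (by rwa [abs_neg, abs_of_nonneg h0])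
  have := (abs_le.1 this).2
  nlinarith

lemma one_sub_exp_le (σ : ℝ) : 1 - Real.exp (-σ) ≤ σ := by
  have := Real.add_one_le_exp (-σ)
  linarith

/-- The probability that `n - A.card - J` outside nodes have no neighbour in `A`. The first factor is
`exp (-A.card * load)` up to an error that tends to zero; every key lost to overlaps costs a factor
of at most `exp (load / K)`. -/
lemma missProb_pow_le (h : K ≤ P) (hK : 0 < K) (h0 : 0 ≤ p) (h1 : p ≤ 1)
    (hσ : (K : ℝ) ^ 2 / P ≤ 1) {A : Finset (Fin n)} {S : Fin n → Finset (Fin P)}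
    (hS : ∀ i, (S i).card = K) (J : ℕ) :
    missProb K p A S ^ (n - A.card - J) ≤
      Real.exp (-(A.card * load n K P p) + A.card * ((A.card + J) * (p * ((K : ℝ) ^ 2 / P)) +
        load n K P p * ((K : ℝ) ^ 2 / P))) * Real.exp (load n K P p / K) ^ excess K A S := by
  have hK' : (0 : ℝ) < K := by exact_mod_cast hK
  set σ := (K : ℝ) ^ 2 / P with hσdef
  have hσ0 : 0 ≤ σ := by positivity
  set s := 1 - Real.exp (-σ) with hs
  have hs1 : σ - σ ^ 2 ≤ s := sub_sq_le_one_sub_exp hσ0 hσ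
  have hs2 : s ≤ σ := one_sub_exp_le σ
  have hs0 : 0 ≤ s := by nlinarith
  set N := n - A.card - J with hN
  have hN1 : (N : ℝ) ≤ n := by exact_mod_cast (by omega : N ≤ n)
  have hN2 : (n : ℝ) - A.card - J ≤ N := by
    have : n ≤ N + A.card + J := by omega
    have : (n : ℝ) ≤ N + A.card + J := by exact_mod_cast this
    linarith
  refine (pow_le_pow_left₀ (missProb_nonneg h0 h1 A S) (missProb_le_exp h hK h0 h1 hS) N).trans ?_
  rw [← Real.exp_nat_mul, ← Real.exp_nat_mul, ← Real.exp_add]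
  refine Real.exp_le_exp.2 ?_
  have e1 : (N : ℝ) * -(p * s * (A.card - (excess K A S : ℝ) / K)) =
      -(A.card * (p * (N * s))) + excess K A S * ((N * (p * s)) / K) := by ring
  rw [e1]
  have hq : 0 ≤ p * σ := by positivity
  have ha : (N : ℝ) * (p * s) ≤ load n K P p := by
    unfold load
    exact mul_le_mul hN1 (mul_le_mul_of_nonneg_left hs2 h0) (by positivity) (by positivity)
  have hb : load n K P p - ((A.card + J) * (p * σ) + load n K P p * σ) ≤ p * (N * s) := by
    have t1 : (N : ℝ) * (σ - σ ^ 2) ≤ N * s := by gcongr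
    have t2 : ((n : ℝ) - A.card - J) * (p * σ) ≤ N * (p * σ) := by gcongr
    have t3 : (N : ℝ) * (p * σ) * σ ≤ n * (p * σ) * σ := by gcongr
    have t4 := mul_le_mul_of_nonneg_left t1 h0
    have t5 : load n K P p = n * (p * σ) := rfl
    rw [t5]
    nlinarith
  have hc : (0 : ℝ) ≤ A.card := by positivity
  have hd : (excess K A S : ℝ) * ((N * (p * s)) / K) ≤ excess K A S * (load n K P p / K) := by
    gcongr
  have := mul_le_mul_of_nonneg_left hb hc
  linarith

/-- The probability that `A` has at most `J` outside neighbours is small; overlapping key rings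
increase it by an amount that exponential moments of the overlap control. -/
lemma netMean_boundary_card_le_exp (h : K ≤ P) (hK : 0 < K) (h0 : 0 ≤ p) (h1 : p ≤ 1)
    (hσ : (K : ℝ) ^ 2 / P ≤ 1) (A : Finset (Fin n)) (J : ℕ)
    (χ : (Fin n → Finset (Fin P)) → ℝ) (hχ : ∀ S S', (∀ i ∈ A, S i = S' i) → χ S = χ S')
    (hχ0 : ∀ S, 0 ≤ χ S) :
    netMean K p (fun S G => χ S * if (boundary A S G).card ≤ J then 1 else 0) ≤
      (1 + A.card * load n K P p) ^ J *
        Real.exp (-(A.card * load n K P p) + A.card * ((A.card + J) * (p * ((K : ℝ) ^ 2 / P)) +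
          load n K P p * ((K : ℝ) ^ 2 / P))) *
        keyMean K fun S => χ S * Real.exp (load n K P p / K) ^ excess K A S := by
  have hl := load_nonneg (n := n) (K := K) (P := P) h0
  refine (netMean_boundary_card_le h h0 h1 A J χ hχ hχ0).trans ?_
  rw [mul_assoc]
  refine mul_le_mul_of_nonneg_left ?_ (by positivity)
  rw [← keyMean_const_mul]
  refine keyMean_mono fun S hS => ?_
  calc χ S * missProb K p A S ^ (n - A.card - J) ≤ χ S * _ :=
        mul_le_mul_of_nonneg_left (missProb_pow_le h hK h0 h1 hσ hS J) (hχ0 S)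
    _ = _ := by ring

lemma keyMean_excess_ne_zero_le (h : K ≤ P) (A : Finset (Fin n)) :
    keyMean K (fun S : Fin n → Finset (Fin P) => if excess K A S = 0 then (0 : ℝ) else 1) ≤
      Real.exp (A.card ^ 2 * ((K : ℝ) ^ 2 / P)) - 1 := by
  have h2 := keyMean_pow_excess_le (n := n) h A (z := 2) (by norm_num)
  rw [show ((2 : ℝ) - 1) = 1 by norm_num, one_mul] at h2
  have h3 : keyMean K (fun S : Fin n → Finset (Fin P) =>
      1 + if excess K A S = 0 then (0 : ℝ) else 1) ≤
      keyMean K (fun S : Fin n → Finset (Fin P) => (2 : ℝ) ^ excess K A S) := by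
    refine keyMean_mono fun S _ => ?_
    split_ifs with hz
    · simp [hz]
    · calc (1 : ℝ) + 1 = 2 ^ 1 := by norm_num
        _ ≤ _ := pow_le_pow_right₀ (by norm_num) (Nat.one_le_iff_ne_zero.2 hz)
  rw [keyMean_add, keyMean_const h] at h3
  linarith

lemma le_keyMean_excess_eq_zero (h : K ≤ P) (A : Finset (Fin n)) :
    2 - Real.exp (A.card ^ 2 * ((K : ℝ) ^ 2 / P)) ≤
      keyMean K (fun S : Fin n → Finset (Fin P) => if excess K A S = 0 then (1 : ℝ) else 0) := by
  have h1 := keyMean_excess_ne_zero_le (n := n) h A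
  have h2 : (fun S : Fin n → Finset (Fin P) => if excess K A S = 0 then (1 : ℝ) else 0) =
      fun S => 1 - if excess K A S = 0 then (0 : ℝ) else 1 := by
    funext S; split_ifs <;> norm_num
  rw [h2, keyMean_sub, keyMean_const h]
  linarith

/-- The exponential moment of the overlap, restricted to overlapping key rings. -/
lemma keyMean_excess_ne_zero_mul_pow_le (h : K ≤ P) (A : Finset (Fin n)) {z : ℝ} (hz : 1 ≤ z) :
    keyMean K (fun S : Fin n → Finset (Fin P) =>
      (if excess K A S = 0 then (0 : ℝ) else 1) * z ^ excess K A S) ≤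
      Real.exp ((z - 1) * (A.card ^ 2 * ((K : ℝ) ^ 2 / P))) +
        Real.exp (A.card ^ 2 * ((K : ℝ) ^ 2 / P)) - 2 := by
  have e : (fun S : Fin n → Finset (Fin P) =>
      (if excess K A S = 0 then (0 : ℝ) else 1) * z ^ excess K A S) =
      fun S => z ^ excess K A S - if excess K A S = 0 then (1 : ℝ) else 0 := by
    funext S; split_ifs with h <;> simp [h]
  rw [e, keyMean_sub]
  linarith [keyMean_pow_excess_le (n := n) h A hz, le_keyMean_excess_eq_zero (n := n) h A]

/-- The factor `load ^ d / d!` counts the choices of the neighbours of each node of `A`. -/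
lemma netMean_separated_le (h : K ≤ P) (hK : 0 < K) (h0 : 0 ≤ p) (h1 : p ≤ 1)
    (hσ : (K : ℝ) ^ 2 / P ≤ 1) (d : ℕ) (A : Finset (Fin n)) :
    netMean K p (fun (S : Fin n → Finset (Fin P)) G =>
        (if excess K A S = 0 then 1 else 0) * separated d A S G) ≤
      (load n K P p ^ d / (d ! : ℝ)) ^ A.card * Real.exp (-(A.card * load n K P p) +
        A.card * ((A.card + (A.card * d : ℕ)) * (p * ((K : ℝ) ^ 2 / P)) +
          load n K P p * ((K : ℝ) ^ 2 / P))) := by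
  rw [netMean_separated h]
  refine (keyMean_mono (F' := fun _ => _) fun S hS => ?_).trans_eq (keyMean_const h _)
  set E := Real.exp (-(A.card * load n K P p) +
        A.card * ((A.card + (A.card * d : ℕ)) * (p * ((K : ℝ) ^ 2 / P)) +
          load n K P p * ((K : ℝ) ^ 2 / P))) with hE
  have hl := load_nonneg (n := n) (K := K) (P := P) h0
  by_cases hA : excess K A S = 0
  · rw [if_pos hA, one_mul]
    have hm := missProb_pow_le h hK h0 h1 hσ hS (A := A) (A.card * d)
    rw [hA, pow_zero, mul_one, ← hE] at hm
    have hq : 0 ≤ p * ((K : ℝ) ^ 2 / P) := by positivity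
    have ht0 : ∀ i, 0 ≤ typeMean K p A S (fun B => if B = {i} then 1 else 0) := fun i => by
      have := typeMean_mono (K := K) (S := S) h0 h1 (A := A) (ψ := fun _ => 0)
        (ψ' := fun B => if B = {i} then 1 else 0) fun B _ => by split_ifs <;> norm_num
      rwa [typeMean_const h] at this
    have hprod : ∏ i ∈ A, typeMean K p A S (fun B => if B = {i} then 1 else 0) ^ d ≤
        ((p * ((K : ℝ) ^ 2 / P)) ^ d) ^ A.card := by
      rw [← Finset.prod_const]
      exact Finset.prod_le_prod (fun i _ => pow_nonneg (ht0 i) _) fun i hi =>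
        pow_le_pow_left₀ (ht0 i) (typeMean_singleton_le h h0 h1 hi (hS i)) _
    have hcard : ((disjFamilies d A Aᶜ).card : ℝ) ≤ ((n : ℝ) ^ d / (d ! : ℝ)) ^ A.card := by
      calc ((disjFamilies d A Aᶜ).card : ℝ) ≤ ((Aᶜ.card.choose d : ℕ) : ℝ) ^ A.card := by
            exact_mod_cast card_disjFamilies_le d A Aᶜ
        _ ≤ _ := by
            refine pow_le_pow_left₀ (by positivity) ?_ _
            refine le_trans ?_ (Nat.choose_le_pow_div d n)
            have : Aᶜ.card ≤ n := by simpa using Finset.card_le_univ Aᶜ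
            exact_mod_cast Nat.choose_le_choose d this
    calc ((disjFamilies d A Aᶜ).card : ℝ) * (missProb K p A S ^ (n - A.card - A.card * d) *
          ∏ i ∈ A, typeMean K p A S (fun B => if B = {i} then 1 else 0) ^ d)
        ≤ ((n : ℝ) ^ d / (d ! : ℝ)) ^ A.card * (E * ((p * ((K : ℝ) ^ 2 / P)) ^ d) ^ A.card) := by
          have hp0 : 0 ≤ ∏ i ∈ A, typeMean K p A S (fun B => if B = {i} then 1 else 0) ^ d :=
            Finset.prod_nonneg fun i _ => pow_nonneg (ht0 i) _
          have hm0 := missProb_nonneg (K := K) h0 h1 A S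
          have hE0 : 0 ≤ E := (Real.exp_pos _).le
          exact mul_le_mul hcard (mul_le_mul hm hprod hp0 hE0) (mul_nonneg (pow_nonneg hm0 _) hp0)
            (by positivity)
      _ = _ := by
          clear_value E
          have e : load n K P p ^ d / (d ! : ℝ) =
              (n : ℝ) ^ d / (d ! : ℝ) * (p * ((K : ℝ) ^ 2 / P)) ^ d := by
            unfold load
            rw [mul_pow]
            ring
          rw [e, mul_pow _ _ A.card]
          ring
  · rw [if_neg hA, zero_mul]
    positivity

lemma le_netMean_separated (h : K ≤ P) (h0 : 0 ≤ p) (h1 : p ≤ 1)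
    (hσ : (K : ℝ) ^ 2 / P ≤ 1) (d : ℕ) (A : Finset (Fin n))
    (hσA : (A.card + 1) * ((K : ℝ) ^ 2 / P) ≤ 1) (hqA : A.card * (p * ((K : ℝ) ^ 2 / P)) ≤ 1) :
    (2 - Real.exp (A.card ^ 2 * ((K : ℝ) ^ 2 / P))) *
      ((((n - A.card - A.card * d).choose d : ℕ) : ℝ) ^ A.card *
        ((1 - A.card * (p * ((K : ℝ) ^ 2 / P))) ^ n *
          ((p * ((K : ℝ) ^ 2 / P) * (1 - (A.card + 1) * ((K : ℝ) ^ 2 / P))) ^ d) ^ A.card)) ≤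
    netMean K p (fun (S : Fin n → Finset (Fin P)) G =>
        (if excess K A S = 0 then 1 else 0) * separated d A S G) := by
  rw [netMean_separated h]
  set σ := (K : ℝ) ^ 2 / P with hσdef
  have hσ0 : 0 ≤ σ := by positivity
  set X := (((n - A.card - A.card * d).choose d : ℕ) : ℝ) ^ A.card *
        ((1 - A.card * (p * σ)) ^ n * ((p * σ * (1 - (A.card + 1) * σ)) ^ d) ^ A.card) with hX
  have hq : 0 ≤ p * σ := by positivity
  have hX0 : 0 ≤ X := by
    have a1 : 0 ≤ 1 - A.card * (p * σ) := by linarith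
    have a2 : 0 ≤ 1 - (A.card + 1) * σ := by linarith
    positivity
  calc (2 - Real.exp (A.card ^ 2 * σ)) * X
      ≤ keyMean K (fun S : Fin n → Finset (Fin P) =>
          if excess K A S = 0 then (1 : ℝ) else 0) * X :=
        mul_le_mul_of_nonneg_right (le_keyMean_excess_eq_zero h A) hX0
    _ = keyMean K (fun S : Fin n → Finset (Fin P) =>
          (if excess K A S = 0 then (1 : ℝ) else 0) * X) := by
        rw [mul_comm, ← keyMean_const_mul]
        simp only [mul_comm X]
    _ ≤ _ := by
        refine keyMean_mono fun S hS => ?_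
        by_cases hA : excess K A S = 0
        · rw [if_pos hA, one_mul, one_mul, hX]
          have hf := one_sub_missProb_le h h0 h1 (A := A) hS
          have hf1 := missProb_le_one h h0 h1 A S
          have hf0 := missProb_nonneg (K := K) h0 h1 A S
          have ht : ∀ i ∈ A, p * σ * (1 - (A.card + 1) * σ) ≤
              typeMean K p A S (fun B => if B = {i} then 1 else 0) := by
            intro i hi
            refine le_trans ?_ (le_typeMean_singleton h h0 h1 hS hA hi)
            have := sub_sq_le_one_sub_exp hσ0 hσ
            have := mul_le_mul_of_nonneg_left this h0
            nlinarith
          have ht0 : 0 ≤ p * σ * (1 - (A.card + 1) * σ) := mul_nonneg hq (by linarith)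
          have hprod : ((p * σ * (1 - (A.card + 1) * σ)) ^ d) ^ A.card ≤
              ∏ i ∈ A, typeMean K p A S (fun B => if B = {i} then 1 else 0) ^ d := by
            rw [← Finset.prod_const]
            exact Finset.prod_le_prod (fun i _ => pow_nonneg ht0 _) fun i hi =>
              pow_le_pow_left₀ ht0 (ht i hi) _
          have hcard : (((n - A.card - A.card * d).choose d : ℕ) : ℝ) ^ A.card ≤
              ((disjFamilies d A Aᶜ).card : ℝ) := by
            have := le_card_disjFamilies d A Aᶜ
            rw [Finset.card_compl, Fintype.card_fin] at this
            exact_mod_cast this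
          have hmiss : (1 - A.card * (p * σ)) ^ n ≤
              missProb K p A S ^ (n - A.card - A.card * d) :=
            (pow_le_pow_left₀ (by linarith) (by linarith) n).trans
              (pow_le_pow_of_le_one hf0 hf1 (by omega))
          have a1 : 0 ≤ 1 - A.card * (p * σ) := by linarith
          gcongr
        · rw [if_neg hA, zero_mul, zero_mul]

/-! #### Large sets of nodes -/

/-- Every set of at most `b₀` nodes in `A` loses at most the fraction `ε` of its keys to overlaps. -/
def SmallOverlap (K b₀ : ℕ) (ε : ℝ) (A : Finset (Fin n)) (S : Fin n → Finset (Fin P)) : Prop :=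
  ∀ B ⊆ A, B.card ≤ b₀ → (excess K B S : ℝ) ≤ ε * (B.card * K)

lemma smallOverlap_congr {b₀ : ℕ} {ε : ℝ} {A : Finset (Fin n)} {S S' : Fin n → Finset (Fin P)}
    (h : ∀ i ∈ A, S i = S' i) : SmallOverlap K b₀ ε A S ↔ SmallOverlap K b₀ ε A S' := by
  unfold SmallOverlap
  refine forall_congr' fun B => forall_congr' fun hB => ?_
  rw [excess_congr fun i hi => h i (hB hi)]

/-- The first term is the contribution of the outside nodes with at most `b₀` channels to `A` that are
on, whose keys barely overlap. If there are more such channels, then `b₀` of them suffice for the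
second term. -/
lemma missProb_le_of_smallOverlap (h : K ≤ P) (h0 : 0 ≤ p) (h1 : p ≤ 1) {b₀ : ℕ} {ε : ℝ}
    (hε : ε ≤ 1 / 4) (hε0 : 0 < ε) (hσε : (K : ℝ) ^ 2 / P ≤ ε) {A : Finset (Fin n)}
    {S : Fin n → Finset (Fin P)} (hS : ∀ i, (S i).card = K) (hA : SmallOverlap K b₀ ε A S) :
    missProb K p A S ≤ Real.exp (-((1 - 2 * ε) * (p * ((K : ℝ) ^ 2 / P)) * A.card)) +
      if b₀ < A.card then Real.exp (-((1 - ε) * (b₀ * ((K : ℝ) ^ 2 / P)))) else 0 := by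
  set σ := (K : ℝ) ^ 2 / P with hσdef
  have hσ0 : 0 ≤ σ := by positivity
  have hsmall : ∀ C ⊆ A, C.card ≤ b₀ → (1 - ε) * (C.card * σ) ≤ (C.biUnion S).card * (K / P : ℝ) := by
    intro C hC hCb
    have h1 := hA C hC hCb
    have h2 : (excess K C S : ℝ) + (C.biUnion S).card = C.card * K := by
      exact_mod_cast excess_add hS C
    have h3 : (1 - ε) * (C.card * K) ≤ (C.biUnion S).card := by linarith
    have h4 : (0 : ℝ) ≤ K / P := by positivity
    calc (1 - ε) * (C.card * σ) = (1 - ε) * (C.card * K) * (K / P) := by rw [hσdef]; ring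
      _ ≤ _ := by gcongr
  calc missProb K p A S ≤ ∑ C ∈ A.powerset, subsetWeight p A C *
        Real.exp (-((C.biUnion S).card * (K / P : ℝ))) := missProb_le_sum h h0 h1 A S
    _ ≤ ∑ C ∈ A.powerset, subsetWeight p A C * ((∏ i ∈ C, Real.exp (-((1 - ε) * σ))) +
          if b₀ < A.card then Real.exp (-((1 - ε) * (b₀ * σ))) else 0) := by
        refine Finset.sum_le_sum fun C hC =>
          mul_le_mul_of_nonneg_left ?_ (subsetWeight_nonneg h0 h1 A C)
        have hC := Finset.mem_powerset.1 hC
        rw [Finset.prod_const, ← Real.exp_nat_mul]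
        rcases le_or_gt C.card b₀ with hCb | hCb
        · have h5 : Real.exp (-((C.biUnion S).card * (K / P : ℝ))) ≤
              Real.exp (C.card * -((1 - ε) * σ)) := by
            refine Real.exp_le_exp.2 ?_
            linarith [hsmall C hC hCb]
          have h6 : 0 ≤ if b₀ < A.card then Real.exp (-((1 - ε) * (b₀ * σ))) else 0 := by
            split_ifs <;> positivity
          linarith
        · rw [if_pos (hCb.trans_le (Finset.card_le_card hC))]
          obtain ⟨C', hC', hc'⟩ := Finset.exists_subset_card_eq hCb.le
          have h7 := hsmall C' (hC'.trans hC) hc'.le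
          have h8 : ((C'.biUnion S).card : ℝ) ≤ (C.biUnion S).card := by
            exact_mod_cast Finset.card_le_card (Finset.biUnion_subset_biUnion_of_subset_left S hC')
          have h9 : ((C'.biUnion S).card : ℝ) * (K / P : ℝ) ≤ (C.biUnion S).card * (K / P : ℝ) := by
            gcongr
          rw [hc'] at h7
          have h10 : Real.exp (-((C.biUnion S).card * (K / P : ℝ))) ≤
              Real.exp (-((1 - ε) * (b₀ * σ))) := Real.exp_le_exp.2 (by linarith)
          have := Real.exp_pos (C.card * -((1 - ε) * σ))
          linarith
    _ = (p * Real.exp (-((1 - ε) * σ)) + (1 - p)) ^ A.card +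
          if b₀ < A.card then Real.exp (-((1 - ε) * (b₀ * σ))) else 0 := by
        simp only [mul_add, Finset.sum_add_distrib]
        rw [sum_subsetWeight_mul_prod A fun _ => Real.exp (-((1 - ε) * σ)), ← Finset.sum_mul,
          sum_subsetWeight, one_mul, Finset.prod_const]
    _ ≤ _ := by
        gcongr
        rw [show -((1 - 2 * ε) * (p * σ) * A.card) = A.card * -((1 - 2 * ε) * (p * σ)) by ring,
          Real.exp_nat_mul]
        have hp1 : 0 ≤ 1 - p := by linarith
        refine pow_le_pow_left₀ (by positivity) ?_ _
        have t1 := Real.add_one_le_exp (-((1 - 2 * ε) * (p * σ)))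
        have t2 := sub_sq_le_one_sub_exp (σ := (1 - ε) * σ) (by nlinarith) (by nlinarith)
        have t3 : (1 - 2 * ε) * σ ≤ 1 - Real.exp (-((1 - ε) * σ)) := by
          have t4 : ((1 - ε) * σ) ^ 2 ≤ ε * σ := by
            have : (1 - ε) ^ 2 ≤ 1 := by nlinarith
            calc ((1 - ε) * σ) ^ 2 = (1 - ε) ^ 2 * (σ * σ) := by ring
              _ ≤ 1 * (ε * σ) := by gcongr
              _ = _ := one_mul _
          linarith
        nlinarith [mul_le_mul_of_nonneg_left t3 h0]

open Classical in
/-- Large overlaps are unlikely: by a union bound over the sets of `b` nodes, `1 ≤ b ≤ b₀`, and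
Markov's inequality for the exponential moment of the excess with parameter `w = P / (b * K)`. -/
lemma keyMean_not_smallOverlap_le (h : K ≤ P) (hK : 0 < K) {c δ ε : ℝ} (hc : 0 < c)
    (hcP : c * n ≤ P) (hδ : 0 < δ) (hδ1 : δ ≤ 1) (hε : 0 < ε) (hεδ : 6 ≤ ε * Real.log δ⁻¹)
    (hεK : 2 ≤ ε * K) {b₀ : ℕ} (hb₀ : b₀ * (K : ℝ) ≤ δ * P)
    (hsmall : Real.exp 1 * (K / c) * Real.exp (-(2 * K : ℝ)) ≤ 1 / 2) :
    keyMean K (fun S : Fin n → Finset (Fin P) =>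
      if SmallOverlap K b₀ ε Finset.univ S then (0 : ℝ) else 1) ≤
      2 * (Real.exp 1 * (K / c) * Real.exp (-(2 * K : ℝ))) := by
  set η := Real.exp 1 * (K / c) * Real.exp (-(2 * K : ℝ)) with hη
  have hK' : (0 : ℝ) < K := by exact_mod_cast hK
  have hP' : (0 : ℝ) < P := by exact_mod_cast (hK.trans_le h)
  have hη0 : 0 ≤ η := by positivity
  -- the expected number of sets of `b` nodes with a large overlap
  have hone : ∀ b, 0 < b → b ≤ b₀ → ∀ B ∈ (Finset.univ : Finset (Fin n)).powersetCard b,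
      (n : ℝ) ^ b / (b ! : ℝ) * keyMean K (fun S : Fin n → Finset (Fin P) =>
        if (excess K B S : ℝ) ≤ ε * (b * K) then (0 : ℝ) else 1) ≤ η ^ b := by
    intro b hb hbb₀ B hB
    have hBb := (Finset.mem_powersetCard.1 hB).2
    have hb' : (0 : ℝ) < b := by exact_mod_cast hb
    have hbK : (b : ℝ) * K ≤ δ * P :=
      (mul_le_mul_of_nonneg_right (by exact_mod_cast hbb₀) hK'.le).trans hb₀
    set w : ℝ := P / (b * K) with hw
    have hwδ : δ⁻¹ ≤ w := by
      rw [hw, le_div_iff₀ (by positivity), inv_mul_le_iff₀ hδ]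
      exact hbK
    have hw1 : 1 ≤ w := (one_le_inv_iff₀.2 ⟨hδ, hδ1⟩).trans hwδ
    have hw0 : 0 < w := by linarith
    have hlog : Real.log δ⁻¹ ≤ Real.log w := Real.log_le_log (by positivity) hwδ
    have hlogδ : 0 ≤ Real.log δ⁻¹ := Real.log_nonneg (one_le_inv_iff₀.2 ⟨hδ, hδ1⟩)
    have hmarkov : keyMean K (fun S : Fin n → Finset (Fin P) =>
        if (excess K B S : ℝ) ≤ ε * (b * K) then (0 : ℝ) else 1) ≤
        Real.exp (-(ε * (b * K) * Real.log w)) * Real.exp (b * K) := by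
      calc keyMean K (fun S : Fin n → Finset (Fin P) =>
            if (excess K B S : ℝ) ≤ ε * (b * K) then (0 : ℝ) else 1)
          ≤ keyMean K (fun S : Fin n → Finset (Fin P) =>
            Real.exp (-(ε * (b * K) * Real.log w)) * w ^ excess K B S) := by
            refine keyMean_mono fun S _ => ?_
            split_ifs with hle
            · positivity
            · push Not at hle
              rw [← Real.exp_log hw0, ← Real.exp_nat_mul, Real.log_exp, ← Real.exp_add]
              refine Real.one_le_exp ?_
              have := mul_le_mul_of_nonneg_right hle.le (Real.log_nonneg hw1)
              linarith
        _ ≤ _ := by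
            rw [keyMean_const_mul]
            refine mul_le_mul_of_nonneg_left ((keyMean_pow_excess_le h B hw1).trans ?_)
              (by positivity)
            refine Real.exp_le_exp.2 ?_
            rw [hBb]
            calc (w - 1) * ((b : ℝ) ^ 2 * ((K : ℝ) ^ 2 / P))
                ≤ w * ((b : ℝ) ^ 2 * ((K : ℝ) ^ 2 / P)) := by gcongr; linarith
              _ = (b : ℝ) * K := by rw [hw]; field_simp
    have hfact : (b : ℝ) ^ b / (b ! : ℝ) ≤ Real.exp b := Real.pow_div_factorial_le_exp _ (by positivity) b
    have hnb : (n : ℝ) / b ≤ K / c * w := by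
      rw [hw, div_mul_div_comm, div_le_div_iff₀ hb' (by positivity)]
      have := mul_le_mul_of_nonneg_left hcP (by positivity : 0 ≤ (K : ℝ) * b)
      nlinarith
    have hpow : (n : ℝ) ^ b / (b ! : ℝ) ≤ (Real.exp 1 * (K / c) * w) ^ b := by
      calc (n : ℝ) ^ b / (b ! : ℝ) = ((n : ℝ) / b) ^ b * ((b : ℝ) ^ b / (b ! : ℝ)) := by
            rw [div_pow]; field_simp
        _ ≤ (K / c * w) ^ b * Real.exp b := by gcongr
        _ = _ := by rw [← Real.exp_one_pow]; ring
    calc (n : ℝ) ^ b / (b ! : ℝ) * keyMean K (fun S : Fin n → Finset (Fin P) =>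
          if (excess K B S : ℝ) ≤ ε * (b * K) then (0 : ℝ) else 1)
        ≤ (Real.exp 1 * (K / c) * w) ^ b *
            (Real.exp (-(ε * (b * K) * Real.log w)) * Real.exp (b * K)) := by
          refine mul_le_mul hpow hmarkov (keyMean_nonneg fun S _ => ?_) (by positivity)
          split_ifs <;> norm_num
      _ = (Real.exp 1 * (K / c) * Real.exp (Real.log w - ε * K * Real.log w + K)) ^ b := by
          have e1 : Real.exp (-(ε * (b * K) * Real.log w)) = Real.exp (-(ε * K * Real.log w)) ^ b := by
            rw [← Real.exp_nat_mul]; congr 1; ring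
          have e2 : Real.exp (Real.log w - ε * K * Real.log w + K) =
              w * Real.exp (-(ε * K * Real.log w)) * Real.exp K := by
            rw [Real.exp_add, sub_eq_add_neg, Real.exp_add, Real.exp_log hw0]
          rw [e1, e2, Real.exp_nat_mul]
          ring
      _ ≤ _ := by
          rw [hη]
          have : Real.log w - ε * K * Real.log w + K ≤ -(2 * K) := by
            have t1 : ε * K / 2 * Real.log w ≤ (ε * K - 1) * Real.log w :=
              mul_le_mul_of_nonneg_right (by linarith) (hlogδ.trans hlog)
            have t2 : K / 2 * 6 ≤ K / 2 * (ε * Real.log w) := by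
              refine mul_le_mul_of_nonneg_left (hεδ.trans ?_) (by positivity)
              exact mul_le_mul_of_nonneg_left hlog hε.le
            nlinarith
          gcongr
  calc keyMean K (fun S : Fin n → Finset (Fin P) =>
        if SmallOverlap K b₀ ε Finset.univ S then (0 : ℝ) else 1)
      ≤ keyMean K (fun S : Fin n → Finset (Fin P) => ∑ b ∈ Finset.Icc 1 b₀,
          ∑ B ∈ (Finset.univ : Finset (Fin n)).powersetCard b,
            if (excess K B S : ℝ) ≤ ε * (b * K) then (0 : ℝ) else 1) := by
        refine keyMean_mono fun S _ => ?_
        have hnn : ∀ b ∈ Finset.Icc 1 b₀, (0 : ℝ) ≤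
            ∑ B ∈ (Finset.univ : Finset (Fin n)).powersetCard b,
            if (excess K B S : ℝ) ≤ ε * (b * K) then (0 : ℝ) else 1 := fun b _ =>
          Finset.sum_nonneg fun B _ => by split_ifs <;> norm_num
        split_ifs with hG
        · exact Finset.sum_nonneg hnn
        · unfold SmallOverlap at hG
          push Not at hG
          obtain ⟨B, -, hBb, hB⟩ := hG
          have hB1 : 1 ≤ B.card := by
            rw [Nat.one_le_iff_ne_zero]
            intro hB0
            rw [Finset.card_eq_zero.1 hB0] at hB
            simp [excess] at hB
          refine le_trans ?_ (Finset.single_le_sum hnn (Finset.mem_Icc.2 ⟨hB1, hBb⟩))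
          refine le_trans (le_of_eq ?_) (Finset.single_le_sum (fun B _ => ?_)
            (Finset.mem_powersetCard.2 ⟨Finset.subset_univ B, rfl⟩))
          · rw [if_neg (not_le.2 hB)]
          · split_ifs <;> norm_num
    _ ≤ ∑ b ∈ Finset.Icc 1 b₀, η ^ b := by
        rw [keyMean_sum]
        refine Finset.sum_le_sum fun b hb => ?_
        obtain ⟨hb1, hb2⟩ := Finset.mem_Icc.1 hb
        rw [keyMean_sum]
        rcases Finset.eq_empty_or_nonempty ((Finset.univ : Finset (Fin n)).powersetCard b) with he | hne
        · rw [he, Finset.sum_empty]; positivity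
        have hcardn : (((Finset.univ : Finset (Fin n)).powersetCard b).card : ℝ) ≤
            (n : ℝ) ^ b / (b ! : ℝ) := by
          rw [Finset.card_powersetCard, Finset.card_univ, Fintype.card_fin]
          exact Nat.choose_le_pow_div b n
        have hcard0 : (0 : ℝ) < ((Finset.univ : Finset (Fin n)).powersetCard b).card := by
          exact_mod_cast Finset.card_pos.2 hne
        have hdiv : ∀ B ∈ (Finset.univ : Finset (Fin n)).powersetCard b,
            keyMean K (fun S : Fin n → Finset (Fin P) =>
              if (excess K B S : ℝ) ≤ ε * (b * K) then (0 : ℝ) else 1) ≤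
            η ^ b / ((Finset.univ : Finset (Fin n)).powersetCard b).card := by
          intro B hB
          rw [le_div_iff₀ hcard0, mul_comm]
          refine (mul_le_mul_of_nonneg_right hcardn (keyMean_nonneg fun S _ => ?_)).trans
            (hone b hb1 hb2 B hB)
          split_ifs <;> norm_num
        refine (Finset.sum_le_sum hdiv).trans_eq ?_
        rw [Finset.sum_const, nsmul_eq_mul]
        field_simp
    _ ≤ 2 * η := by
        have e : ∑ b ∈ Finset.Icc 1 b₀, η ^ b = η * ∑ b ∈ Finset.range b₀, η ^ b := by
          rw [Finset.mul_sum, Finset.range_eq_Ico, Finset.sum_Ico_eq_sum_range,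
            ← Finset.Ico_add_one_right_eq_Icc, Finset.sum_Ico_eq_sum_range]
          simp only [Nat.add_sub_cancel, Nat.sub_zero]
          exact Finset.sum_congr rfl fun i _ => by rw [pow_add]; simp
        have hgeom : ∑ b ∈ Finset.range b₀, η ^ b ≤ 2 := by
          calc ∑ b ∈ Finset.range b₀, η ^ b ≤ ∑ b ∈ Finset.range b₀, (1 / 2 : ℝ) ^ b :=
                Finset.sum_le_sum fun b _ => pow_le_pow_left₀ hη0 hsmall b
            _ ≤ ∑' b : ℕ, (1 / 2 : ℝ) ^ b := summable_geometric_two.sum_le_tsum _ fun b _ => by positivity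
            _ = 2 := tsum_geometric_two
        rw [e, mul_comm]
        gcongr

end Bounds

/-! ### The asymptotic regime -/

/-- The asymptotic consequences of the hypotheses that the argument uses: the load is the
approximate mean degree, and `n * exp (-load) * load ^ d / d!` the approximate expected number
of nodes of degree `d`. Here `d` is the degree of connectivity minus one, and `μ` is the limit of
this number times `d!`. -/
structure Regime (d : ℕ) (K P : ℕ → ℕ) (p : ℕ → ℝ) (μ : ℝ) : Prop where
  p_nonneg : ∀ n, 0 ≤ p n
  p_le_one : ∀ n, p n ≤ 1
  K_le : ∀ᶠ n in atTop, K n ≤ P n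
  tendsto_K : Tendsto (fun n => (K n : ℝ)) atTop atTop
  le_P : ∃ c : ℝ, 0 < c ∧ ∀ᶠ n : ℕ in atTop, c * n ≤ P n
  sigma_log : Tendsto (fun n : ℕ => (K n : ℝ) ^ 2 / P n * Real.log n) atTop (𝓝 0)
  load_log : Tendsto (fun n : ℕ => load n (K n) (P n) (p n) / Real.log n) atTop (𝓝 1)
  load_exp : Tendsto (fun n : ℕ => n * Real.exp (-load n (K n) (P n) (p n)) *
    load n (K n) (P n) (p n) ^ d) atTop (𝓝 μ)

lemma tendsto_log_natCast : Tendsto (fun n : ℕ => Real.log n) atTop atTop :=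
  Real.tendsto_log_atTop.comp tendsto_natCast_atTop_atTop

lemma tendsto_log_log_div_log :
    Tendsto (fun n : ℕ => Real.log (Real.log n) / Real.log n) atTop (𝓝 0) :=
  Real.isLittleO_log_id_atTop.tendsto_div_nhds_zero.comp tendsto_log_natCast

/-- The hypotheses of the theorem imply the asymptotic regime. -/
lemma regime_of_scaling {k : ℕ} (hk : 1 ≤ k) {K P : ℕ → ℕ} {p : ℕ → unitInterval} {β : ℕ → ℝ}
    {βstar : ℝ} (hP : (fun n : ℕ => (n : ℝ)) =O[atTop] fun n : ℕ => (P n : ℝ))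
    (hK : (fun n : ℕ => (K n : ℝ) ^ 2 / (P n : ℝ)) =o[atTop] fun n : ℕ => 1 / Real.log (n : ℝ))
    (hβ : ∀ᶠ n : ℕ in atTop, (p n : ℝ) * ((K n : ℝ) ^ 2 / (P n : ℝ)) =
      (Real.log (n : ℝ) + ((k : ℝ) - 1) * Real.log (Real.log (n : ℝ)) + β n) / (n : ℝ))
    (hlim : Tendsto β atTop (𝓝 βstar)) :
    Regime (k - 1) K P (fun n => (p n : ℝ)) (Real.exp (-βstar)) := by
  have hlogpos : ∀ᶠ n : ℕ in atTop, 0 < Real.log n := tendsto_log_natCast.eventually_gt_atTop 0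
  have hload : ∀ᶠ n : ℕ in atTop, load n (K n) (P n) (p n) =
      Real.log n + ((k : ℝ) - 1) * Real.log (Real.log n) + β n := by
    filter_upwards [hβ, eventually_gt_atTop 0] with n hn hn0
    have : (n : ℝ) ≠ 0 := by positivity
    rw [load, hn]
    field_simp
  have hll : Tendsto (fun n : ℕ => load n (K n) (P n) (p n) / Real.log n) atTop (𝓝 1) := by
    have h1 : Tendsto (fun n : ℕ => 1 + ((k : ℝ) - 1) * (Real.log (Real.log n) / Real.log n) +
        β n / Real.log n) atTop (𝓝 (1 + ((k : ℝ) - 1) * 0 + 0)) :=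
      ((tendsto_log_log_div_log.const_mul _).const_add 1).add (hlim.div_atTop tendsto_log_natCast)
    simp only [mul_zero, add_zero] at h1
    refine h1.congr' ?_
    filter_upwards [hload, hlogpos] with n hn hl
    rw [hn]
    field_simp
  have hload_top : Tendsto (fun n : ℕ => load n (K n) (P n) (p n)) atTop atTop := by
    have := hll.pos_mul_atTop one_pos tendsto_log_natCast
    refine this.congr' ?_
    filter_upwards [hlogpos] with n hl
    field_simp
  obtain ⟨C, hC, hCP⟩ := hP.exists_pos
  have hcP : ∀ᶠ n : ℕ in atTop, C⁻¹ * n ≤ P n := by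
    filter_upwards [hCP.bound] with n hn
    simp only [Real.norm_natCast] at hn
    rwa [inv_mul_le_iff₀ hC]
  have hσlog : Tendsto (fun n : ℕ => (K n : ℝ) ^ 2 / P n * Real.log n) atTop (𝓝 0) := by
    have := hK.tendsto_div_nhds_zero
    refine this.congr fun n => ?_
    rw [div_div_eq_mul_div, div_one]
  have hσ : ∀ᶠ n : ℕ in atTop, (K n : ℝ) ^ 2 / P n < 1 := by
    filter_upwards [hσlog.eventually_lt_const one_pos,
      tendsto_log_natCast.eventually_ge_atTop 1] with n hn hl
    have : (0 : ℝ) ≤ (K n : ℝ) ^ 2 / P n := by positivity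
    nlinarith
  have hPpos : ∀ᶠ n : ℕ in atTop, (0 : ℝ) < P n := by
    filter_upwards [hcP, eventually_gt_atTop 0] with n hn hn0
    have : (0 : ℝ) < n := by exact_mod_cast hn0
    have : 0 < C⁻¹ * n := by positivity
    linarith
  refine ⟨fun n => (p n).2.1, fun n => (p n).2.2, ?_, ?_, ⟨C⁻¹, by positivity, hcP⟩, hσlog, hll, ?_⟩
  · filter_upwards [hσ, hPpos] with n hn hP0
    rw [div_lt_one hP0] at hn
    have h1 : K n ^ 2 < P n := by exact_mod_cast hn
    exact (Nat.le_self_pow two_ne_zero _).trans h1.le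
  · -- since `P` is at least of order `n`, the square of `K` is at least of the order of the load
    have h2 : Tendsto (fun n => (K n : ℝ) ^ 2) atTop atTop := by
      refine tendsto_atTop_mono' _ ?_ (hload_top.const_mul_atTop (inv_pos.2 hC))
      filter_upwards [hcP, hPpos] with n hn hP0
      unfold load
      have hσ0 : (0 : ℝ) ≤ (K n : ℝ) ^ 2 / P n := by positivity
      have hp1 := (p n).2.2
      have hp0 := (p n).2.1
      calc C⁻¹ * (n * ((p n : ℝ) * ((K n : ℝ) ^ 2 / P n)))
          = C⁻¹ * n * ((p n : ℝ) * ((K n : ℝ) ^ 2 / P n)) := by ring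
        _ ≤ P n * (1 * ((K n : ℝ) ^ 2 / P n)) := by gcongr
        _ = _ := by field_simp
    refine tendsto_atTop.2 fun b => ?_
    filter_upwards [h2.eventually_ge_atTop (b ^ 2)] with n hn
    exact le_of_sq_le_sq hn (by positivity)
  · have h1 : Tendsto (fun n : ℕ => Real.exp (-β n) *
        (load n (K n) (P n) (p n) / Real.log n) ^ (k - 1)) atTop
        (𝓝 (Real.exp (-βstar) * 1 ^ (k - 1))) :=
      ((Real.continuous_exp.tendsto _).comp hlim.neg).mul (hll.pow _)
    rw [one_pow, mul_one] at h1
    refine h1.congr' ?_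
    filter_upwards [hload, hlogpos, eventually_gt_atTop 0] with n hn hl hn0
    have hn0' : (0 : ℝ) < n := by exact_mod_cast hn0
    have e : Real.exp (-load n (K n) (P n) (p n)) =
        Real.exp (-β n) / (n * Real.log n ^ (k - 1)) := by
      rw [hn, eq_div_iff (by positivity)]
      have e1 : (n : ℝ) * Real.log n ^ (k - 1) =
          Real.exp (Real.log n + ((k : ℝ) - 1) * Real.log (Real.log n)) := by
        have e2 : (k : ℝ) - 1 = (k - 1 : ℕ) := by push_cast [Nat.cast_sub hk]; ring
        rw [Real.exp_add, Real.exp_log hn0', e2, Real.exp_nat_mul, Real.exp_log hl]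
      rw [e1, ← Real.exp_add]
      congr 1
      ring
    rw [e, div_pow]
    field_simp

namespace Regime
variable {d : ℕ} {K P : ℕ → ℕ} {p : ℕ → ℝ} {μ : ℝ}

lemma load_nonneg (hR : Regime d K P p μ) (n : ℕ) : 0 ≤ load n (K n) (P n) (p n) :=
  SecureNetwork.load_nonneg (hR.p_nonneg n)

lemma tendsto_load (hR : Regime d K P p μ) :
    Tendsto (fun n => load n (K n) (P n) (p n)) atTop atTop := by
  refine (hR.load_log.pos_mul_atTop one_pos tendsto_log_natCast).congr' ?_
  filter_upwards [tendsto_log_natCast.eventually_gt_atTop 0] with n hl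
  field_simp

lemma tendsto_sigma (hR : Regime d K P p μ) :
    Tendsto (fun n => (K n : ℝ) ^ 2 / P n) atTop (𝓝 0) := by
  refine (hR.sigma_log.div_atTop tendsto_log_natCast).congr' ?_
  filter_upwards [tendsto_log_natCast.eventually_gt_atTop 0] with n hl
  field_simp

lemma tendsto_load_mul_sigma (hR : Regime d K P p μ) :
    Tendsto (fun n => load n (K n) (P n) (p n) * ((K n : ℝ) ^ 2 / P n)) atTop (𝓝 0) := by
  have := hR.load_log.mul hR.sigma_log
  rw [mul_zero] at this
  refine this.congr' ?_
  filter_upwards [tendsto_log_natCast.eventually_gt_atTop 0] with n hl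
  field_simp

lemma load_le_two_log (hR : Regime d K P p μ) :
    ∀ᶠ n : ℕ in atTop, load n (K n) (P n) (p n) ≤ 2 * Real.log n := by
  filter_upwards [hR.load_log.eventually_lt_const (one_lt_two),
    tendsto_log_natCast.eventually_gt_atTop 0] with n hn hl
  rw [div_lt_iff₀ hl] at hn
  exact hn.le

lemma tendsto_log_mul_rpow_neg {s : ℝ} (hs : 0 < s) :
    Tendsto (fun n : ℕ => Real.log n * (n : ℝ) ^ (-s)) atTop (𝓝 0) := by
  have h1 : Tendsto (fun x : ℝ => Real.log x / x ^ s) atTop (𝓝 0) :=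
    (isLittleO_log_rpow_atTop hs).tendsto_div_nhds_zero
  refine (h1.comp tendsto_natCast_atTop_atTop).congr fun n => ?_
  simp only [Function.comp_apply]
  rw [Real.rpow_neg (Nat.cast_nonneg n), div_eq_mul_inv]

lemma edge_eq_load_div (n : ℕ) (hn : 0 < n) :
    p n * ((K n : ℝ) ^ 2 / P n) = load n (K n) (P n) (p n) / n := by
  have : (n : ℝ) ≠ 0 := by positivity
  unfold load
  field_simp

/-- Even multiplied by `n ^ (1/8)`, the probability of a link tends to zero. -/
lemma tendsto_rpow_mul_edge (hR : Regime d K P p μ) :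
    Tendsto (fun n : ℕ => (n : ℝ) ^ (1 / 8 : ℝ) * (p n * ((K n : ℝ) ^ 2 / P n))) atTop (𝓝 0) := by
  have h1 := (tendsto_log_mul_rpow_neg (s := 7 / 8) (by norm_num)).const_mul 2
  rw [mul_zero] at h1
  refine squeeze_zero' (Eventually.of_forall fun n => ?_) ?_ h1
  · have := hR.p_nonneg n
    positivity
  · filter_upwards [hR.load_le_two_log, eventually_gt_atTop 0] with n hn hn0
    have hn0' : (0 : ℝ) < n := by exact_mod_cast hn0
    rw [edge_eq_load_div n hn0]
    calc (n : ℝ) ^ (1 / 8 : ℝ) * (load n (K n) (P n) (p n) / n)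
        ≤ (n : ℝ) ^ (1 / 8 : ℝ) * (2 * Real.log n / n) := by gcongr
      _ = 2 * (Real.log n * ((n : ℝ) ^ (1 / 8 : ℝ) * (n : ℝ) ^ (-1 : ℝ))) := by
          rw [Real.rpow_neg_one]; ring
      _ = _ := by rw [← Real.rpow_add hn0']; norm_num

lemma tendsto_edge (hR : Regime d K P p μ) :
    Tendsto (fun n : ℕ => p n * ((K n : ℝ) ^ 2 / P n)) atTop (𝓝 0) := by
  refine squeeze_zero' (Eventually.of_forall fun n => ?_) ?_ hR.tendsto_rpow_mul_edge
  · have := hR.p_nonneg n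
    positivity
  · filter_upwards [eventually_ge_atTop 1] with n hn
    have := hR.p_nonneg n
    have hn' : (1 : ℝ) ≤ n := by exact_mod_cast hn
    exact le_mul_of_one_le_left (by positivity) (Real.one_le_rpow hn' (by norm_num))

/-- The overlap of the key rings of at most `n ^ (1/8)` nodes is negligible: if the rings are
small then the overlap is small, and if they are large then a common key costs little. -/
lemma tendsto_overlap (hR : Regime d K P p μ) :
    Tendsto (fun n : ℕ => (Real.exp (load n (K n) (P n) (p n) / K n) - 1) *
      ((n : ℝ) ^ (1 / 8 : ℝ) * ((K n : ℝ) ^ 2 / P n))) atTop (𝓝 0) := by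
  obtain ⟨c, hc, hcP⟩ := hR.le_P
  have hbound : Tendsto (fun n : ℕ => (n : ℝ) ^ (-(1 / 4) : ℝ) / c + 4 * (n : ℝ) ^ (-(1 / 8) : ℝ))
      atTop (𝓝 (0 / c + 4 * 0)) :=
    (((tendsto_rpow_neg_atTop (by norm_num)).comp tendsto_natCast_atTop_atTop).div_const c).add
      (((tendsto_rpow_neg_atTop (by norm_num)).comp tendsto_natCast_atTop_atTop).const_mul 4)
  rw [zero_div, mul_zero, add_zero] at hbound
  have hsmall : ∀ᶠ n : ℕ in atTop, 2 * (Real.log n * (n : ℝ) ^ (-(1 / 4) : ℝ)) < 1 := by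
    have := (tendsto_log_mul_rpow_neg (s := 1 / 4) (by norm_num)).const_mul 2
    rw [mul_zero] at this
    exact this.eventually_lt_const one_pos
  refine squeeze_zero' (Eventually.of_forall fun n => ?_) ?_ hbound
  · have : 1 ≤ Real.exp (load n (K n) (P n) (p n) / K n) :=
      Real.one_le_exp (div_nonneg (hR.load_nonneg n) (by positivity))
    have : 0 ≤ Real.exp (load n (K n) (P n) (p n) / K n) - 1 := by linarith
    positivity
  · filter_upwards [hR.load_le_two_log, hcP, hsmall, eventually_gt_atTop 0,
      hR.tendsto_K.eventually_ge_atTop 16, hR.sigma_log.eventually_lt_const one_pos,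
      tendsto_log_natCast.eventually_gt_atTop 0] with n hl hP hs hn0 hK16 hσl hlog
    have hn0' : (0 : ℝ) < n := by exact_mod_cast hn0
    have hK0 : (0 : ℝ) < K n := by linarith
    have hP0 : (0 : ℝ) < P n := by have : 0 < c * n := by positivity
                                   linarith
    have hl0 := hR.load_nonneg n
    have hexp : 1 ≤ Real.exp (load n (K n) (P n) (p n) / K n) := Real.one_le_exp (by positivity)
    -- for small rings `K ^ 2 / P` is a negative power of `n`, for large ones `load / K` is
    rcases le_or_gt (K n : ℝ) ((n : ℝ) ^ (1 / 4 : ℝ)) with hK | hK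
    · have h1 : Real.exp (load n (K n) (P n) (p n) / K n) ≤ (n : ℝ) ^ (1 / 8 : ℝ) := by
        rw [Real.rpow_def_of_pos hn0']
        refine Real.exp_le_exp.2 ?_
        rw [div_le_iff₀ hK0]
        nlinarith
      have h2 : (K n : ℝ) ^ 2 / P n ≤ (n : ℝ) ^ (-(1 / 2) : ℝ) / c := by
        have h3 : (K n : ℝ) ^ 2 ≤ (n : ℝ) ^ (1 / 2 : ℝ) := by
          calc (K n : ℝ) ^ 2 ≤ ((n : ℝ) ^ (1 / 4 : ℝ)) ^ 2 := by gcongr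
            _ = _ := by rw [← Real.rpow_natCast, ← Real.rpow_mul hn0'.le]; norm_num
        calc (K n : ℝ) ^ 2 / P n ≤ (n : ℝ) ^ (1 / 2 : ℝ) / (c * n) := by gcongr
          _ = (n : ℝ) ^ (1 / 2 : ℝ) * (n : ℝ) ^ (-1 : ℝ) / c := by
              rw [Real.rpow_neg_one]; field_simp
          _ = _ := by rw [← Real.rpow_add hn0']; norm_num
      calc (Real.exp (load n (K n) (P n) (p n) / K n) - 1) *
            ((n : ℝ) ^ (1 / 8 : ℝ) * ((K n : ℝ) ^ 2 / P n))
          ≤ (n : ℝ) ^ (1 / 8 : ℝ) * ((n : ℝ) ^ (1 / 8 : ℝ) * ((n : ℝ) ^ (-(1 / 2) : ℝ) / c)) := by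
            gcongr
            linarith
        _ = (n : ℝ) ^ (1 / 8 : ℝ) * (n : ℝ) ^ (1 / 8 : ℝ) * (n : ℝ) ^ (-(1 / 2) : ℝ) / c := by ring
        _ = (n : ℝ) ^ (-(1 / 4) : ℝ) / c := by
            rw [← Real.rpow_add hn0', ← Real.rpow_add hn0']; norm_num
        _ ≤ _ := by
            have : 0 < (n : ℝ) ^ (-(1 / 8) : ℝ) := by positivity
            linarith
    · have hq : (0 : ℝ) < (n : ℝ) ^ (1 / 4 : ℝ) := by positivity
      have ht : load n (K n) (P n) (p n) / K n ≤ 2 * (Real.log n * (n : ℝ) ^ (-(1 / 4) : ℝ)) := by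
        calc load n (K n) (P n) (p n) / K n ≤ 2 * Real.log n / (n : ℝ) ^ (1 / 4 : ℝ) := by gcongr
          _ = _ := by rw [Real.rpow_neg hn0'.le]; ring
      have h1 : Real.exp (load n (K n) (P n) (p n) / K n) - 1 ≤
          4 * (Real.log n * (n : ℝ) ^ (-(1 / 4) : ℝ)) := by
        have h0 : 0 ≤ load n (K n) (P n) (p n) / K n := by positivity
        have := Real.abs_exp_sub_one_le (x := load n (K n) (P n) (p n) / K n)
          (by rw [abs_of_nonneg h0]; linarith)
        rw [abs_of_nonneg h0] at this
        have := (le_abs_self _).trans this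
        linarith
      calc (Real.exp (load n (K n) (P n) (p n) / K n) - 1) *
            ((n : ℝ) ^ (1 / 8 : ℝ) * ((K n : ℝ) ^ 2 / P n))
          ≤ 4 * (Real.log n * (n : ℝ) ^ (-(1 / 4) : ℝ)) *
              ((n : ℝ) ^ (1 / 8 : ℝ) * ((K n : ℝ) ^ 2 / P n)) := by gcongr
        _ = 4 * ((n : ℝ) ^ (-(1 / 4) : ℝ) * (n : ℝ) ^ (1 / 8 : ℝ)) *
              ((K n : ℝ) ^ 2 / P n * Real.log n) := by ring
        _ ≤ 4 * ((n : ℝ) ^ (-(1 / 4) : ℝ) * (n : ℝ) ^ (1 / 8 : ℝ)) * 1 := by gcongr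
        _ = 4 * (n : ℝ) ^ (-(1 / 8) : ℝ) := by rw [← Real.rpow_add hn0']; norm_num
        _ ≤ _ := by
            have : 0 < (n : ℝ) ^ (-(1 / 4) : ℝ) / c := by positivity
            linarith

lemma tendsto_overlap_const (hR : Regime d K P p μ) :
    Tendsto (fun n : ℕ => (Real.exp (load n (K n) (P n) (p n) / K n) - 1) *
      ((K n : ℝ) ^ 2 / P n)) atTop (𝓝 0) := by
  have hnn : ∀ n, 0 ≤ Real.exp (load n (K n) (P n) (p n) / K n) - 1 := fun n => by
    have : 1 ≤ Real.exp (load n (K n) (P n) (p n) / K n) :=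
      Real.one_le_exp (div_nonneg (hR.load_nonneg n) (by positivity))
    linarith
  refine squeeze_zero' (Eventually.of_forall fun n => ?_) ?_ hR.tendsto_overlap
  · have := hnn n
    positivity
  · filter_upwards [eventually_ge_atTop 1] with n hn
    have hn' : (1 : ℝ) ≤ n := by exact_mod_cast hn
    refine mul_le_mul_of_nonneg_left ?_ (hnn n)
    exact le_mul_of_one_le_left (by positivity) (Real.one_le_rpow hn' (by norm_num))

end Regime

/-! ### Bounded sets of nodes -/

lemma tendsto_choose_div_pow (d : ℕ) :
    Tendsto (fun n : ℕ => ((n.choose d : ℕ) : ℝ) / (n : ℝ) ^ d) atTop (𝓝 (1 / (d ! : ℝ))) := by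
  have h := (isEquivalent_choose d)
  have hne : ∀ᶠ n : ℕ in atTop, (n : ℝ) ^ d / (d ! : ℝ) ≠ 0 := by
    filter_upwards [eventually_gt_atTop 0] with n hn
    have : (n : ℝ) ≠ 0 := by positivity
    positivity
  have h1 := ((isEquivalent_iff_tendsto_one hne).1 h).mul_const (1 / (d ! : ℝ))
  rw [one_mul] at h1
  refine h1.congr fun n => ?_
  have : (d ! : ℝ) ≠ 0 := by positivity
  simp only [Pi.div_apply]
  field_simp

lemma tendsto_choose_sub_div_pow (m d : ℕ) :
    Tendsto (fun n : ℕ => (((n - m).choose d : ℕ) : ℝ) / (n : ℝ) ^ d) atTop (𝓝 (1 / (d ! : ℝ))) := by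
  have h1 := (tendsto_choose_div_pow d).comp (tendsto_sub_atTop_nat m)
  have h2 : Tendsto (fun n : ℕ => ((n - m : ℕ) : ℝ) / n) atTop (𝓝 1) := by
    have h3 : Tendsto (fun n : ℕ => 1 - (m : ℝ) / n) atTop (𝓝 (1 - 0)) :=
      (tendsto_const_div_atTop_nhds_zero_nat _).const_sub 1
    rw [sub_zero] at h3
    refine h3.congr' ?_
    filter_upwards [eventually_ge_atTop m, eventually_gt_atTop 0] with n hn hn0
    have : (n : ℝ) ≠ 0 := by positivity
    rw [Nat.cast_sub hn]
    field_simp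
  have h4 := h1.mul (h2.pow d)
  rw [one_pow, mul_one] at h4
  refine h4.congr' ?_
  filter_upwards [eventually_gt_atTop m] with n hn
  have : ((n - m : ℕ) : ℝ) ≠ 0 := by
    have : n - m ≠ 0 := by omega
    exact_mod_cast this
  simp only [Function.comp_apply]
  rw [div_pow]
  field_simp

lemma exp_neg_le_one_sub {x : ℝ} (h1 : x ≤ 1 / 2) :
    Real.exp (-(x + 2 * x ^ 2)) ≤ 1 - x := by
  rw [Real.exp_neg, inv_le_comm₀ (Real.exp_pos _) (by linarith)]
  have h2 := Real.add_one_le_exp (x + 2 * x ^ 2)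
  refine le_trans ?_ h2
  rw [inv_le_iff_one_le_mul₀ (by linarith)]
  nlinarith [mul_nonneg (sq_nonneg x) (by linarith : 0 ≤ 1 - 2 * x)]

namespace Regime
variable {d : ℕ} {K P : ℕ → ℕ} {p : ℕ → ℝ} {μ : ℝ}

lemma eventually_basic (hR : Regime d K P p μ) :
    ∀ᶠ n in atTop, K n ≤ P n ∧ 0 < K n ∧ (K n : ℝ) ^ 2 / P n ≤ 1 ∧ 0 < n := by
  filter_upwards [hR.K_le, hR.tendsto_K.eventually_gt_atTop 0,
    hR.tendsto_sigma.eventually_lt_const one_pos, eventually_gt_atTop 0] with n h1 h2 h3 h4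
  exact ⟨h1, by exact_mod_cast h2, h3.le, h4⟩

/-- The error term in the exponent of `missProb_pow_le` for sets of `r` nodes. -/
lemma tendsto_error (hR : Regime d K P p μ) (r J : ℕ) :
    Tendsto (fun n : ℕ => (r : ℝ) * ((r + J) * (p n * ((K n : ℝ) ^ 2 / P n)) +
      load n (K n) (P n) (p n) * ((K n : ℝ) ^ 2 / P n))) atTop (𝓝 0) := by
  have := ((hR.tendsto_edge.const_mul ((r : ℝ) + J)).add hR.tendsto_load_mul_sigma).const_mul (r : ℝ)
  simpa using this

lemma tendsto_load_exp_shift (hR : Regime d K P p μ) (r : ℝ) :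
    Tendsto (fun n : ℕ => n * Real.exp (-load n (K n) (P n) (p n)) *
      (1 + r * load n (K n) (P n) (p n)) ^ d) atTop (𝓝 (μ * r ^ d)) := by
  have h1 : Tendsto (fun n : ℕ => 1 / load n (K n) (P n) (p n) + r) atTop (𝓝 (0 + r)) :=
    (hR.tendsto_load.const_div_atTop 1).add_const r
  rw [zero_add] at h1
  refine (hR.load_exp.mul (h1.pow d)).congr' ?_
  filter_upwards [hR.tendsto_load.eventually_gt_atTop 0] with n hl
  rw [mul_assoc, ← mul_pow]
  congr 2
  field_simp

lemma tendsto_exp_sq_sigma (hR : Regime d K P p μ) (r : ℕ) :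
    Tendsto (fun n : ℕ => Real.exp ((r : ℝ) ^ 2 * ((K n : ℝ) ^ 2 / P n))) atTop (𝓝 1) := by
  have := (Real.continuous_exp.tendsto _).comp (hR.tendsto_sigma.const_mul ((r : ℝ) ^ 2))
  rw [mul_zero, Real.exp_zero] at this
  exact this

lemma tendsto_exp_overlap (hR : Regime d K P p μ) (r : ℕ) :
    Tendsto (fun n : ℕ => Real.exp ((Real.exp (load n (K n) (P n) (p n) / K n) - 1) *
      ((r : ℝ) ^ 2 * ((K n : ℝ) ^ 2 / P n)))) atTop (𝓝 1) := by
  have := (Real.continuous_exp.tendsto _).comp (hR.tendsto_overlap_const.const_mul ((r : ℝ) ^ 2))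
  simp only [mul_zero, Real.exp_zero] at this
  refine this.congr fun n => ?_
  simp only [Function.comp_apply]
  congr 1
  ring

lemma one_le_exp_load (hR : Regime d K P p μ) (n : ℕ) :
    1 ≤ Real.exp (load n (K n) (P n) (p n) / K n) :=
  Real.one_le_exp (div_nonneg (hR.load_nonneg n) (by positivity))

/-- A union bound over the `r`-element sets of nodes. -/
lemma sum_boundary_le {n P K : ℕ} {p : ℝ} (h : K ≤ P) (hK : 0 < K) (h0 : 0 ≤ p) (h1 : p ≤ 1)
    (hσ : (K : ℝ) ^ 2 / P ≤ 1) (r J : ℕ)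
    (χ : Finset (Fin n) → (Fin n → Finset (Fin P)) → ℝ)
    (hχ : ∀ A S S', (∀ i ∈ A, S i = S' i) → χ A S = χ A S')
    (hχ0 : ∀ A S, 0 ≤ χ A S) {M : ℝ}
    (hM : ∀ A : Finset (Fin n), A.card = r →
      keyMean K (fun S => χ A S * Real.exp (load n K P p / K) ^ excess K A S) ≤ M) :
    ∑ A ∈ (Finset.univ : Finset (Fin n)).powersetCard r,
      netMean K p (fun S G => χ A S * if (boundary A S G).card ≤ J then 1 else 0) ≤
      ((n.choose r : ℕ) : ℝ) * ((1 + r * load n K P p) ^ J *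
        Real.exp (-(r * load n K P p) + r * ((r + J) * (p * ((K : ℝ) ^ 2 / P)) +
          load n K P p * ((K : ℝ) ^ 2 / P))) * M) := by
  have hl := SecureNetwork.load_nonneg (n := n) (K := K) (P := P) h0
  refine (Finset.sum_le_card_nsmul _ _ ((1 + r * load n K P p) ^ J *
        Real.exp (-(r * load n K P p) + r * ((r + J) * (p * ((K : ℝ) ^ 2 / P)) +
          load n K P p * ((K : ℝ) ^ 2 / P))) * M) fun A hA => ?_).trans_eq ?_
  · have hAr := (Finset.mem_powersetCard.1 hA).2
    refine (netMean_boundary_card_le_exp h hK h0 h1 hσ A J (χ A) (hχ A) (hχ0 A)).trans ?_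
    rw [hAr]
    exact mul_le_mul_of_nonneg_left (hM A hAr) (by positivity)
  · rw [Finset.card_powersetCard, Finset.card_univ, Fintype.card_fin, nsmul_eq_mul]

lemma pow_mul_exp_eq (n r d : ℕ) (l x e : ℝ) :
    (n : ℝ) ^ r * (x ^ (r * d) * Real.exp (-(r * l) + e)) =
      (n * Real.exp (-l) * x ^ d) ^ r * Real.exp e := by
  rw [Real.exp_add, show -(r * l) = r * -l by ring, Real.exp_nat_mul, mul_pow, mul_pow, ← pow_mul,
    mul_comm d r]
  ring

lemma choose_le_pow (n r : ℕ) : ((n.choose r : ℕ) : ℝ) ≤ (n : ℝ) ^ r := by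
  exact_mod_cast Nat.choose_le_pow _ _

/-- Sets of `r` nodes with overlapping key rings and few outside neighbours do not occur. -/
lemma tendsto_overlapping (hR : Regime d K P p μ) (r : ℕ) :
    Tendsto (fun n : ℕ => ∑ A ∈ (Finset.univ : Finset (Fin n)).powersetCard r,
      netMean (K n) (p n) (fun (S : Fin n → Finset (Fin (P n))) G =>
        (if excess (K n) A S = 0 then 0 else 1) *
          if (boundary A S G).card ≤ r * d then 1 else 0)) atTop (𝓝 0) := by
  have hlim : Tendsto (fun n : ℕ => (n * Real.exp (-load n (K n) (P n) (p n)) *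
      (1 + r * load n (K n) (P n) (p n)) ^ d) ^ r *
      Real.exp ((r : ℝ) * ((r + (r * d : ℕ)) * (p n * ((K n : ℝ) ^ 2 / P n)) +
        load n (K n) (P n) (p n) * ((K n : ℝ) ^ 2 / P n))) *
      (Real.exp ((Real.exp (load n (K n) (P n) (p n) / K n) - 1) *
      ((r : ℝ) ^ 2 * ((K n : ℝ) ^ 2 / P n))) + Real.exp ((r : ℝ) ^ 2 * ((K n : ℝ) ^ 2 / P n)) - 2))
      atTop (𝓝 ((μ * (r : ℝ) ^ d) ^ r * Real.exp 0 * (1 + 1 - 2))) :=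
    (((hR.tendsto_load_exp_shift r).pow r).mul
      ((Real.continuous_exp.tendsto _).comp (hR.tendsto_error r (r * d)))).mul
      (((hR.tendsto_exp_overlap r).add (hR.tendsto_exp_sq_sigma r)).sub_const 2)
  rw [show (1 : ℝ) + 1 - 2 = 0 by norm_num, mul_zero] at hlim
  refine squeeze_zero' ?_ ?_ hlim
  · refine Eventually.of_forall fun n => Finset.sum_nonneg fun A _ =>
      netMean_nonneg (hR.p_nonneg n) (hR.p_le_one n) fun S G _ => ?_
    split_ifs <;> norm_num
  · filter_upwards [hR.eventually_basic] with n ⟨h1, h2, h3, h4⟩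
    have hl := hR.load_nonneg n
    have hM : ∀ A : Finset (Fin n), A.card = r → keyMean (K n) (fun S : Fin n → Finset (Fin (P n)) =>
        (if excess (K n) A S = 0 then (0 : ℝ) else 1) *
          Real.exp (load n (K n) (P n) (p n) / K n) ^ excess (K n) A S) ≤
        Real.exp ((Real.exp (load n (K n) (P n) (p n) / K n) - 1) *
      ((r : ℝ) ^ 2 * ((K n : ℝ) ^ 2 / P n))) + Real.exp ((r : ℝ) ^ 2 * ((K n : ℝ) ^ 2 / P n)) - 2 := by
      intro A hA
      have := keyMean_excess_ne_zero_mul_pow_le (n := n) h1 A (hR.one_le_exp_load n)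
      rwa [hA] at this
    refine (sum_boundary_le h1 h2 (hR.p_nonneg n) (hR.p_le_one n) h3 r (r * d)
      (fun A S => if excess (K n) A S = 0 then (0 : ℝ) else 1)
      (fun A S S' hS => by rw [excess_congr hS])
      (fun A S => by split_ifs <;> norm_num) hM).trans ?_
    rw [← pow_mul_exp_eq, ← mul_assoc, ← mul_assoc]
    have hM0 : 0 ≤ Real.exp ((Real.exp (load n (K n) (P n) (p n) / K n) - 1) *
      ((r : ℝ) ^ 2 * ((K n : ℝ) ^ 2 / P n))) + Real.exp ((r : ℝ) ^ 2 * ((K n : ℝ) ^ 2 / P n)) - 2 := by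
      have t1 : 1 ≤ Real.exp ((Real.exp (load n (K n) (P n) (p n) / K n) - 1) *
        ((r : ℝ) ^ 2 * ((K n : ℝ) ^ 2 / P n))) := Real.one_le_exp
          (mul_nonneg (by linarith [hR.one_le_exp_load n]) (by positivity))
      have t2 : 1 ≤ Real.exp ((r : ℝ) ^ 2 * ((K n : ℝ) ^ 2 / P n)) :=
        Real.one_le_exp (by positivity)
      linarith
    refine mul_le_mul_of_nonneg_right ?_ hM0
    rw [mul_assoc]
    exact mul_le_mul_of_nonneg_right (choose_le_pow n r) (by positivity)

/-- Sets of `r` nodes with fewer than `r * d` outside neighbours do not occur. -/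
lemma tendsto_few_neighbours (hR : Regime d K P p μ) (r M : ℕ) (hM : M ≤ r * d) :
    Tendsto (fun n : ℕ => ∑ A ∈ (Finset.univ : Finset (Fin n)).powersetCard r,
      netMean (K n) (p n) (fun (S : Fin n → Finset (Fin (P n))) G =>
          if (boundary A S G).card < M then 1 else 0)) atTop (𝓝 0) := by
  cases M with
  | zero => simp [netMean, keyMean, chanMean]
  | succ J =>
    have hr : 0 < r := by
      rcases Nat.eq_zero_or_pos r with rfl | hr
      · simp at hM
      · exact hr
    have hinv : Tendsto (fun n : ℕ => (1 + r * load n (K n) (P n) (p n))⁻¹) atTop (𝓝 0) :=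
      (tendsto_atTop_add_const_left _ 1
        (hR.tendsto_load.const_mul_atTop (by exact_mod_cast hr : (0 : ℝ) < r))).inv_tendsto_atTop
    have hlim : Tendsto (fun n : ℕ => (n * Real.exp (-load n (K n) (P n) (p n)) *
        (1 + r * load n (K n) (P n) (p n)) ^ d) ^ r *
        Real.exp ((r : ℝ) * ((r + J) * (p n * ((K n : ℝ) ^ 2 / P n)) +
          load n (K n) (P n) (p n) * ((K n : ℝ) ^ 2 / P n))) *
        Real.exp ((Real.exp (load n (K n) (P n) (p n) / K n) - 1) *
          ((r : ℝ) ^ 2 * ((K n : ℝ) ^ 2 / P n))) * (1 + r * load n (K n) (P n) (p n))⁻¹)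
        atTop (𝓝 ((μ * (r : ℝ) ^ d) ^ r * Real.exp 0 * 1 * 0)) :=
      ((((hR.tendsto_load_exp_shift r).pow r).mul
        ((Real.continuous_exp.tendsto _).comp (hR.tendsto_error r J))).mul
        (hR.tendsto_exp_overlap r)).mul hinv
    rw [mul_zero] at hlim
    refine squeeze_zero' ?_ ?_ hlim
    · refine Eventually.of_forall fun n => Finset.sum_nonneg fun A _ =>
        netMean_nonneg (hR.p_nonneg n) (hR.p_le_one n) fun S G _ => ?_
      split_ifs <;> norm_num
    · filter_upwards [hR.eventually_basic] with n ⟨h1, h2, h3, h4⟩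
      have hl := hR.load_nonneg n
      have hM' : ∀ A : Finset (Fin n), A.card = r → keyMean (K n)
          (fun S : Fin n → Finset (Fin (P n)) => (1 : ℝ) *
            Real.exp (load n (K n) (P n) (p n) / K n) ^ excess (K n) A S) ≤
          Real.exp ((Real.exp (load n (K n) (P n) (p n) / K n) - 1) *
            ((r : ℝ) ^ 2 * ((K n : ℝ) ^ 2 / P n))) := by
        intro A hA
        have := keyMean_pow_excess_le (n := n) h1 A (hR.one_le_exp_load n)
        rw [hA] at this
        simpa only [one_mul] using this
      have hb := sum_boundary_le h1 h2 (hR.p_nonneg n) (hR.p_le_one n) h3 r J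
        (fun A S => 1) (fun A S S' hS => rfl) (fun A S => zero_le_one) hM'
      simp only [one_mul, ← Nat.lt_succ_iff, Nat.succ_eq_add_one] at hb
      refine hb.trans ?_
      rw [← pow_mul_exp_eq]
      set x := 1 + r * load n (K n) (P n) (p n) with hx
      have hx1 : 1 ≤ x := by
        have : 0 ≤ (r : ℝ) * load n (K n) (P n) (p n) := by positivity
        linarith
      have hx0 : 0 < x := by linarith
      have hpow : x ^ J ≤ x ^ (r * d) * x⁻¹ := by
        rw [← div_eq_mul_inv, le_div_iff₀ hx0, ← pow_succ]
        exact pow_le_pow_right₀ hx1 hM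
      calc _ ≤ (n : ℝ) ^ r * (x ^ (r * d) * x⁻¹ * _ * _) := by
            refine mul_le_mul (choose_le_pow n r) ?_ (by positivity) (by positivity)
            refine mul_le_mul_of_nonneg_right (mul_le_mul_of_nonneg_right hpow ?_) ?_ <;> positivity
        _ = _ := by ring

end Regime

/-! ### The number of nodes of degree `d` is asymptotically Poisson -/

/-- If all nodes of `A` have degree `d`, then the key rings of `A` overlap, or `A` has fewer than
`A.card * d` outside neighbours, or the neighbourhoods are disjoint and lie outside `A`. -/
lemma indicator_nbrs_le {n P K d : ℕ} {S : Fin n → Finset (Fin P)} {G : SimpleGraph (Fin n)}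
    (hS : ∀ i, (S i).card = K) (A : Finset (Fin n)) :
    (if ∀ i ∈ A, (nbrs S G i).card = d then (1 : ℝ) else 0) ≤
      (if excess K A S = 0 then 0 else 1) *
          (if (boundary A S G).card ≤ A.card * d then 1 else 0) +
        (if (boundary A S G).card < A.card * d then 1 else 0) +
        (if excess K A S = 0 then 1 else 0) * separated d A S G := by
  have hsep : 0 ≤ separated d A S G := by
    rw [separated_eq]; split_ifs <;> norm_num
  split_ifs with h1 h2 h3 h4 h5 h6 h7 <;> try linarith
  · have := separated_eq_one hS h2 h1 (not_lt.1 h4)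
    linarith
  · exact absurd (boundary_card_le_of_nbrs h1) h3
  · exact absurd (boundary_card_le_of_nbrs h1) (by assumption)

namespace Regime
variable {d : ℕ} {K P : ℕ → ℕ} {p : ℕ → ℝ} {μ : ℝ}

lemma eventually_degreeMoment_le (hR : Regime d K P p μ) (r : ℕ) :
    ∀ᶠ n : ℕ in atTop, degreeMoment n (P n) (K n) (p n) d r ≤
      (∑ A ∈ (Finset.univ : Finset (Fin n)).powersetCard r,
        netMean (K n) (p n) (fun (S : Fin n → Finset (Fin (P n))) G =>
          (if excess (K n) A S = 0 then 0 else 1) *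
            if (boundary A S G).card ≤ r * d then 1 else 0)) +
      (∑ A ∈ (Finset.univ : Finset (Fin n)).powersetCard r,
        netMean (K n) (p n) (fun (S : Fin n → Finset (Fin (P n))) G =>
          if (boundary A S G).card < r * d then 1 else 0)) +
      (n * Real.exp (-load n (K n) (P n) (p n)) * load n (K n) (P n) (p n) ^ d / (d ! : ℝ)) ^ r /
        (r ! : ℝ) * Real.exp ((r : ℝ) * ((r + (r * d : ℕ)) * (p n * ((K n : ℝ) ^ 2 / P n)) +
          load n (K n) (P n) (p n) * ((K n : ℝ) ^ 2 / P n))) := by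
  filter_upwards [hR.eventually_basic] with n ⟨h1, h2, h3, h4⟩
  have hl := hR.load_nonneg n
  have hsum : ∑ A ∈ (Finset.univ : Finset (Fin n)).powersetCard r,
      netMean (K n) (p n) (fun (S : Fin n → Finset (Fin (P n))) G =>
        (if excess (K n) A S = 0 then 1 else 0) * separated d A S G) ≤
      (n * Real.exp (-load n (K n) (P n) (p n)) * load n (K n) (P n) (p n) ^ d / (d ! : ℝ)) ^ r /
        (r ! : ℝ) * Real.exp ((r : ℝ) * ((r + (r * d : ℕ)) * (p n * ((K n : ℝ) ^ 2 / P n)) +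
          load n (K n) (P n) (p n) * ((K n : ℝ) ^ 2 / P n))) := by
    set E := Real.exp ((r : ℝ) * ((r + (r * d : ℕ)) * (p n * ((K n : ℝ) ^ 2 / P n)) +
          load n (K n) (P n) (p n) * ((K n : ℝ) ^ 2 / P n))) with hE
    refine (Finset.sum_le_card_nsmul _ _ ((load n (K n) (P n) (p n) ^ d / (d ! : ℝ)) ^ r *
      (Real.exp (-load n (K n) (P n) (p n)) ^ r * E)) fun A hA => ?_).trans ?_
    · have hAr := (Finset.mem_powersetCard.1 hA).2
      have := netMean_separated_le (n := n) h1 h2 (hR.p_nonneg n) (hR.p_le_one n) h3 d A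
      rw [hAr, Real.exp_add, ← hE, show -((r : ℝ) * load n (K n) (P n) (p n)) =
        r * -load n (K n) (P n) (p n) by ring, Real.exp_nat_mul] at this
      exact this
    · rw [Finset.card_powersetCard, Finset.card_univ, Fintype.card_fin, nsmul_eq_mul]
      have hE0 : 0 ≤ E := (Real.exp_pos _).le
      calc ((n.choose r : ℕ) : ℝ) * ((load n (K n) (P n) (p n) ^ d / (d ! : ℝ)) ^ r *
            (Real.exp (-load n (K n) (P n) (p n)) ^ r * E))
          ≤ (n : ℝ) ^ r / (r ! : ℝ) * ((load n (K n) (P n) (p n) ^ d / (d ! : ℝ)) ^ r *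
            (Real.exp (-load n (K n) (P n) (p n)) ^ r * E)) :=
            mul_le_mul_of_nonneg_right (Nat.choose_le_pow_div r n) (by positivity)
        _ = _ := by
            clear_value E
            rw [mul_div_assoc, mul_pow, mul_pow]
            ring
  refine le_trans ?_ (add_le_add_right hsum _)
  rw [degreeMoment, ← Finset.sum_add_distrib, ← Finset.sum_add_distrib]
  refine Finset.sum_le_sum fun A hA => ?_
  have hAr := (Finset.mem_powersetCard.1 hA).2
  rw [← netMean_add, ← netMean_add]
  refine netMean_mono (hR.p_nonneg n) (hR.p_le_one n) fun S G hS => ?_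
  have := indicator_nbrs_le (d := d) (G := G) hS A
  rwa [hAr] at this

lemma eventually_le_degreeMoment (hR : Regime d K P p μ) (r : ℕ) :
    ∀ᶠ n : ℕ in atTop,
      ((n.choose r : ℕ) : ℝ) / (n : ℝ) ^ r *
        (2 - Real.exp ((r : ℝ) ^ 2 * ((K n : ℝ) ^ 2 / P n))) *
        ((((n - (r + r * d)).choose d : ℕ) : ℝ) / (n : ℝ) ^ d) ^ r *
        (1 - ((r : ℝ) + 1) * ((K n : ℝ) ^ 2 / P n)) ^ (d * r) *
        (n * Real.exp (-load n (K n) (P n) (p n)) * load n (K n) (P n) (p n) ^ d) ^ r *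
        Real.exp (-(2 * (r : ℝ) ^ 2 * (load n (K n) (P n) (p n) * (p n * ((K n : ℝ) ^ 2 / P n))))) ≤
      degreeMoment n (P n) (K n) (p n) d r := by
  have hs : ∀ᶠ n : ℕ in atTop, ((r : ℝ) + 1) * ((K n : ℝ) ^ 2 / P n) < 1 := by
    have := hR.tendsto_sigma.const_mul ((r : ℝ) + 1)
    rw [mul_zero] at this
    exact this.eventually_lt_const one_pos
  have hq : ∀ᶠ n : ℕ in atTop, (r : ℝ) * (p n * ((K n : ℝ) ^ 2 / P n)) < 1 / 2 := by
    have := hR.tendsto_edge.const_mul (r : ℝ)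
    rw [mul_zero] at this
    exact this.eventually_lt_const (by norm_num)
  filter_upwards [hR.eventually_basic, hs, hq,
    (hR.tendsto_exp_sq_sigma r).eventually_lt_const one_lt_two] with n ⟨h1, h2, h3, h4⟩ hs hq he
  have hl := hR.load_nonneg n
  have hp0 := hR.p_nonneg n
  set σ := (K n : ℝ) ^ 2 / P n with hσ
  have hσ0 : 0 ≤ σ := by positivity
  have hn : (0 : ℝ) < n := by exact_mod_cast h4
  set q := p n * σ with hqdef
  have hq0 : 0 ≤ q := by positivity
  set L := load n (K n) (P n) (p n) with hL
  have hLq : L = n * q := rfl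
  clear_value L
  have hpow : Real.exp (-L) ^ r * Real.exp (-(2 * (r : ℝ) ^ 2 * (L * q))) ≤ (1 - r * q) ^ n := by
    have := pow_le_pow_left₀ (Real.exp_pos _).le (exp_neg_le_one_sub hq.le) n
    rw [← Real.exp_nat_mul] at this
    rw [← Real.exp_nat_mul, ← Real.exp_add]
    refine le_trans (le_of_eq ?_) this
    congr 1
    rw [hLq]
    ring
  have hterm : ∀ A ∈ (Finset.univ : Finset (Fin n)).powersetCard r,
      (2 - Real.exp ((r : ℝ) ^ 2 * σ)) * ((((n - (r + r * d)).choose d : ℕ) : ℝ) ^ r *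
        ((Real.exp (-L) ^ r * Real.exp (-(2 * (r : ℝ) ^ 2 * (L * q)))) *
          ((q * (1 - ((r : ℝ) + 1) * σ)) ^ d) ^ r)) ≤
      netMean (K n) (p n) fun (S : Fin n → Finset (Fin (P n))) G =>
        if ∀ i ∈ A, (nbrs S G i).card = d then 1 else 0 := by
    intro A hA
    have hAr := (Finset.mem_powersetCard.1 hA).2
    have h5 := le_netMean_separated (n := n) h1 hp0 (hR.p_le_one n) h3 d A (by rw [hAr]; exact hs.le)
      (by rw [hAr]; linarith)
    rw [hAr, Nat.sub_sub] at h5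
    refine le_trans ?_ (h5.trans (netMean_mono hp0 (hR.p_le_one n) fun S G hS => ?_))
    · have : 0 ≤ 2 - Real.exp ((r : ℝ) ^ 2 * σ) := by linarith
      have : 0 ≤ 1 - ((r : ℝ) + 1) * σ := by linarith
      gcongr
    · by_cases hA0 : excess (K n) A S = 0
      · rw [if_pos hA0, one_mul]
        exact separated_le hS hA0 G
      · rw [if_neg hA0, zero_mul]
        split_ifs <;> norm_num
  have := Finset.card_nsmul_le_sum _ _ _ hterm
  rw [Finset.card_powersetCard, Finset.card_univ, Fintype.card_fin, nsmul_eq_mul] at this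
  refine le_trans (le_of_eq ?_) this
  generalize Real.exp (-L) = x1
  generalize Real.exp (-(2 * (r : ℝ) ^ 2 * (L * q))) = x2
  generalize Real.exp ((r : ℝ) ^ 2 * σ) = x3
  have hqL : q = L / n := by rw [hLq]; field_simp
  clear_value q
  subst hqL
  rw [← pow_mul (_ * _) d r, mul_pow (L / n), div_pow, mul_pow, mul_pow, div_pow, ← pow_mul,
    ← pow_mul]
  field_simp

lemma tendsto_degreeMoment (hR : Regime d K P p μ) (r : ℕ) :
    Tendsto (fun n : ℕ => degreeMoment n (P n) (K n) (p n) d r) atTop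
      (𝓝 ((μ / (d ! : ℝ)) ^ r / (r ! : ℝ))) := by
  have hup := ((hR.tendsto_overlapping r).add (hR.tendsto_few_neighbours r (r * d) le_rfl)).add
    ((((hR.load_exp.div_const (d ! : ℝ)).pow r).div_const (r ! : ℝ)).mul
      ((Real.continuous_exp.tendsto _).comp (hR.tendsto_error r (r * d))))
  have hsq : Tendsto (fun n : ℕ => load n (K n) (P n) (p n) * (p n * ((K n : ℝ) ^ 2 / P n))) atTop
      (𝓝 0) := by
    refine squeeze_zero (fun n => ?_) (fun n => ?_) hR.tendsto_load_mul_sigma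
    · have := hR.load_nonneg n
      have := hR.p_nonneg n
      positivity
    · refine mul_le_mul_of_nonneg_left ?_ (hR.load_nonneg n)
      exact mul_le_of_le_one_left (by positivity) (hR.p_le_one n)
  have hlow := (((((tendsto_choose_div_pow r).mul ((hR.tendsto_exp_sq_sigma r).const_sub 2)).mul
    ((tendsto_choose_sub_div_pow (r + r * d) d).pow r)).mul
    (((hR.tendsto_sigma.const_mul ((r : ℝ) + 1)).const_sub 1).pow (d * r))).mul
    (hR.load_exp.pow r)).mul
    ((Real.continuous_exp.tendsto _).comp (hsq.const_mul (2 * (r : ℝ) ^ 2)).neg)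
  simp only [Function.comp_def] at hup hlow
  refine tendsto_of_tendsto_of_tendsto_of_le_of_le' ?_ ?_ (hR.eventually_le_degreeMoment r)
    (hR.eventually_degreeMoment_le r)
  · convert hlow using 2
    rw [mul_zero, sub_zero, one_pow, mul_zero, neg_zero, Real.exp_zero, div_pow, div_pow]
    norm_num
    field_simp
  · convert hup using 2
    rw [Real.exp_zero]
    ring

/-- The probability that no node has degree `d` has the Poisson limit. -/
lemma tendsto_no_degree (hR : Regime d K P p μ) :
    Tendsto (fun n : ℕ => netMean (K n) (p n) fun (S : Fin n → Finset (Fin (P n))) G =>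
      if ∀ i, (nbrs S G i).card ≠ d then 1 else 0) atTop (𝓝 (Real.exp (-(μ / (d ! : ℝ))))) := by
  set lam := μ / (d ! : ℝ) with hlam
  have hpart : ∀ J : ℕ, Tendsto (fun n : ℕ => ∑ r ∈ Finset.range (J + 1),
      (-1) ^ r * degreeMoment n (P n) (K n) (p n) d r) atTop
      (𝓝 (∑ r ∈ Finset.range (J + 1), (-lam) ^ r / (r ! : ℝ))) := by
    intro J
    refine tendsto_finsetSum _ fun r _ => ?_
    have := (hR.tendsto_degreeMoment r).const_mul ((-1) ^ r)
    rwa [← mul_div_assoc, ← mul_pow, neg_one_mul] at this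
  have hexp : Tendsto (fun J : ℕ => ∑ r ∈ Finset.range (J + 1), (-lam) ^ r / (r ! : ℝ)) atTop
      (𝓝 (Real.exp (-lam))) := by
    have := (NormedSpace.expSeries_div_hasSum_exp (-lam)).tendsto_sum_nat
    rw [← Real.exp_eq_exp_ℝ] at this
    exact this.comp (tendsto_add_atTop_nat 1)
  refine tendsto_order.2 ⟨fun a ha => ?_, fun a ha => ?_⟩
  · obtain ⟨J₀, hJ₀⟩ := eventually_atTop.1 (hexp.eventually_const_lt ha)
    have hJ := hJ₀ (2 * J₀ + 1) (by omega)
    filter_upwards [(hpart (2 * J₀ + 1)).eventually_const_lt hJ] with n hn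
    exact hn.trans_le ((bonferroni (hR.p_nonneg n) (hR.p_le_one n) d _).2 ⟨J₀, rfl⟩)
  · obtain ⟨J₀, hJ₀⟩ := eventually_atTop.1 (hexp.eventually_lt_const ha)
    have hJ := hJ₀ (2 * J₀) (by omega)
    filter_upwards [(hpart (2 * J₀)).eventually_lt_const hJ] with n hn
    exact ((bonferroni (hR.p_nonneg n) (hR.p_le_one n) d _).1 (even_two_mul J₀)).trans_lt hn

end Regime

/-! ### Sets of at most `n ^ (1/8)` nodes -/

/-- The tails of the exponential series are small. -/
lemma exists_sum_pow_div_factorial_lt (x : ℝ) {ε : ℝ} (hε : 0 < ε) :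
    ∃ R : ℕ, ∀ m, ∑ r ∈ Finset.Icc R m, x ^ r / (r ! : ℝ) < ε := by
  obtain ⟨s, hs⟩ := (Real.summable_pow_div_factorial x).vanishing (Iio_mem_nhds hε)
  refine ⟨s.sup id + 1, fun m => hs _ (Finset.disjoint_left.2 fun r hr hrs => ?_)⟩
  have h1 : r ≤ s.sup id := Finset.le_sup (f := id) hrs
  have h2 := (Finset.mem_Icc.1 hr).1
  omega

namespace Regime
variable {d : ℕ} {K P : ℕ → ℕ} {p : ℕ → ℝ} {μ : ℝ}

/-- Sets of `r` nodes with at most `d` outside neighbours, where `r` may grow with `n`. -/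
lemma eventually_sum_boundary_le (hR : Regime d K P p μ) :
    ∀ᶠ n : ℕ in atTop, ∀ r : ℕ, 1 ≤ r → (r : ℝ) ≤ (n : ℝ) ^ (1 / 8 : ℝ) →
      ∑ A ∈ (Finset.univ : Finset (Fin n)).powersetCard r,
        netMean (K n) (p n) (fun (S : Fin n → Finset (Fin (P n))) G =>
          if (boundary A S G).card ≤ d then 1 else 0) ≤
        (d ! : ℝ) * (((μ + 1) * Real.exp 3) ^ r / (r ! : ℝ)) := by
  have hC := (hR.tendsto_load_exp_shift 1).eventually_le_const
    (show μ * 1 ^ d < μ + 1 by rw [one_pow]; linarith)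
  have hq : ∀ᶠ n : ℕ in atTop, (n : ℝ) ^ (1 / 8 : ℝ) * (p n * ((K n : ℝ) ^ 2 / P n)) +
      d * (p n * ((K n : ℝ) ^ 2 / P n)) +
      load n (K n) (P n) (p n) * ((K n : ℝ) ^ 2 / P n) < 1 := by
    have := (hR.tendsto_rpow_mul_edge.add (hR.tendsto_edge.const_mul (d : ℝ))).add
      hR.tendsto_load_mul_sigma
    rw [mul_zero, add_zero, add_zero] at this
    exact this.eventually_lt_const one_pos
  filter_upwards [hR.eventually_basic, hC, hq, hR.tendsto_overlap.eventually_lt_const one_pos]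
    with n ⟨h1, h2, h3, h4⟩ hC hq hz r hr hrn
  have hl := hR.load_nonneg n
  have hp0 := hR.p_nonneg n
  have hz1 := hR.one_le_exp_load n
  have hr' : (1 : ℝ) ≤ r := by exact_mod_cast hr
  have hM : ∀ A : Finset (Fin n), A.card = r → keyMean (K n)
      (fun S : Fin n → Finset (Fin (P n)) => (1 : ℝ) *
        Real.exp (load n (K n) (P n) (p n) / K n) ^ excess (K n) A S) ≤ Real.exp r := by
    intro A hA
    have := keyMean_pow_excess_le (n := n) h1 A hz1
    rw [hA] at this
    simp only [one_mul]
    refine this.trans (Real.exp_le_exp.2 ?_)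
    calc (Real.exp (load n (K n) (P n) (p n) / K n) - 1) * ((r : ℝ) ^ 2 * ((K n : ℝ) ^ 2 / P n))
        = r * ((Real.exp (load n (K n) (P n) (p n) / K n) - 1) *
            (r * ((K n : ℝ) ^ 2 / P n))) := by ring
      _ ≤ r * ((Real.exp (load n (K n) (P n) (p n) / K n) - 1) *
            ((n : ℝ) ^ (1 / 8 : ℝ) * ((K n : ℝ) ^ 2 / P n))) := by
          have : 0 ≤ Real.exp (load n (K n) (P n) (p n) / K n) - 1 := by linarith
          gcongr
      _ ≤ r * 1 := by gcongr
      _ = r := mul_one _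
  have hb := sum_boundary_le h1 h2 hp0 (hR.p_le_one n) h3 r d
    (fun A S => 1) (fun A S S' hS => rfl) (fun A S => zero_le_one) hM
  simp only [one_mul] at hb
  refine hb.trans ?_
  set l := load n (K n) (P n) (p n) with hldef
  set σ := (K n : ℝ) ^ 2 / P n with hσ
  have hσ0 : 0 ≤ σ := by positivity
  have hl1 : (1 : ℝ) ≤ (1 + l) ^ d := one_le_pow₀ (by linarith)
  have hE : (r + d) * (p n * σ) + l * σ ≤ 1 := by
    have : r * (p n * σ) ≤ (n : ℝ) ^ (1 / 8 : ℝ) * (p n * σ) := by gcongr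
    linarith
  have hpow : (1 + r * l) ^ d ≤ (r : ℝ) ^ d * ((1 + l) ^ d) ^ r := by
    calc (1 + r * l) ^ d ≤ (r * (1 + l)) ^ d := by gcongr; linarith
      _ = (r : ℝ) ^ d * ((1 + l) ^ d) ^ 1 := by rw [mul_pow, pow_one]
      _ ≤ _ := by gcongr
  have hrd : (r : ℝ) ^ d ≤ d ! * Real.exp r := by
    have := Real.pow_div_factorial_le_exp (r : ℝ) (by positivity) d
    rwa [div_le_iff₀ (by positivity), mul_comm] at this
  have hC0 : 0 ≤ (n : ℝ) * Real.exp (-l) * (1 + 1 * l) ^ d := by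
    rw [one_mul]; positivity
  calc ((n.choose r : ℕ) : ℝ) * ((1 + r * l) ^ d *
        Real.exp (-(r * l) + r * ((r + d) * (p n * σ) + l * σ)) * Real.exp r)
      ≤ (n : ℝ) ^ r / (r ! : ℝ) * ((d ! * Real.exp r) * ((1 + l) ^ d) ^ r *
        Real.exp (-(r * l) + r * 1) * Real.exp r) := by
        have e1 := Nat.choose_le_pow_div (α := ℝ) r n
        have e2 := hpow.trans (mul_le_mul_of_nonneg_right hrd (by positivity))
        gcongr
    _ = d ! * ((n * Real.exp (-l) * (1 + 1 * l) ^ d * Real.exp 3) ^ r / (r ! : ℝ)) := by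
        have e3 : Real.exp (-(r * l) + r * 1) = (Real.exp (-l) * Real.exp 1) ^ r := by
          rw [← Real.exp_add, ← Real.exp_nat_mul]; congr 1; ring
        have e4 : Real.exp r = Real.exp 1 ^ r := (Real.exp_one_pow r).symm
        have e5 : Real.exp 3 = Real.exp 1 ^ 3 := by rw [← Real.exp_nat_mul]; norm_num
        rw [e3, e4, e5, one_mul]
        ring
    _ ≤ _ := by gcongr

lemma eventually_sum_moderate_le (hR : Regime d K P p μ) {ε : ℝ} (hε : 0 < ε) :
    ∃ R : ℕ, ∀ᶠ n : ℕ in atTop, ∑ r ∈ Finset.Icc R ⌊(n : ℝ) ^ (1 / 8 : ℝ)⌋₊,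
      ∑ A ∈ (Finset.univ : Finset (Fin n)).powersetCard r,
        netMean (K n) (p n) (fun (S : Fin n → Finset (Fin (P n))) G =>
          if (boundary A S G).card ≤ d then 1 else 0) ≤ ε := by
  obtain ⟨R, hR'⟩ := exists_sum_pow_div_factorial_lt ((μ + 1) * Real.exp 3)
    (show 0 < ε / (d ! : ℝ) by positivity)
  -- starting at `R + 1` excludes the empty set, which has no boundary
  refine ⟨R + 1, ?_⟩
  have hμ : 0 ≤ μ := ge_of_tendsto' hR.load_exp fun n => by
    have := hR.load_nonneg n
    positivity
  filter_upwards [hR.eventually_sum_boundary_le] with n hn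
  calc _ ≤ ∑ r ∈ Finset.Icc (R + 1) ⌊(n : ℝ) ^ (1 / 8 : ℝ)⌋₊,
        (d ! : ℝ) * (((μ + 1) * Real.exp 3) ^ r / (r ! : ℝ)) := by
        refine Finset.sum_le_sum fun r hr => ?_
        obtain ⟨h1, h2⟩ := Finset.mem_Icc.1 hr
        exact hn r (by omega) ((Nat.le_floor_iff (by positivity)).1 h2)
    _ ≤ (d ! : ℝ) * ∑ r ∈ Finset.Icc R ⌊(n : ℝ) ^ (1 / 8 : ℝ)⌋₊,
        (((μ + 1) * Real.exp 3) ^ r / (r ! : ℝ)) := by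
        rw [← Finset.mul_sum]
        refine mul_le_mul_of_nonneg_left ?_ (by positivity)
        exact Finset.sum_le_sum_of_subset_of_nonneg
          (Finset.Icc_subset_Icc_left (Nat.le_succ R)) fun r _ _ => by positivity
    _ ≤ d ! * (ε / (d ! : ℝ)) := by
        gcongr
        exact (hR' _).le
    _ = ε := by field_simp

end Regime

/-! ### Sets of more than `n ^ (1/8)` nodes -/

lemma choose_le_exp {n r : ℕ} (hn : 0 < n) (hr : 0 < r) :
    ((n.choose r : ℕ) : ℝ) ≤ Real.exp (r * (1 + Real.log n - Real.log r)) := by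
  have hn' : (0 : ℝ) < n := by exact_mod_cast hn
  have hr' : (0 : ℝ) < r := by exact_mod_cast hr
  have h1 := Real.pow_div_factorial_le_exp (r : ℝ) hr'.le r
  calc ((n.choose r : ℕ) : ℝ) ≤ (n : ℝ) ^ r / (r ! : ℝ) := Nat.choose_le_pow_div r n
    _ = ((n : ℝ) / r) ^ r * ((r : ℝ) ^ r / (r ! : ℝ)) := by rw [div_pow]; field_simp
    _ ≤ ((n : ℝ) / r) ^ r * Real.exp r := by gcongr
    _ = _ := by
        rw [Real.exp_nat_mul, Real.exp_sub, Real.exp_add, Real.exp_log hn', Real.exp_log hr',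
          ← Real.exp_one_pow]
        ring

/-- The power of the probability of missing a set of `r` nodes, if these nodes have at most a
bounded expected number of links to a given node. -/
lemma pow_miss_le_of_small {n r d : ℕ} {F q η C : ℝ} (hn : 0 < n) (hr : 0 < r) (hq : 0 ≤ q)
    (hF0 : 0 ≤ F) (hη0 : 0 ≤ η) (hF : F ≤ Real.exp (-(31 / 32 * (q * r))) + η)
    (hη : η * n ≤ C * r) (hrq : q * r ≤ 10) :
    F ^ (n - r - d) ≤
      Real.exp (r * (-(31 / 32 * (n * q)) + (10 * (1 + d) + C * Real.exp 10))) := by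
  have hn' : (0 : ℝ) < n := by exact_mod_cast hn
  have hr' : (1 : ℝ) ≤ r := by exact_mod_cast hr
  have hF1 : F ≤ Real.exp (-(31 / 32 * (q * r)) + η * Real.exp 10) := by
    have h1 : η ≤ Real.exp (-(31 / 32 * (q * r))) * (η * Real.exp 10) := by
      rw [mul_left_comm, ← Real.exp_add]
      refine le_mul_of_one_le_right hη0 (Real.one_le_exp ?_)
      have : 0 ≤ q * r := by positivity
      linarith
    calc F ≤ Real.exp (-(31 / 32 * (q * r))) * (η * Real.exp 10 + 1) := by linarith
      _ ≤ Real.exp (-(31 / 32 * (q * r))) * Real.exp (η * Real.exp 10) := by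
          gcongr; exact Real.add_one_le_exp _
      _ = _ := (Real.exp_add _ _).symm
  refine (pow_le_pow_left₀ hF0 hF1 _).trans ?_
  rw [← Real.exp_nat_mul]
  refine Real.exp_le_exp.2 ?_
  set N := n - r - d with hN
  have hN1 : (N : ℝ) ≤ n := by exact_mod_cast (by omega : N ≤ n)
  have hN2 : (n : ℝ) - r - d ≤ N := by
    have : n ≤ N + r + d := by omega
    have : (n : ℝ) ≤ N + r + d := by exact_mod_cast this
    linarith
  have h2 : N * (η * Real.exp 10) ≤ C * r * Real.exp 10 := by
    calc N * (η * Real.exp 10) ≤ n * (η * Real.exp 10) := by gcongr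
      _ = η * n * Real.exp 10 := by ring
      _ ≤ _ := by gcongr
  have h3 : q * r * (n - r - d) ≤ q * r * N := by gcongr
  have h4 : q * r * (r + d) ≤ 10 * (r + r * d) := by
    have : (d : ℝ) ≤ r * d := le_mul_of_one_le_left (by positivity) hr'
    gcongr
  have h5 : (0 : ℝ) ≤ r + r * d := by positivity
  nlinarith

/-- The power of the probability of missing at most half of the nodes, if this probability is
small. -/
lemma pow_miss_le_of_large {n r d : ℕ} {F : ℝ} (hF0 : 0 ≤ F) (hF : F ≤ Real.exp (-9))
    (hr : 2 * r ≤ n) : F ^ (n - r - d) ≤ Real.exp (9 * d - 9 / 2 * n) := by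
  refine (pow_le_pow_left₀ hF0 hF _).trans ?_
  rw [← Real.exp_nat_mul]
  refine Real.exp_le_exp.2 ?_
  have h1 : n ≤ 2 * (n - r - d) + 2 * d := by omega
  have h2 : (n : ℝ) ≤ 2 * (n - r - d : ℕ) + 2 * d := by exact_mod_cast h1
  linarith

/-- The number of key rings up to which overlaps are controlled, a small multiple of `P / K`. The
constant `exp (-384)` makes `6 ≤ ε * log δ⁻¹` in `keyMean_not_smallOverlap_le` for `ε = 1 / 64`. -/
noncomputable def overlapRange (K P : ℕ) : ℕ := ⌊Real.exp (-384) * (P / K : ℝ)⌋₊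

lemma overlapRange_mul_le {K P : ℕ} (hK : 0 < K) :
    (overlapRange K P : ℝ) * K ≤ Real.exp (-384) * P := by
  have hK' : (0 : ℝ) < K := by exact_mod_cast hK
  have := Nat.floor_le (show 0 ≤ Real.exp (-384) * (P / K : ℝ) by positivity)
  calc (overlapRange K P : ℝ) * K ≤ Real.exp (-384) * (P / K : ℝ) * K := by
        gcongr; exact this
    _ = _ := by field_simp

lemma lt_overlapRange_add_one (K P : ℕ) :
    Real.exp (-384) * (P / K : ℝ) < overlapRange K P + 1 := Nat.lt_floor_add_one _

namespace Regime
variable {d : ℕ} {K P : ℕ → ℕ} {p : ℕ → ℝ} {μ : ℝ}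

open Classical in
lemma tendsto_not_smallOverlap (hR : Regime d K P p μ) :
    Tendsto (fun n : ℕ => keyMean (K n) fun S : Fin n → Finset (Fin (P n)) =>
      if SmallOverlap (K n) (overlapRange (K n) (P n)) (1 / 64) Finset.univ S then (0 : ℝ) else 1)
      atTop (𝓝 0) := by
  obtain ⟨c, hc, hcP⟩ := hR.le_P
  have hlim : Tendsto (fun n : ℕ => Real.exp 1 * ((K n : ℝ) / c) * Real.exp (-(2 * K n))) atTop
      (𝓝 0) := by
    have h1 := (Real.tendsto_pow_mul_exp_neg_atTop_nhds_zero 1).comp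
      (hR.tendsto_K.const_mul_atTop (zero_lt_two' ℝ))
    have h2 := h1.const_mul (Real.exp 1 / (2 * c))
    rw [mul_zero] at h2
    refine h2.congr fun n => ?_
    simp only [Function.comp_apply, pow_one]
    field_simp
  have hlim2 := hlim.const_mul 2
  rw [mul_zero] at hlim2
  refine squeeze_zero' (Eventually.of_forall fun n => keyMean_nonneg fun S _ => ?_) ?_ hlim2
  · split_ifs <;> norm_num
  · filter_upwards [hR.eventually_basic, hcP, hR.tendsto_K.eventually_ge_atTop 128,
      hlim.eventually_le_const (show (0 : ℝ) < 1 / 2 by norm_num)] with n ⟨h1, h2, h3, h4⟩ h5 h6 h7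
    refine keyMean_not_smallOverlap_le h1 h2 hc h5 (Real.exp_pos (-384)) ?_ (by norm_num) ?_
      (by linarith) (overlapRange_mul_le h2) h7
    · exact Real.exp_le_one_iff.2 (by norm_num)
    · rw [← Real.exp_neg, Real.log_exp]; norm_num

/-- A uniform bound for the probability that a node has no link to any of `r` nodes with small
overlaps. The error `η` is `exp (-c * K)` for a constant `c`, and zero unless `r` exceeds
`overlapRange`. -/
lemma eventually_missProb_le (hR : Regime d K P p μ) :
    ∃ C : ℝ, ∀ κ : ℝ, 0 < κ → ∀ᶠ n : ℕ in atTop, ∀ r : ℕ, 0 < r →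
      ∃ η : ℝ, 0 ≤ η ∧ η ≤ κ ∧ η * n ≤ C * r ∧
        ∀ (A : Finset (Fin n)) (S : Fin n → Finset (Fin (P n))), A.card = r →
          (∀ i, (S i).card = K n) →
          SmallOverlap (K n) (overlapRange (K n) (P n)) (1 / 64) A S →
          missProb (K n) (p n) A S ≤
            Real.exp (-(31 / 32 * (p n * ((K n : ℝ) ^ 2 / P n) * r))) + η := by
  obtain ⟨c, hc, hcP⟩ := hR.le_P
  set δ := Real.exp (-384) with hδ
  have hδ0 : 0 < δ := Real.exp_pos _
  refine ⟨4 / (δ ^ 2 * c), fun κ hκ => ?_⟩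
  have hκ' : ∀ᶠ n in atTop, Real.exp (-(δ / 4 * K n)) < κ := by
    refine Tendsto.eventually_lt_const hκ ?_
    exact Real.tendsto_exp_neg_atTop_nhds_zero.comp
      (hR.tendsto_K.const_mul_atTop (by positivity))
  filter_upwards [hR.eventually_basic, hcP, hκ', hR.tendsto_K.eventually_ge_atTop (2 / δ),
    hR.tendsto_sigma.eventually_le_const (show (0 : ℝ) < 1 / 64 by norm_num)]
    with n ⟨h1, h2, h3, h4⟩ h5 h6 h7 h8 r hr
  have hr' : (0 : ℝ) < r := by exact_mod_cast hr
  have hK' : (0 : ℝ) < K n := by exact_mod_cast h2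
  have hP' : (0 : ℝ) < P n := by exact_mod_cast h2.trans_le h1
  have hn' : (0 : ℝ) < n := by exact_mod_cast h4
  have hb0 := lt_overlapRange_add_one (K n) (P n)
  have hmiss := fun (A : Finset (Fin n)) (S : Fin n → Finset (Fin (P n))) (hA : A.card = r) hS hAS =>
    missProb_le_of_smallOverlap (A := A) (S := S) (b₀ := overlapRange (K n) (P n)) h1
      (hR.p_nonneg n) (hR.p_le_one n) (by norm_num : (1 / 64 : ℝ) ≤ 1 / 4) (by norm_num) h8 hS hAS
  rw [← hδ] at hb0
  by_cases hbr : overlapRange (K n) (P n) < r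
  · refine ⟨Real.exp (-(δ / 4 * K n)), by positivity, h6.le, ?_, fun A S hA hS hAS => ?_⟩
    · -- as `r` exceeds `overlapRange`, the rings have at least of order `n / r` keys
      have hKr : δ * (c * n) ≤ r * K n := by
        have e1 : δ * (P n / K n : ℝ) ≤ r := by
          refine hb0.le.trans ?_
          exact_mod_cast hbr
        calc δ * (c * n) ≤ δ * P n := by gcongr
          _ = δ * (P n / K n : ℝ) * K n := by field_simp
          _ ≤ _ := by gcongr
      have e2 : Real.exp (-(δ / 4 * K n)) ≤ (δ / 4 * K n)⁻¹ := by
        rw [Real.exp_neg]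
        gcongr
        linarith [Real.add_one_le_exp (δ / 4 * K n)]
      calc Real.exp (-(δ / 4 * K n)) * n ≤ (δ / 4 * K n)⁻¹ * n := by gcongr
        _ = 4 / (δ ^ 2 * c) * (δ * (c * n) / K n) := by field_simp
        _ ≤ 4 / (δ ^ 2 * c) * (r * K n / K n) := by gcongr
        _ = _ := by field_simp
    · refine (hmiss A S hA hS hAS).trans ?_
      rw [hA, if_pos hbr]
      refine add_le_add (le_of_eq (by norm_num [mul_assoc])) (Real.exp_le_exp.2 ?_)
      have e3 : δ * K n - (K n : ℝ) ^ 2 / P n ≤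
          overlapRange (K n) (P n) * ((K n : ℝ) ^ 2 / P n) := by
        have : δ * K n = δ * (P n / K n : ℝ) * ((K n : ℝ) ^ 2 / P n) := by field_simp
        rw [this]
        nlinarith [show 0 ≤ (K n : ℝ) ^ 2 / P n by positivity]
      have e4 : 2 ≤ δ * K n := by rwa [div_le_iff₀' hδ0] at h7
      linarith
  · refine ⟨0, le_rfl, hκ.le, by rw [zero_mul]; positivity, fun A S hA hS hAS => ?_⟩
    refine (hmiss A S hA hS hAS).trans ?_
    rw [hA, if_neg hbr]
    exact add_le_add (le_of_eq (by norm_num [mul_assoc])) le_rfl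

/-- The number of sets of `r` nodes times the power of the probability of missing such a set is
negligible. -/
lemma eventually_choose_mul_pow_le (hR : Regime d K P p μ) (C : ℝ) :
    ∃ κ : ℝ, 0 < κ ∧ ∀ᶠ n : ℕ in atTop, ∀ (r : ℕ) (F η : ℝ), (n : ℝ) ^ (1 / 8 : ℝ) ≤ r →
      2 * r ≤ n → 0 ≤ F → 0 ≤ η → η ≤ κ → η * n ≤ C * r →
      F ≤ Real.exp (-(31 / 32 * (p n * ((K n : ℝ) ^ 2 / P n) * r))) + η →
      ((n.choose r : ℕ) : ℝ) * F ^ (n - r - d) ≤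
        Real.exp (9 * d) * Real.exp (-(n : ℝ) ^ (1 / 8 : ℝ)) := by
  refine ⟨Real.exp (-9) - Real.exp (-(310 / 32)), ?_, ?_⟩
  · exact sub_pos.2 (Real.exp_lt_exp.2 (by norm_num))
  have hLlog : ∀ᶠ n : ℕ in atTop, Real.log n ≤ 33 / 32 * load n (K n) (P n) (p n) := by
    filter_upwards [hR.load_log.eventually_const_le (show (32 / 33 : ℝ) < 1 by norm_num),
      tendsto_log_natCast.eventually_gt_atTop 0] with n h1 h2
    rw [le_div_iff₀ h2] at h1
    linarith
  filter_upwards [hLlog, eventually_gt_atTop 0, hR.tendsto_load.eventually_ge_atTop 32,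
    hR.tendsto_load.eventually_ge_atTop (32 * (1 + (10 * (1 + d) + C * Real.exp 10)))]
    with n hlog hn hL32 hLC r F η hr hrn hF0 hη0 hηκ hηn hF
  have hn' : (0 : ℝ) < n := by exact_mod_cast hn
  have hr' : (0 : ℝ) < r := (Real.rpow_pos_of_pos hn' _).trans_le hr
  have hr0 : 0 < r := by exact_mod_cast hr'
  have hp0 := hR.p_nonneg n
  have hlq : load n (K n) (P n) (p n) = n * (p n * ((K n : ℝ) ^ 2 / P n)) := rfl
  set q := p n * ((K n : ℝ) ^ 2 / P n) with hq
  have hq0 : 0 ≤ q := by positivity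
  set l := load n (K n) (P n) (p n) with hl
  -- if `q * r ≤ 10`, then `r ≥ n ^ (1/8)` saves a factor `n ^ (-r/8)` in the number of sets, more than
  -- is lost by the constant `31/32`; otherwise the bound `2 ^ n` for the number of sets suffices
  rcases le_or_gt (q * r) 10 with hqr | hqr
  · have h1 := pow_miss_le_of_small (d := d) hn hr0 hq0 hF0 hη0 hF hηn hqr
    rw [← hlq] at h1
    have hlogr : 1 / 8 * Real.log n ≤ Real.log r := by
      rw [← Real.log_rpow hn']
      exact Real.log_le_log (by positivity) hr
    have hlr : 32 * r ≤ l * r := by gcongr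
    calc ((n.choose r : ℕ) : ℝ) * F ^ (n - r - d)
        ≤ Real.exp (r * (1 + Real.log n - Real.log r)) *
          Real.exp (r * (-(31 / 32 * l) + (10 * (1 + d) + C * Real.exp 10))) := by
          gcongr
          exact choose_le_exp hn hr0
      _ ≤ Real.exp (-r) := by
          rw [← Real.exp_add, ← mul_add]
          refine Real.exp_le_exp.2 ?_
          rw [← mul_neg_one (r : ℝ)]
          refine mul_le_mul_of_nonneg_left ?_ hr'.le
          linarith
      _ ≤ Real.exp (-(n : ℝ) ^ (1 / 8 : ℝ)) := Real.exp_le_exp.2 (by linarith)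
      _ ≤ _ := le_mul_of_one_le_left (by positivity) (Real.one_le_exp (by positivity))
  · have hF9 : F ≤ Real.exp (-9) := by
      have : Real.exp (-(31 / 32 * (q * r))) ≤ Real.exp (-(310 / 32)) :=
        Real.exp_le_exp.2 (by linarith)
      linarith
    have hch : ((n.choose r : ℕ) : ℝ) ≤ Real.exp n := by
      calc ((n.choose r : ℕ) : ℝ) ≤ ((2 ^ n : ℕ) : ℝ) := by exact_mod_cast Nat.choose_le_two_pow n r
        _ = (2 : ℝ) ^ n := by push_cast; rfl
        _ ≤ Real.exp 1 ^ n := by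
            gcongr
            linarith [Real.add_one_le_exp (1 : ℝ)]
        _ = _ := Real.exp_one_pow n
    have hrn' : 2 * (r : ℝ) ≤ n := by exact_mod_cast hrn
    calc ((n.choose r : ℕ) : ℝ) * F ^ (n - r - d)
        ≤ Real.exp n * Real.exp (9 * d - 9 / 2 * n) := by
          gcongr
          exact pow_miss_le_of_large hF0 hF9 hrn
      _ ≤ _ := by
          rw [← Real.exp_add, ← Real.exp_add]
          refine Real.exp_le_exp.2 ?_
          linarith

open Classical in
/-- Sets of at least `n ^ (1/8)` nodes with small overlaps and few outside neighbours do not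
occur. -/
lemma tendsto_sum_large (hR : Regime d K P p μ) :
    Tendsto (fun n : ℕ => ∑ r ∈ Finset.Ioc ⌊(n : ℝ) ^ (1 / 8 : ℝ)⌋₊ (n / 2),
      ∑ A ∈ (Finset.univ : Finset (Fin n)).powersetCard r,
        netMean (K n) (p n) (fun (S : Fin n → Finset (Fin (P n))) G =>
          (if SmallOverlap (K n) (overlapRange (K n) (P n)) (1 / 64) A S then 1 else 0) *
            if (boundary A S G).card ≤ d then 1 else 0)) atTop (𝓝 0) := by
  obtain ⟨C, hC⟩ := hR.eventually_missProb_le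
  obtain ⟨κ, hκ, hch⟩ := hR.eventually_choose_mul_pow_le C
  have hlim : Tendsto (fun n : ℕ => (n : ℝ) * ((3 * (n : ℝ) ^ 2) ^ d *
      (Real.exp (9 * d) * Real.exp (-(n : ℝ) ^ (1 / 8 : ℝ))))) atTop (𝓝 0) := by
    have h1 := (Real.tendsto_pow_mul_exp_neg_atTop_nhds_zero (8 * (1 + 2 * d))).comp
      ((tendsto_rpow_atTop (show (0 : ℝ) < 1 / 8 by norm_num)).comp tendsto_natCast_atTop_atTop)
    have h2 := h1.const_mul (3 ^ d * Real.exp (9 * d))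
    rw [mul_zero] at h2
    refine h2.congr fun n => ?_
    simp only [Function.comp_apply]
    rw [pow_mul, ← Real.rpow_natCast _ 8, ← Real.rpow_mul (Nat.cast_nonneg n)]
    norm_num
    ring
  refine squeeze_zero' (Eventually.of_forall fun n => Finset.sum_nonneg fun r _ =>
    Finset.sum_nonneg fun A _ => netMean_nonneg (hR.p_nonneg n) (hR.p_le_one n) fun S G _ => ?_) ?_
    hlim
  · split_ifs <;> norm_num
  filter_upwards [hR.eventually_basic, hC κ hκ, hch, hR.load_le_two_log]
    with n ⟨h1, h2, h3, h4⟩ hC hch hlog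
  have hn' : (1 : ℝ) ≤ n := by exact_mod_cast h4
  have hl0 := hR.load_nonneg n
  have hp0 := hR.p_nonneg n
  have hterm : ∀ r ∈ Finset.Ioc ⌊(n : ℝ) ^ (1 / 8 : ℝ)⌋₊ (n / 2),
      ∑ A ∈ (Finset.univ : Finset (Fin n)).powersetCard r,
        netMean (K n) (p n) (fun (S : Fin n → Finset (Fin (P n))) G =>
          (if SmallOverlap (K n) (overlapRange (K n) (P n)) (1 / 64) A S then 1 else 0) *
            if (boundary A S G).card ≤ d then 1 else 0) ≤
        (3 * (n : ℝ) ^ 2) ^ d * (Real.exp (9 * d) * Real.exp (-(n : ℝ) ^ (1 / 8 : ℝ))) := by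
    intro r hr
    obtain ⟨hr1, hr2⟩ := Finset.mem_Ioc.1 hr
    have hr1' : (n : ℝ) ^ (1 / 8 : ℝ) ≤ r := (Nat.lt_of_floor_lt hr1).le
    obtain ⟨η, hη0, hηκ, hηn, hη⟩ := hC r (by omega)
    set F := Real.exp (-(31 / 32 * (p n * ((K n : ℝ) ^ 2 / P n) * r))) + η with hF
    have hF0 : 0 ≤ F := by positivity
    have hr2' : 2 * r ≤ n := by omega
    have hrn : (r : ℝ) ≤ n := by exact_mod_cast (by omega : r ≤ n)
    have hx : 1 + r * (n * (p n * ((K n : ℝ) ^ 2 / P n))) ≤ 3 * (n : ℝ) ^ 2 := by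
      have e1 : load n (K n) (P n) (p n) ≤ 2 * n :=
        hlog.trans (by linarith [Real.log_le_self (show (0 : ℝ) ≤ n by linarith)])
      have e2 : r * load n (K n) (P n) (p n) ≤ n * (2 * n) := by gcongr
      have e3 : load n (K n) (P n) (p n) = n * (p n * ((K n : ℝ) ^ 2 / P n)) := rfl
      rw [← e3]
      nlinarith
    refine (Finset.sum_le_card_nsmul _ _ ((3 * (n : ℝ) ^ 2) ^ d * F ^ (n - r - d))
      fun A hA => ?_).trans ?_
    · have hAr := (Finset.mem_powersetCard.1 hA).2
      refine (netMean_boundary_card_le h1 hp0 (hR.p_le_one n) A d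
        (fun S => if SmallOverlap (K n) (overlapRange (K n) (P n)) (1 / 64) A S then 1 else 0)
        (fun S S' hS => by simp only [smallOverlap_congr hS])
        (fun S => by split_ifs <;> norm_num)).trans ?_
      rw [hAr]
      refine mul_le_mul (pow_le_pow_left₀ (by positivity) hx d) ?_
        (keyMean_nonneg fun S _ => mul_nonneg (by split_ifs <;> norm_num)
          (pow_nonneg (missProb_nonneg hp0 (hR.p_le_one n) A S) _)) (by positivity)
      refine (keyMean_mono (F' := fun _ => F ^ (n - r - d)) fun S hS => ?_).trans_eq
        (keyMean_const h1 _)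
      split_ifs with hAS
      · rw [one_mul]
        exact pow_le_pow_left₀ (missProb_nonneg hp0 (hR.p_le_one n) A S) (hη A S hAr hS hAS) _
      · rw [zero_mul]; positivity
    · rw [Finset.card_powersetCard, Finset.card_univ, Fintype.card_fin, nsmul_eq_mul,
        mul_left_comm]
      exact mul_le_mul_of_nonneg_left (hch r F η hr1' hr2' hF0 hη0 hηκ hηn le_rfl) (by positivity)
  refine (Finset.sum_le_card_nsmul _ _ _ hterm).trans ?_
  rw [Nat.card_Ioc, nsmul_eq_mul]
  refine mul_le_mul_of_nonneg_right ?_ (by positivity)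
  exact_mod_cast (by omega : n / 2 - ⌊(n : ℝ) ^ (1 / 8 : ℝ)⌋₊ ≤ n)

end Regime

/-! ### The limit of the probability of `k`-connectivity -/

lemma one_le_sum_powersetCard {α : Type*} [Fintype α] {s : Finset ℕ} {f : ℕ → Finset α → ℝ}
    (hf : ∀ r A, 0 ≤ f r A) {A : Finset α} (hA : A.card ∈ s) (hA1 : 1 ≤ f A.card A) :
    1 ≤ ∑ r ∈ s, ∑ A ∈ (Finset.univ : Finset α).powersetCard r, f r A :=
  hA1.trans ((Finset.single_le_sum (f := fun B => f A.card B) (fun B _ => hf _ B)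
    (Finset.mem_powersetCard.2 ⟨Finset.subset_univ A, rfl⟩)).trans
      (Finset.single_le_sum (f := fun r => ∑ A ∈ (Finset.univ : Finset α).powersetCard r, f r A)
        (fun r _ => Finset.sum_nonneg fun A _ => hf r A) hA))

open Classical in
/-- If no node has degree `d` and the graph is not `(d + 1)`-connected, then there is a node of
smaller degree, or a set of nodes with at most `d` outside neighbours; in the latter case the key
rings of the set overlap. -/
lemma indicator_no_degree_le {n P K d b₀ R m : ℕ} {ε : ℝ} (hn : d + 1 < n)
    {S : Fin n → Finset (Fin P)} (hS : ∀ i, (S i).card = K) (G : SimpleGraph (Fin n)) :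
    (if ∀ i, (nbrs S G i).card ≠ d then (1 : ℝ) else 0) ≤
      (if IsKConnected (keyGraph S ⊓ G) (d + 1) then 1 else 0) +
        (∑ A ∈ (Finset.univ : Finset (Fin n)).powersetCard 1,
          if (boundary A S G).card < d then 1 else 0) +
        (∑ r ∈ Finset.Ico 1 R, ∑ A ∈ (Finset.univ : Finset (Fin n)).powersetCard r,
          (if excess K A S = 0 then 0 else 1) *
            if (boundary A S G).card ≤ r * d then 1 else 0) +
        (∑ r ∈ Finset.Icc R m, ∑ A ∈ (Finset.univ : Finset (Fin n)).powersetCard r,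
          if (boundary A S G).card ≤ d then 1 else 0) +
        (if SmallOverlap K b₀ ε Finset.univ S then 0 else 1) +
        (∑ r ∈ Finset.Ioc m (n / 2), ∑ A ∈ (Finset.univ : Finset (Fin n)).powersetCard r,
          (if SmallOverlap K b₀ ε A S then 1 else 0) *
            if (boundary A S G).card ≤ d then 1 else 0) := by
  have hite : ∀ (q : Prop) [Decidable q], (0 : ℝ) ≤ if q then 1 else 0 := fun q _ => by
    split_ifs <;> norm_num
  have hite' : ∀ (q : Prop) [Decidable q], (0 : ℝ) ≤ if q then 0 else 1 := fun q _ => by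
    split_ifs <;> norm_num
  have t1 := hite (IsKConnected (keyGraph S ⊓ G) (d + 1))
  have t2 : (0 : ℝ) ≤ ∑ A ∈ (Finset.univ : Finset (Fin n)).powersetCard 1,
      if (boundary A S G).card < d then 1 else 0 := Finset.sum_nonneg fun A _ => hite _
  have f3 : ∀ (r : ℕ) (A : Finset (Fin n)), (0 : ℝ) ≤ (if excess K A S = 0 then 0 else 1) *
      if (boundary A S G).card ≤ r * d then 1 else 0 := fun r A => mul_nonneg (hite' _) (hite _)
  have f4 : ∀ (_ : ℕ) (A : Finset (Fin n)), (0 : ℝ) ≤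
      if (boundary A S G).card ≤ d then 1 else 0 := fun _ A => hite _
  have f6 : ∀ (_ : ℕ) (A : Finset (Fin n)), (0 : ℝ) ≤ (if SmallOverlap K b₀ ε A S then 1 else 0) *
      if (boundary A S G).card ≤ d then 1 else 0 := fun _ A => mul_nonneg (hite _) (hite _)
  have t3 := Finset.sum_nonneg fun r (_ : r ∈ Finset.Ico 1 R) => Finset.sum_nonneg
    fun A (_ : A ∈ (Finset.univ : Finset (Fin n)).powersetCard r) => f3 r A
  have t4 := Finset.sum_nonneg fun r (_ : r ∈ Finset.Icc R m) => Finset.sum_nonneg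
    fun A (_ : A ∈ (Finset.univ : Finset (Fin n)).powersetCard r) => f4 r A
  have t5 := hite' (SmallOverlap K b₀ ε Finset.univ S)
  have t6 := Finset.sum_nonneg fun r (_ : r ∈ Finset.Ioc m (n / 2)) => Finset.sum_nonneg
    fun A (_ : A ∈ (Finset.univ : Finset (Fin n)).powersetCard r) => f6 r A
  by_cases hdeg : ∀ i, (nbrs S G i).card ≠ d
  swap
  · rw [if_neg hdeg]; linarith
  rw [if_pos hdeg]
  by_cases hconn : IsKConnected (keyGraph S ⊓ G) (d + 1)
  · rw [if_pos hconn]; linarith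
  by_cases hlow : ∃ i, (nbrs S G i).card < d
  · obtain ⟨i, hi⟩ := hlow
    have hi1 : ({i} : Finset (Fin n)) ∈ (Finset.univ : Finset (Fin n)).powersetCard 1 :=
      Finset.mem_powersetCard.2 ⟨Finset.subset_univ _, Finset.card_singleton i⟩
    have := Finset.single_le_sum (f := fun A => if (boundary A S G).card < d then (1 : ℝ) else 0)
      (fun A _ => hite _) hi1
    rw [if_pos ((boundary_singleton_card_le i).trans_lt hi)] at this
    linarith
  push Not at hlow
  obtain ⟨A, hA, hAn, hAb⟩ := exists_boundary_card_lt hn hconn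
  have hex : excess K A S ≠ 0 :=
    excess_ne_zero_of_boundary hS (fun i => lt_of_le_of_ne (hlow i) (hdeg i).symm) hA hAb
  have hAb' : (boundary A S G).card ≤ d := Nat.lt_succ_iff.1 hAb
  have hA1 : 1 ≤ A.card := hA.card_pos
  rcases lt_or_ge A.card R with h1 | h1
  · have := one_le_sum_powersetCard f3 (Finset.mem_Ico.2 ⟨hA1, h1⟩)
      (by rw [if_neg hex, if_pos (hAb'.trans (Nat.le_mul_of_pos_left d hA1)), one_mul])
    linarith
  rcases le_or_gt A.card m with h2 | h2
  · have := one_le_sum_powersetCard f4 (Finset.mem_Icc.2 ⟨h1, h2⟩) (by rw [if_pos hAb'])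
    linarith
  by_cases hso : SmallOverlap K b₀ ε Finset.univ S
  · have hsoA : SmallOverlap K b₀ ε A S := fun B _ => hso B (Finset.subset_univ B)
    have := one_le_sum_powersetCard f6 (A := A) (s := Finset.Ioc m (n / 2))
      (Finset.mem_Ioc.2 ⟨h2, by omega⟩)
      (by rw [if_pos hsoA, if_pos hAb', one_mul])
    linarith
  · rw [if_neg hso]; linarith

namespace Regime
variable {d : ℕ} {K P : ℕ → ℕ} {p : ℕ → ℝ} {μ : ℝ}

open Classical in
/-- `(d + 1)`-connectivity is asymptotically equivalent to the absence of nodes of degree `d`. -/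
lemma tendsto_isKConnected (hR : Regime d K P p μ) :
    Tendsto (fun n : ℕ => netMean (K n) (p n) fun (S : Fin n → Finset (Fin (P n))) G =>
      if IsKConnected (keyGraph S ⊓ G) (d + 1) then 1 else 0) atTop
      (𝓝 (Real.exp (-(μ / (d ! : ℝ))))) := by
  have hdiff : Tendsto (fun n : ℕ =>
      (netMean (K n) (p n) fun (S : Fin n → Finset (Fin (P n))) G =>
        if ∀ i, (nbrs S G i).card ≠ d then 1 else 0) -
      netMean (K n) (p n) fun (S : Fin n → Finset (Fin (P n))) G =>
        if IsKConnected (keyGraph S ⊓ G) (d + 1) then 1 else 0) atTop (𝓝 0) := by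
    refine tendsto_order.2 ⟨fun a ha => Eventually.of_forall fun n => ?_, fun a ha => ?_⟩
    · refine ha.trans_le (sub_nonneg.2 ?_)
      refine netMean_mono (hR.p_nonneg n) (hR.p_le_one n) fun S G _ => ?_
      by_cases hc : IsKConnected (keyGraph S ⊓ G) (d + 1)
      · rw [if_pos hc, if_pos fun i => Nat.ne_of_gt (le_card_nbrs_of_isKConnected hc i)]
      · rw [if_neg hc]; split_ifs <;> norm_num
    · obtain ⟨R, hmod⟩ := hR.eventually_sum_moderate_le (half_pos ha)
      have hrest := (((hR.tendsto_few_neighbours 1 d (by rw [one_mul])).add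
        (tendsto_finsetSum (Finset.Ico 1 R) fun r _ => hR.tendsto_overlapping r)).add
        hR.tendsto_not_smallOverlap).add hR.tendsto_sum_large
      simp only [Finset.sum_const_zero, add_zero] at hrest
      filter_upwards [hmod, hrest.eventually_lt_const (half_pos ha), hR.eventually_basic,
        eventually_gt_atTop (d + 1)] with n hmod hrest ⟨h1, _⟩ hn
      have h := netMean_mono (P := P n) (K := K n) (hR.p_nonneg n) (hR.p_le_one n) fun S G hS =>
        indicator_no_degree_le (R := R) (m := ⌊(n : ℝ) ^ (1 / 8 : ℝ)⌋₊)
          (b₀ := overlapRange (K n) (P n)) (ε := 1 / 64) hn hS G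
      have hS : (netMean (K n) (p n) fun (S : Fin n → Finset (Fin (P n))) (_ : SimpleGraph (Fin n)) =>
          if SmallOverlap (K n) (overlapRange (K n) (P n)) (1 / 64) Finset.univ S then (0 : ℝ) else 1) =
          keyMean (K n) fun S : Fin n → Finset (Fin (P n)) =>
            if SmallOverlap (K n) (overlapRange (K n) (P n)) (1 / 64) Finset.univ S
              then (0 : ℝ) else 1 := by
        unfold netMean
        simp only [chanMean_const]
      simp only [netMean_add, netMean_sum] at h
      rw [hS] at h
      linarith
  have := hR.tendsto_no_degree.sub hdiff
  rw [sub_zero] at this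
  refine this.congr fun n => ?_
  rw [sub_sub_cancel]

end Regime

end SecureNetwork

theorem corollary1 (k : ℕ) (hk : 1 ≤ k)
    (K P : ℕ → ℕ) (p : ℕ → unitInterval) (β : ℕ → ℝ) (βstar : ℝ)
    (hP : (fun n : ℕ => (n : ℝ)) =O[atTop] fun n : ℕ => (P n : ℝ))
    (hK : (fun n : ℕ => (K n : ℝ) ^ 2 / (P n : ℝ)) =o[atTop] fun n : ℕ => 1 / Real.log (n : ℝ))
    (hβ : ∀ᶠ n : ℕ in atTop, (p n : ℝ) * ((K n : ℝ) ^ 2 / (P n : ℝ)) =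
      (Real.log (n : ℝ) + ((k : ℝ) - 1) * Real.log (Real.log (n : ℝ)) + β n) / (n : ℝ))
    (hlim : Tendsto β atTop (𝓝 βstar)) :
    Tendsto (fun n : ℕ => SecureNetwork.probKConnected n (K n) (P n) (p n) k) atTop
      (𝓝 (Real.exp (-(Real.exp (-βstar) / ((k - 1)! : ℝ))))) := by
  have hR := SecureNetwork.regime_of_scaling hk hP hK hβ hlim
  refine hR.tendsto_isKConnected.congr' ?_
  filter_upwards [hR.K_le] with n hn
  rw [SecureNetwork.probKConnected, SecureNetwork.networkMeasure_real hn, Nat.sub_add_cancel hk]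
  rfl
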